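/- All logarithms and entropies are to base $2$; $H_b(q)=-q\log q-(1-q)\log(1-q)$. Let $\mathcal S,\mathcal Y$ be finite, $P_S$ a distribution on $\mathcal S$, $P_{Y|S,X}$ a memoryless channel with state $s\in\mathcal S$, input $x\in\mathbb F_2$ and output in $\mathcal Y$, and $R>0$. **The code.** For $\mathbf q\in[0,1]^n$, $\mathbf u\in\mathbb F_2^n$ put $w_{\mathbf q}(\mathbf u)=\prod_i q_i^{u_i}(1-q_i)^{1-u_i}$, and for an invertible $\mathbf H\in\mathbb F_2^{n\times n}$ let $f_{\mathbf H}(\mathbf p,\mathbf q)\in\operatorname{argmax}_{\mathbf x\in\mathbb F_2^n}w_{\mathbf p}(\mathbf x)\,w_{\mathbf q}(\mathbf x\mathbf H^T)$, ties being broken in an arbitrary fixed way. Let $k=\lfloor nR\rfloor$. Given functions $p_e:\mathcal S\to[0,1]$, $p_d:\mathcal Y\to[0,1]$ and a finitely supported distribution $P_Q$ on $[0,1]$ that is symmetric about $1/2$, the weighted parity-check code is as follows. The encoder and the decoder share $\mathbf H$, uniform on the invertible $n\times n$ matrices over $\mathbb F_2$, and $\mathbf q=(q_1,\dots,q_{n-k})$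 with $q_i\sim P_Q$ i.i.d. The message $\mathbf m$ is uniform on $\mathbb F_2^k$, the state sequence $\mathbf s$ is i.i.d. $\sim P_S$, and $\mathbf H,\mathbf q,\mathbf m,\mathbf s$ are independent. The encoder sends $\mathbf x=f_{\mathbf H}([p_e(s_1),\dots,p_e(s_n)],[\mathbf m,\mathbf q])$; the decoder receives $\mathbf y$, forms $\hat{\mathbf x}=f_{\mathbf H}([p_d(y_1),\dots,p_d(y_n)],[\tfrac12,\dots,\tfrac12,\mathbf q])$, and outputs the first $k$ bits $\hat{\mathbf m}$ of $\hat{\mathbf x}\mathbf H^T$. **(1)** Let $P_{X|S}$ be a conditional distribution on $\mathbb F_2$ given $\mathcal S$, let $(S,X,Y)\sim P_SP_{X|S}P_{Y|S,X}$, and take $p_e(s)=P_{X|S}(1|s)$, $p_d(y)=P_{X|Y}(1|y)$. Suppose that $$\mathbf E[H_b(Q)]=\frac{1-H(X|S)}{1-R},\qquad R<I(X;Y)-I(X;S).$$ Exclude the degenerate case in which both $P_{X|S}(1|S)$ and $Q$ take values only in $\{0,\tfrac12,1\}$ (almost surely) and $P_{X|S}(1|S)\in\{0,1\}$ with positive probability.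 Then, as $n\to\infty$, the error probability $\mathbf P(\hat{\mathbf m}\ne\mathbf m)$ tends to $0$, and the empirical joint distribution of $\{(s_i,x_i)\}_{i\le n}$ tends to $P_SP_{X|S}$ in probability. **(2)** Consequently the code achieves the Gelfand–Pinsker rate with binary auxiliary: for a memoryless state channel $P_{Y|S,A}$ with any input alphabet $\mathcal A$, if $R<\sup\,(I(U;Y)-I(U;S))$, the supremum being over $P_{U|S}$ with $U\in\mathbb F_2$ and maps $g:\mathbb F_2\times\mathcal S\to\mathcal A$ (channel input $g(U,S)$), then there are $P_{U|S}$, $g$ and $P_Q$ as above with $\mathbf E[H_b(Q)]=(1-H(U|S))/(1-R)$ for which the code for the channel $P_{Y|S,A}(\cdot|s,g(u,s))$ (with $U$ in the role of $X$) has both properties in (1). This supremum is the Gelfand–Pinsker capacity whenever a binary auxiliary is optimal. **(3)** In particular, for any (possibly asymmetric) binary-input channel $P_{Y|X}$ without state and any $R<\sup_{P_X}I(X;Y)$, there are $P_X$ and $P_Q$ as above with $\mathbf E[H_b(Q)]=(1-H(X))/(1-R)$ for which the code (with constant state) has both properties in (1). -/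

import Mathlib

namespace WPC

/-! ### Finite distributions and information quantities (logarithms to base 2)

A distribution on a finite type `A` is an element of `stdSimplex ℝ A`. -/

/-- A channel (conditional distribution) from `A` to the finite alphabet `B`. -/
def IsKernel {A B : Type*} [Fintype B] (K : A → B → ℝ) : Prop :=
  ∀ a, K a ∈ stdSimplex ℝ B

/-- A channel with state: the conditional distribution of the output given state and input. -/
def IsStateChannel {S A Y : Type*} [Fintype Y] (W : S → A → Y → ℝ) : Prop :=
  ∀ s, IsKernel (W s)

/-- Shannon entropy in bits. -/
noncomputable def entropy {A : Type*} [Fintype A] (p : A → ℝ) : ℝ :=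
  -∑ a, p a * Real.logb 2 (p a)

/-- `H(X|S) = ∑ₛ P_S(s) H(P_{X|S}(·|s))`. -/
noncomputable def condEntropy {S A : Type*} [Fintype S] [Fintype A]
    (PS : S → ℝ) (PX : S → A → ℝ) : ℝ :=
  ∑ s, PS s * entropy (PX s)

/-- Mutual information `H(A) + H(B) - H(A,B)` of a joint distribution `J` on `A × B`. -/
noncomputable def mutualInfo {A B : Type*} [Fintype A] [Fintype B] (J : A → B → ℝ) : ℝ :=
  entropy (fun a => ∑ b, J a b) + entropy (fun b => ∑ a, J a b)
    - entropy (fun ab : A × B => J ab.1 ab.2)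

/-- Joint distribution of `(X, S)`. -/
def jointXS {S U : Type*} (PS : S → ℝ) (PX : S → U → ℝ) : U → S → ℝ :=
  fun x s => PS s * PX s x

/-- Joint distribution of `(X, Y)` when `S ∼ P_S`, `X|S ∼ P_{X|S}`, `Y|(S,X) ∼ W`. -/
def jointXY {S U Y : Type*} [Fintype S] (PS : S → ℝ) (PX : S → U → ℝ)
    (W : S → U → Y → ℝ) : U → Y → ℝ :=
  fun x y => ∑ s, PS s * PX s x * W s x y

/-- The Gelfand–Pinsker rate `I(X;Y) - I(X;S)`. -/
noncomputable def gpRate {S U Y : Type*} [Fintype S] [Fintype U] [Fintype Y]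
    (PS : S → ℝ) (PX : S → U → ℝ) (W : S → U → Y → ℝ) : ℝ :=
  mutualInfo (jointXY PS PX W) - mutualInfo (jointXS PS PX)

/-- The channel seen by an auxiliary letter `u` when the physical input is `g u s`. -/
def auxChannel {S U A Y : Type*} (W : S → A → Y → ℝ) (g : U → S → A) : S → U → Y → ℝ :=
  fun s u => W s (g u s)

/-- The Gelfand–Pinsker expression `sup (I(U;Y) - I(U;S))` for the state channel `W`, the
supremum being over `P_{U|S}` and `x = g(u,s)` with `U` ranging in the alphabet `U`. -/
noncomputable def gelfandPinsker (U : Type*) {S A Y : Type*} [Fintype S] [Fintype U] [Fintype Y]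
    (PS : S → ℝ) (W : S → A → Y → ℝ) : ℝ :=
  sSup {r | ∃ (PU : S → U → ℝ) (g : U → S → A), IsKernel PU ∧ r = gpRate PS PU (auxChannel W g)}

/-- The Shannon capacity `sup I(X;Y)` of a (possibly asymmetric) channel without state. -/
noncomputable def shannonCapacity {A Y : Type*} [Fintype A] [Fintype Y] (W : A → Y → ℝ) : ℝ :=
  sSup {r | ∃ PX ∈ stdSimplex ℝ A, r = mutualInfo (fun x y => PX x * W x y)}

/-! ### The parity bias distribution -/

/-- `P_Q` (given by its finitely supported mass function) is a probability distribution on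
`[0,1]` which is symmetric about `1/2`. -/
structure IsParityBias (PQ : ℝ →₀ ℝ) : Prop where
  nonneg : ∀ q, 0 ≤ PQ q
  support_subset : ∀ q ∈ PQ.support, q ∈ Set.Icc (0 : ℝ) 1
  sum_eq_one : ∑ q ∈ PQ.support, PQ q = 1
  symm : ∀ q, PQ (1 - q) = PQ q

/-- `E[H_b(Q)]` in bits, for `Q ∼ P_Q`. -/
noncomputable def meanBinEntropy (PQ : ℝ →₀ ℝ) : ℝ :=
  ∑ q ∈ PQ.support, PQ q * (Real.binEntropy q / Real.log 2)

/-- Either some codeword bias `P_{X|S}(1|s)` or some parity bias is outside `{0, 1/2, 1}`,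
or no codeword bias is `0` or `1` (only `s`, `q` of positive probability count). -/
def NonDegenerate {S : Type*} (PS : S → ℝ) (PX : S → ZMod 2 → ℝ) (PQ : ℝ →₀ ℝ) : Prop :=
  (∃ s, PS s ≠ 0 ∧ PX s 1 ∉ ({0, 1 / 2, 1} : Set ℝ)) ∨
  (∃ q ∈ PQ.support, q ∉ ({0, 1 / 2, 1} : Set ℝ)) ∨
  (∀ s, PS s ≠ 0 → PX s 1 ∉ ({0, 1} : Set ℝ))

/-! ### Weighted parity-check codes -/

/-- The `q`-weight `∏ᵢ qᵢ^{uᵢ} (1-qᵢ)^{1-uᵢ}`. -/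
noncomputable def weight {n : ℕ} (q : Fin n → ℝ) (u : Fin n → ZMod 2) : ℝ :=
  ∏ i, if u i = 1 then q i else 1 - q i

/-- `x Hᵀ`. -/
def parity {n : ℕ} (H : GL (Fin n) (ZMod 2)) (x : Fin n → ZMod 2) : Fin n → ZMod 2 :=
  Matrix.vecMul x (Matrix.transpose (H : Matrix (Fin n) (Fin n) (ZMod 2)))

/-- Candidate query functions `f_H(p, q)`, for all blocklengths. -/
abbrev Query : Type :=
  (n : ℕ) → GL (Fin n) (ZMod 2) → (Fin n → ℝ) → (Fin n → ℝ) → (Fin n → ZMod 2)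

/-- `f_H(p, q)` is a maximizer of `w_p(x) w_q(x Hᵀ)`; ties may be broken in any way. -/
def IsQuery (f : Query) : Prop :=
  ∀ (n : ℕ) (H : GL (Fin n) (ZMod 2)) (p q : Fin n → ℝ) (x : Fin n → ZMod 2),
    weight p x * weight q (parity H x) ≤
      weight p (f n H p q) * weight q (parity H (f n H p q))

/-- The concatenation `[a, b]` of length `n` of `a` of length `k` and `b` of length `n - k`. -/
def concat {n k : ℕ} (a : Fin k → ℝ) (b : Fin (n - k) → ℝ) : Fin n → ℝ :=
  fun i => if h : (i : ℕ) < k then a ⟨i, h⟩ else b ⟨i - k, by omega⟩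

/-- The encoder: `(m, s) ↦ f_H([p_e(s₁),…,p_e(sₙ)], [m, q])`. -/
noncomputable def encode {S : Type*} (f : Query) (pe : S → ℝ) {n k : ℕ}
    (H : GL (Fin n) (ZMod 2)) (q : Fin (n - k) → ℝ) (m : Fin k → ZMod 2) (s : Fin n → S) :
    Fin n → ZMod 2 :=
  f n H (fun i => pe (s i)) (concat (fun j => if m j = 1 then 1 else 0) q)

/-- The decoder: the first `k` bits of `x̂ Hᵀ`, where
`x̂ = f_H([p_d(y₁),…,p_d(yₙ)], [1/2,…,1/2, q])`. It is used with `k ≤ n` only. -/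
noncomputable def decode {Y : Type*} (f : Query) (pd : Y → ℝ) {n k : ℕ}
    (H : GL (Fin n) (ZMod 2)) (q : Fin (n - k) → ℝ) (y : Fin n → Y) : Fin k → ZMod 2 :=
  fun j => if h : (j : ℕ) < n then
    parity H (f n H (fun i => pd (y i)) (concat (fun _ : Fin k => 1 / 2) q)) ⟨j, h⟩
  else 0

open Classical in
/-- Probability that `E m m̂ s x` holds when the message `m` is uniform on `𝔽₂ᵏ`, `H` is uniform
on the full-rank matrices, `qᵢ ∼ P_Q` i.i.d., `sᵢ ∼ P_S` i.i.d. (all independent), `x` is the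
codeword, `y` is the output of the memoryless channel `W` and `m̂` is the decoded message. -/
noncomputable def codeProb {S Y : Type*} [Fintype S] [Fintype Y] (f : Query)
    (PS : S → ℝ) (W : S → ZMod 2 → Y → ℝ) (PQ : ℝ →₀ ℝ) (pe : S → ℝ) (pd : Y → ℝ) (n k : ℕ)
    (E : (Fin k → ZMod 2) → (Fin k → ZMod 2) → (Fin n → S) → (Fin n → ZMod 2) → Prop) : ℝ :=
  ∑ m : Fin k → ZMod 2, ∑ H : GL (Fin n) (ZMod 2),
    ∑ q ∈ Fintype.piFinset (fun _ : Fin (n - k) => PQ.support), ∑ s : Fin n → S,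
      ∑ y : Fin n → Y,
        (1 / 2 ^ k) * (1 / (Fintype.card (GL (Fin n) (ZMod 2)) : ℝ)) * (∏ j, PQ (q j)) *
          (∏ i, PS (s i)) * (∏ i, W (s i) (encode f pe H q m s i) (y i)) *
          (if E m (decode f pd H q y) s (encode f pe H q m s) then 1 else 0)

/-- The empirical joint distribution of `(sᵢ, xᵢ)`, `i = 1, …, n`. -/
noncomputable def empirical {S : Type*} [DecidableEq S] {n : ℕ} (s : Fin n → S) (x : Fin n → ZMod 2)
    (a : S) (b : ZMod 2) : ℝ :=
  ((Finset.univ.filter (fun i => s i = a ∧ x i = b)).card : ℝ) / n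

/-- Codeword bias of the encoder: `p_e(s) = P_{X|S}(1|s)`. -/
def encBias {S : Type*} (PX : S → ZMod 2 → ℝ) : S → ℝ := fun s => PX s 1

/-- Codeword bias of the decoder: `p_d(y) = P_{X|Y}(1|y)` (`0` where `P_Y(y) = 0`). -/
noncomputable def decBias {S Y : Type*} [Fintype S] (PS : S → ℝ) (PX : S → ZMod 2 → ℝ)
    (W : S → ZMod 2 → Y → ℝ) : Y → ℝ :=
  fun y => jointXY PS PX W 1 y / ∑ x, jointXY PS PX W x y

/-- With message length `k = ⌊nR⌋`, `p_e = P_{X|S}(1|·)`, `p_d = P_{X|Y}(1|·)` and any tie-breaking,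
the error probability of the weighted parity-check code tends to `0`, and the empirical joint
distribution of `(sᵢ, xᵢ)` tends to `P_S P_{X|S}` in probability. -/
def Reliable {S Y : Type*} [Fintype S] [DecidableEq S] [Fintype Y] (R : ℝ)
    (PS : S → ℝ) (PX : S → ZMod 2 → ℝ) (W : S → ZMod 2 → Y → ℝ) (PQ : ℝ →₀ ℝ) : Prop :=
  ∀ f : Query, IsQuery f →
    Filter.Tendsto
      (fun n : ℕ => codeProb f PS W PQ (encBias PX) (decBias PS PX W) n ⌊(n : ℝ) * R⌋₊
        (fun m m' _ _ => m ≠ m'))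
      Filter.atTop (nhds 0) ∧
    ∀ ε : ℝ, 0 < ε → Filter.Tendsto
      (fun n : ℕ => codeProb f PS W PQ (encBias PX) (decBias PS PX W) n ⌊(n : ℝ) * R⌋₊
        (fun _ _ s x => ∃ a b, ε ≤ |empirical s x a b - PS a * PX a b|))
      Filter.atTop (nhds 0)

end WPC

namespace WPC

open Finset Filter Topology

/-! ### The uniform distribution on `GL_n(𝔽₂)` -/

/-! Work in nats. The hypothesis on `P_Q` is the balance H(X|S) + (1-R) E[H_b(Q)] = log 2: about 2ⁿ
pairs (x, v), with v a value of the n - k parity bits, are typical for the biases, each of weight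
about 2⁻ⁿ. For a fixed message such a pair prescribes one full parity vector, and a random
invertible matrix hits a given pair with probability about 2⁻ⁿ. The encoder is therefore exactly at
the threshold of finding a typical solution, and the proof shows that it reaches weight θ = 2⁻ⁿ
exp(-δn) for every δ > 0.

Encoder. Distinct nonzero vectors over 𝔽₂ are linearly independent, so their parities are almost
pairwise independent and a second moment argument (`avgGL_forall_notMem_le`) finds a solution in any
set of pairs much larger than 2ⁿ. To get above the threshold, the biases are tilted slightly towards
1/2, in the analysis only: the entropy rises strictly above log 2, while the cross entropy, which
governs the original weight of a tilted-typical pair, stays below log 2 + δ (`avgGL_fail_le`,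
`failProb_of_exists`). Tilting achieves nothing when all biases lie in {0, 1/2, 1}; the remaining
non-degenerate case is solved exactly (`failProb_of_half`).

Change of measure. Once the maximizer has weight at least θ, the probability of an event at the
encoder's output is at most its expected total over all x of weight at least θ. By Markov's
inequality this is at most 1/(θ(2ⁿ-1)) ≤ 2 exp(δn) times its probability when x and the parities are
drawn independently from the biases (`firstMoment_le`). The events of interest are exponentially
rare there by `chernoff`, so a small δ suffices. This gives the empirical law, and a large decoder
weight for the transmitted x.

Decoder. The expected number of competing pairs is controlled in the same way (`pairMoment_le`),
with exponent R - (I(X;Y) - I(X;S)) up to arbitrarily small terms. The zero vector, whose parity is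
not random, is treated apart by the symmetry of `P_Q` (`sum_bias_weight_zero`).

Claims (2) and (3) follow by choosing near-optimal distributions and a two-point `P_Q`
(`exists_parityBias`). -/

lemma parity_eq_mulVec {n : ℕ} (H : GL (Fin n) (ZMod 2)) (x : Fin n → ZMod 2) :
    parity H x = Matrix.mulVec (H : Matrix (Fin n) (Fin n) (ZMod 2)) x :=
  Matrix.vecMul_transpose _ _

lemma parity_mul {n : ℕ} (g H : GL (Fin n) (ZMod 2)) (x : Fin n → ZMod 2) :
    parity (g * H) x = parity g (parity H x) := by
  simp [parity_eq_mulVec, Matrix.mulVec_mulVec]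

lemma parity_one {n : ℕ} (x : Fin n → ZMod 2) : parity 1 x = x := by
  simp [parity_eq_mulVec]

lemma parity_zero {n : ℕ} (H : GL (Fin n) (ZMod 2)) : parity H 0 = 0 := by
  simp [parity_eq_mulVec]

lemma parity_inv_parity {n : ℕ} (H : GL (Fin n) (ZMod 2)) (x : Fin n → ZMod 2) :
    parity H⁻¹ (parity H x) = x := by
  rw [← parity_mul, inv_mul_cancel, parity_one]

lemma parity_parity_inv {n : ℕ} (H : GL (Fin n) (ZMod 2)) (x : Fin n → ZMod 2) :
    parity H (parity H⁻¹ x) = x := by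
  rw [← parity_mul, mul_inv_cancel, parity_one]

lemma parity_injective {n : ℕ} (H : GL (Fin n) (ZMod 2)) : Function.Injective (parity H) :=
  Function.LeftInverse.injective (parity_inv_parity H)

lemma parity_ne_zero {n : ℕ} (H : GL (Fin n) (ZMod 2)) {x : Fin n → ZMod 2} (hx : x ≠ 0) :
    parity H x ≠ 0 := by
  intro h
  exact hx (parity_injective H (h.trans (parity_zero H).symm))

/-- The isomorphism between the spans extends to the whole space, because complements of the two
spans have equal finite dimension. -/
lemma exists_parity_eq {n : ℕ} {ι : Type*} [Finite ι] {v w : ι → Fin n → ZMod 2}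
    (hv : LinearIndependent (ZMod 2) v) (hw : LinearIndependent (ZMod 2) w) :
    ∃ H : GL (Fin n) (ZMod 2), ∀ i, parity H (v i) = w i := by
  let f := hv.linearCombinationEquiv.symm ≪≫ₗ hw.linearCombinationEquiv
  have : FiniteDimensional (ZMod 2) (Submodule.span (ZMod 2) (Set.range v)) :=
    FiniteDimensional.span_of_finite _ (Set.finite_range _)
  obtain ⟨g, hg⟩ := Submodule.exists_linearEquiv_restrict_eq f
  refine ⟨Matrix.GeneralLinearGroup.toLin.symm (LinearMap.GeneralLinearGroup.ofLinearEquiv g),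
    fun i => ?_⟩
  have h1 := hg ⟨v i, Submodule.subset_span ⟨i, rfl⟩⟩
  have h2 : f ⟨v i, Submodule.subset_span ⟨i, rfl⟩⟩ = ⟨w i, Submodule.subset_span ⟨i, rfl⟩⟩ := by
    have : (⟨v i, Submodule.subset_span ⟨i, rfl⟩⟩ : Submodule.span (ZMod 2) (Set.range v)) =
        hv.linearCombinationEquiv (Finsupp.single i 1) := by
      ext1; simp
    simp only [f, this, LinearEquiv.trans_apply, LinearEquiv.symm_apply_apply]
    ext1; simp
  rw [h2] at h1
  rw [parity_eq_mulVec, ← Matrix.mulVecLin_apply, ← Matrix.GeneralLinearGroup.coe_toLin,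
    MulEquiv.apply_symm_apply]
  exact h1.symm

/-- Left multiplication by a matrix carrying `w` to `w'` is a bijection between the two sets. Hence
the images of fixed vectors are uniform over independent families. -/
lemma card_parity_eq_congr {n : ℕ} {ι : Type*} [Fintype ι] {v w w' : ι → Fin n → ZMod 2}
    (hw : LinearIndependent (ZMod 2) w) (hw' : LinearIndependent (ZMod 2) w') :
    #{H : GL (Fin n) (ZMod 2) | ∀ i, parity H (v i) = w i} =
      #{H : GL (Fin n) (ZMod 2) | ∀ i, parity H (v i) = w' i} := by
  obtain ⟨g, hg⟩ := exists_parity_eq hw hw'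
  refine Finset.card_bij (fun H _ => g * H) ?_ ?_ ?_
  · intro H hH
    simp only [mem_filter, mem_univ, true_and] at hH ⊢
    intro i
    rw [parity_mul, hH, hg]
  · intro a _ b _ h
    exact mul_left_cancel h
  · intro H hH
    simp only [mem_filter, mem_univ, true_and] at hH
    refine ⟨g⁻¹ * H, ?_, by simp⟩
    simp only [mem_filter, mem_univ, true_and]
    intro i
    rw [parity_mul, hH, ← hg, parity_inv_parity]

lemma zmod_two_eq_one_of_ne_zero {a : ZMod 2} (h : a ≠ 0) : a = 1 := by
  revert a; decide

/-- The only nonzero scalar is 1, so distinctness already excludes proportionality. This is what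
makes the parities of any two distinct nonzero vectors almost independent. -/
lemma linearIndependent_pair_of_ne {n : ℕ} {x y : Fin n → ZMod 2} (hx : x ≠ 0) (hy : y ≠ 0)
    (hxy : x ≠ y) : LinearIndependent (ZMod 2) ![x, y] := by
  rw [LinearIndependent.pair_iff' hx]
  intro a h
  by_cases ha : a = 0
  · simp [ha] at h; exact hy h.symm
  · rw [zmod_two_eq_one_of_ne_zero ha, one_smul] at h
    exact hxy h

/-- The number of nonzero vectors of `𝔽₂ⁿ`, as a real number. -/
noncomputable def numNonzero (n : ℕ) : ℝ := 2 ^ n - 1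

lemma card_ne_zero (n : ℕ) : (#{z : Fin n → ZMod 2 | z ≠ 0} : ℝ) = numNonzero n := by
  have h : #{z : Fin n → ZMod 2 | z ≠ 0} + 1 = 2 ^ n := by
    have := Finset.card_erase_add_one (Finset.mem_univ (0 : Fin n → ZMod 2))
    rw [Finset.card_univ, Fintype.card_pi] at this
    simp only [ZMod.card, prod_const, card_univ, Fintype.card_fin] at this
    rw [← this]
    congr 2
    ext; simp
  have h' := congrArg (Nat.cast (R := ℝ)) h
  push_cast at h'
  rw [numNonzero]; linarith

/-- The fibres of H ↦ xHᵀ over the nonzero vectors all have the same size and partition the group.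
-/
lemma card_parity_eq {n : ℕ} {x z : Fin n → ZMod 2} (hx : x ≠ 0) (hz : z ≠ 0) :
    (#{H : GL (Fin n) (ZMod 2) | parity H x = z} : ℝ) * numNonzero n =
      Fintype.card (GL (Fin n) (ZMod 2)) := by
  have hli : ∀ u : Fin n → ZMod 2, u ≠ 0 →
      LinearIndependent (ZMod 2) (fun _ : Unit => u) := fun u hu =>
    linearIndependent_unique_iff.2 hu
  have hconst : ∀ u : Fin n → ZMod 2, u ≠ 0 → #{H : GL (Fin n) (ZMod 2) | parity H x = u} =
      #{H : GL (Fin n) (ZMod 2) | parity H x = z} := by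
    intro u hu
    have := card_parity_eq_congr (v := fun _ : Unit => x) (hli u hu) (hli z hz)
    simpa using this
  have h := Finset.card_eq_sum_card_fiberwise (s := (univ : Finset (GL (Fin n) (ZMod 2))))
    (t := {u : Fin n → ZMod 2 | u ≠ 0}) (f := fun H => parity H x)
    (fun H _ => by simpa using parity_ne_zero H hx)
  rw [Finset.sum_congr rfl (fun u hu => hconst u (by simpa using hu)), Finset.sum_const,
    smul_eq_mul, card_univ] at h
  rw [← card_ne_zero, mul_comm]
  exact_mod_cast h.symm

lemma card_pair_ne (n : ℕ) :
    (#{z : (Fin n → ZMod 2) × (Fin n → ZMod 2) | z.1 ≠ 0 ∧ z.2 ≠ 0 ∧ z.1 ≠ z.2} : ℝ) =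
      numNonzero n * (numNonzero n - 1) := by
  have h := Finset.offDiag_card ({z : Fin n → ZMod 2 | z ≠ 0} : Finset _)
  have h2 : ({z : Fin n → ZMod 2 | z ≠ 0} : Finset _).offDiag =
      ({z : (Fin n → ZMod 2) × (Fin n → ZMod 2) | z.1 ≠ 0 ∧ z.2 ≠ 0 ∧ z.1 ≠ z.2} : Finset _) := by
    ext; simp [Finset.mem_offDiag]
  rw [h2] at h
  rw [h, Nat.cast_sub (Nat.le_mul_self _)]
  push_cast
  rw [card_ne_zero]; ring

lemma card_parity_eq_pair {n : ℕ} {x x' z z' : Fin n → ZMod 2} (hx : x ≠ 0) (hx' : x' ≠ 0)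
    (hxx : x ≠ x') (hz : z ≠ 0) (hz' : z' ≠ 0) (hzz : z ≠ z') :
    (#{H : GL (Fin n) (ZMod 2) | parity H x = z ∧ parity H x' = z'} : ℝ) *
      (numNonzero n * (numNonzero n - 1)) = Fintype.card (GL (Fin n) (ZMod 2)) := by
  have hconst : ∀ u : (Fin n → ZMod 2) × (Fin n → ZMod 2), u.1 ≠ 0 ∧ u.2 ≠ 0 ∧ u.1 ≠ u.2 →
      #{H : GL (Fin n) (ZMod 2) | (parity H x, parity H x') = u} =
      #{H : GL (Fin n) (ZMod 2) | parity H x = z ∧ parity H x' = z'} := by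
    intro u hu
    have := card_parity_eq_congr (v := ![x, x']) (linearIndependent_pair_of_ne hu.1 hu.2.1 hu.2.2)
      (linearIndependent_pair_of_ne hz hz' hzz)
    simpa [Fin.forall_fin_two, Prod.ext_iff] using this
  have h := Finset.card_eq_sum_card_fiberwise (s := (univ : Finset (GL (Fin n) (ZMod 2))))
    (t := {z : (Fin n → ZMod 2) × (Fin n → ZMod 2) | z.1 ≠ 0 ∧ z.2 ≠ 0 ∧ z.1 ≠ z.2})
    (f := fun H => (parity H x, parity H x'))
    (fun H _ => by
      simpa using ⟨parity_ne_zero H hx, parity_ne_zero H hx', fun h => hxx (parity_injective H h)⟩)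
  rw [Finset.sum_congr rfl (fun u hu => hconst u (by simpa using hu)), Finset.sum_const,
    smul_eq_mul, card_univ] at h
  rw [← card_pair_ne, mul_comm]
  exact_mod_cast h.symm

/-- Expectation over the uniform distribution on `GL_n(𝔽₂)`. -/
noncomputable def avgGL (n : ℕ) (F : GL (Fin n) (ZMod 2) → ℝ) : ℝ :=
  (1 / (Fintype.card (GL (Fin n) (ZMod 2)) : ℝ)) * ∑ H, F H

lemma card_GL_pos (n : ℕ) : (0 : ℝ) < Fintype.card (GL (Fin n) (ZMod 2)) := by
  exact_mod_cast Fintype.card_pos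

lemma avgGL_mono {n : ℕ} {F G : GL (Fin n) (ZMod 2) → ℝ} (h : ∀ H, F H ≤ G H) :
    avgGL n F ≤ avgGL n G := by
  have := card_GL_pos n
  unfold avgGL
  gcongr with H
  exact h H

lemma avgGL_const (n : ℕ) (c : ℝ) : avgGL n (fun _ => c) = c := by
  have := card_GL_pos n
  simp only [avgGL, sum_const, card_univ, nsmul_eq_mul]
  field_simp

lemma avgGL_nonneg {n : ℕ} {F : GL (Fin n) (ZMod 2) → ℝ} (h : ∀ H, 0 ≤ F H) :
    0 ≤ avgGL n F := by
  rw [← avgGL_const n 0]; exact avgGL_mono h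

lemma avgGL_add (n : ℕ) (F G : GL (Fin n) (ZMod 2) → ℝ) :
    avgGL n (fun H => F H + G H) = avgGL n F + avgGL n G := by
  simp [avgGL, sum_add_distrib, mul_add]

lemma avgGL_mul_left (n : ℕ) (c : ℝ) (F : GL (Fin n) (ZMod 2) → ℝ) :
    avgGL n (fun H => c * F H) = c * avgGL n F := by
  simp only [avgGL, ← mul_sum]; ring

lemma avgGL_sum {n : ℕ} {ι : Type*} (s : Finset ι) (F : ι → GL (Fin n) (ZMod 2) → ℝ) :
    avgGL n (fun H => ∑ i ∈ s, F i H) = ∑ i ∈ s, avgGL n (F i) := by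
  simp only [avgGL, mul_sum]; rw [sum_comm]

lemma numNonzero_pos {n : ℕ} (hn : 2 ≤ n) : 1 < numNonzero n := by
  have : (2 : ℝ) ^ 2 ≤ 2 ^ n := pow_le_pow_right₀ (by norm_num) hn
  rw [numNonzero]; linarith

lemma avgGL_indicator {n : ℕ} (hn : 2 ≤ n) {x z : Fin n → ZMod 2} (hx : x ≠ 0) (hz : z ≠ 0) :
    avgGL n (fun H => if parity H x = z then 1 else 0) = 1 / numNonzero n := by
  have h1 := numNonzero_pos hn
  have h2 := card_GL_pos n
  have h := card_parity_eq hx hz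
  rw [avgGL, ← Finset.sum_filter, Finset.sum_const, nsmul_eq_mul, mul_one, ← h]
  have : (#{H : GL (Fin n) (ZMod 2) | parity H x = z} : ℝ) ≠ 0 := by
    intro h0; rw [h0] at h; linarith
  field_simp

lemma avgGL_indicator_pair {n : ℕ} (hn : 2 ≤ n) {x x' z z' : Fin n → ZMod 2} (hx : x ≠ 0)
    (hx' : x' ≠ 0) (hxx : x ≠ x') (hz : z ≠ 0) (hz' : z' ≠ 0) (hzz : z ≠ z') :
    avgGL n (fun H => if parity H x = z ∧ parity H x' = z' then 1 else 0) =
      1 / (numNonzero n * (numNonzero n - 1)) := by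
  have h1 := numNonzero_pos hn
  have h1' : 0 < numNonzero n - 1 := by linarith
  have h2 := card_GL_pos n
  have h := card_parity_eq_pair hx hx' hxx hz hz' hzz
  rw [avgGL, ← Finset.sum_filter, Finset.sum_const, nsmul_eq_mul, mul_one, ← h]
  have : (#{H : GL (Fin n) (ZMod 2) | parity H x = z ∧ parity H x' = z'} : ℝ) ≠ 0 := by
    intro h0; rw [h0] at h; linarith
  field_simp

/-- The parity of a nonzero vector is uniform on the nonzero vectors; the term z = 0 is added on the
right at no harm since `F` is nonnegative. -/
lemma avgGL_comp_parity_le {n : ℕ} (hn : 2 ≤ n) {x : Fin n → ZMod 2} (hx : x ≠ 0)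
    {F : (Fin n → ZMod 2) → ℝ} (hF : ∀ z, 0 ≤ F z) :
    avgGL n (fun H => F (parity H x)) ≤ (1 / numNonzero n) * ∑ z, F z := by
  have h1 := numNonzero_pos hn
  calc avgGL n (fun H => F (parity H x))
      = avgGL n (fun H => ∑ z, F z * (if parity H x = z then 1 else 0)) := by
        congr 1; ext H; simp
    _ = ∑ z, F z * avgGL n (fun H => if parity H x = z then 1 else 0) := by
        rw [avgGL_sum]; simp_rw [avgGL_mul_left]
    _ ≤ ∑ z, F z * (1 / numNonzero n) := by
        refine sum_le_sum fun z _ => mul_le_mul_of_nonneg_left ?_ (hF z)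
        by_cases hz : z = 0
        · subst hz
          simp only [parity_ne_zero _ hx, if_false, avgGL_const]
          positivity
        · rw [avgGL_indicator hn hx hz]
    _ = _ := by rw [← sum_mul, mul_comm]

lemma avgGL_comp_parity_pair_le {n : ℕ} (hn : 2 ≤ n) {x x' : Fin n → ZMod 2} (hx : x ≠ 0)
    (hx' : x' ≠ 0) (hxx : x ≠ x') {F G : (Fin n → ZMod 2) → ℝ} (hF : ∀ z, 0 ≤ F z)
    (hG : ∀ z, 0 ≤ G z) :
    avgGL n (fun H => F (parity H x) * G (parity H x')) ≤
      (1 / (numNonzero n * (numNonzero n - 1))) * ((∑ z, F z) * ∑ z, G z) := by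
  have h1 := numNonzero_pos hn
  have h1' : 0 < numNonzero n - 1 := by linarith
  calc avgGL n (fun H => F (parity H x) * G (parity H x'))
      = avgGL n (fun H => ∑ z, ∑ z', F z * G z' *
          (if parity H x = z ∧ parity H x' = z' then 1 else 0)) := by
        congr 1; ext H
        rw [Finset.sum_eq_single (parity H x), Finset.sum_eq_single (parity H x')]
        · simp
        · intro b _ hb; simp [hb.symm]
        · simp
        · intro b _ hb; simp [hb.symm]
        · simp
    _ = ∑ z, ∑ z', F z * G z' *
          avgGL n (fun H => if parity H x = z ∧ parity H x' = z' then 1 else 0) := by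
        simp_rw [avgGL_sum, avgGL_mul_left]
    _ ≤ ∑ z, ∑ z', F z * G z' * (1 / (numNonzero n * (numNonzero n - 1))) := by
        refine sum_le_sum fun z _ => sum_le_sum fun z' _ =>
          mul_le_mul_of_nonneg_left ?_ (mul_nonneg (hF z) (hG z'))
        by_cases hz : z ≠ 0 ∧ z' ≠ 0 ∧ z ≠ z'
        · rw [avgGL_indicator_pair hn hx hx' hxx hz.1 hz.2.1 hz.2.2]
        · have : ∀ H : GL (Fin n) (ZMod 2), ¬ (parity H x = z ∧ parity H x' = z') := by
            rintro H ⟨rfl, rfl⟩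
            exact hz ⟨parity_ne_zero H hx, parity_ne_zero H hx',
              fun h => hxx (parity_injective H h)⟩
          simp only [this, if_false, avgGL_const]
          positivity
    _ = _ := by
        simp_rw [← Finset.sum_mul, ← Finset.mul_sum]
        rw [← Finset.sum_mul, mul_comm]

/-- Second moment bound: a set `G` of pairs which is large compared to `2ⁿ` contains some
`(x, x Hᵀ)` with high probability. -/
lemma avgGL_forall_notMem_le {n : ℕ} (hn : 2 ≤ n)
    (G : Finset ((Fin n → ZMod 2) × (Fin n → ZMod 2)))
    (hG : ∀ a ∈ G, a.1 ≠ 0 ∧ a.2 ≠ 0) (hne : G.Nonempty) :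
    avgGL n (fun H => if ∀ x, (x, parity H x) ∉ G then 1 else 0) ≤
      numNonzero n / #G + 1 / (numNonzero n - 1) := by
  have h1 := numNonzero_pos hn
  set K := numNonzero n
  have h1' : 0 < K - 1 := by linarith
  have hK : 0 < K := by linarith
  set g : ℝ := (#G : ℝ) with hgdef
  have hg : 0 < g := by rw [hgdef]; exact_mod_cast hne.card_pos
  let ind : (Fin n → ZMod 2) × (Fin n → ZMod 2) → GL (Fin n) (ZMod 2) → ℝ :=
    fun a H => if parity H a.1 = a.2 then 1 else 0
  have hmean : avgGL n (fun H => ∑ a ∈ G, ind a H) = g / K := by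
    rw [avgGL_sum, Finset.sum_congr rfl (fun a ha => avgGL_indicator hn (hG a ha).1 (hG a ha).2),
      Finset.sum_const, nsmul_eq_mul]
    ring
  have hsq : avgGL n (fun H => (∑ a ∈ G, ind a H) * ∑ b ∈ G, ind b H) ≤
      g / K + g * g / (K * (K - 1)) := by
    have : avgGL n (fun H => (∑ a ∈ G, ind a H) * ∑ b ∈ G, ind b H) =
        ∑ a ∈ G, ∑ b ∈ G, avgGL n (fun H => ind a H * ind b H) := by
      simp_rw [Finset.sum_mul_sum, avgGL_sum]
    rw [this]
    have hb : ∀ a ∈ G, ∀ b ∈ G, avgGL n (fun H => ind a H * ind b H) ≤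
        (if a = b then 1 / K else 0) + 1 / (K * (K - 1)) := by
      intro a ha b hb
      have hp : ∀ H, ind a H * ind b H =
          if parity H a.1 = a.2 ∧ parity H b.1 = b.2 then 1 else 0 := by
        intro H; simp only [ind]; split_ifs <;> simp_all
      simp_rw [hp]
      by_cases hab : a = b
      · subst hab
        simp only [and_self, if_true]
        rw [avgGL_indicator hn (hG a ha).1 (hG a ha).2]
        have : 0 ≤ 1 / (K * (K - 1)) := by positivity
        linarith
      · simp only [hab, if_false, zero_add]
        -- Two different pairs agreeing in one coordinate exclude each other, since H acts as an
        -- injective function; only pairs differing in both coordinates contribute off the diagonal.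
        by_cases hab1 : a.1 = b.1 ∨ a.2 = b.2
        · have : ∀ H : GL (Fin n) (ZMod 2), ¬ (parity H a.1 = a.2 ∧ parity H b.1 = b.2) := by
            rintro H ⟨e1, e2⟩
            apply hab
            rcases hab1 with h | h
            · exact Prod.ext h (by rw [← e1, ← e2, h])
            · exact Prod.ext (parity_injective H (by rw [e1, e2, h])) h
          simp only [this, if_false, avgGL_const]
          positivity
        · push Not at hab1
          rw [avgGL_indicator_pair hn (hG a ha).1 (hG b hb).1 hab1.1 (hG a ha).2 (hG b hb).2 hab1.2]
    refine (sum_le_sum fun a ha => sum_le_sum fun b hb' => hb a ha b hb').trans ?_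
    simp only [sum_add_distrib, sum_const, nsmul_eq_mul]
    rw [Finset.sum_congr rfl (fun a ha => by rw [Finset.sum_ite_eq, if_pos ha])]
    simp only [sum_const, nsmul_eq_mul]
    rw [← hgdef]
    apply le_of_eq; ring
  -- Chebyshev's inequality: with Z the number of hits and μ = g/K its mean, μ² 1{Z = 0} ≤ (Z - μ)².
  have hpt : ∀ H, (g / K) * (g / K) * (if ∀ x, (x, parity H x) ∉ G then 1 else 0) ≤
      (∑ a ∈ G, ind a H) * (∑ b ∈ G, ind b H) + (-(2 * (g / K)) * (∑ a ∈ G, ind a H)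
        + (g / K) * (g / K)) := by
    intro H
    split_ifs with h
    · have : ∑ a ∈ G, ind a H = 0 := by
        refine Finset.sum_eq_zero fun a ha => ?_
        have : parity H a.1 ≠ a.2 := fun e => h a.1 (by rw [e]; exact ha)
        simp [ind, this]
      rw [this]; simp
    · nlinarith [sq_nonneg (∑ a ∈ G, ind a H - g / K)]
  have hfin := avgGL_mono hpt
  rw [avgGL_mul_left, avgGL_add, avgGL_add, avgGL_mul_left, hmean, avgGL_const] at hfin
  set p := avgGL n (fun H => if ∀ x, (x, parity H x) ∉ G then 1 else 0)
  have h3 : (g / K) * (g / K) * p ≤ g / K + g * g / (K * (K - 1)) - (g / K) * (g / K) := by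
    linarith
  have h4 : g / K + g * g / (K * (K - 1)) - (g / K) * (g / K) =
      (g / K) * (g / K) * (K / g + 1 / (K - 1)) := by
    field_simp
    ring
  rw [h4] at h3
  exact le_of_mul_le_mul_left h3 (by positivity)

/-! ### Large deviations for finite alphabets -/

/-- The first letter ranges over a `Finset` of an arbitrary type so that the large deviation bounds
also apply to parity biases, which are real numbers with finite support. -/
lemma sum_piFinset_sum_prod {A B : Type*} [Fintype B] (D : Finset A) (n : ℕ) (F : A → B → ℝ) :
    ∑ a ∈ Fintype.piFinset (fun _ : Fin n => D), ∑ b : Fin n → B, ∏ i, F (a i) (b i) =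
      (∑ a ∈ D, ∑ b, F a b) ^ n := by
  classical
  have h : ∀ a : Fin n → A, ∑ b : Fin n → B, ∏ i, F (a i) (b i) = ∏ i, ∑ b, F (a i) b := by
    intro a
    rw [Finset.prod_univ_sum, Fintype.piFinset_univ]
  simp_rw [h]
  rw [← Finset.prod_univ_sum (fun _ : Fin n => D) (fun _ a => ∑ b, F a b)]
  simp

/-- The left side equals 1 at t = 0 and has there the negative derivative E[φ] - c. -/
lemma exists_mgf_lt_one {ι : Type*} (D : Finset ι) (P φ : ι → ℝ)
    (h1 : ∑ a ∈ D, P a = 1) {c : ℝ} (hc : ∑ a ∈ D, P a * φ a < c) :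
    ∃ t : ℝ, 0 < t ∧ ∑ a ∈ D, P a * Real.exp (t * (φ a - c)) < 1 := by
  have hd : HasDerivAt (fun t : ℝ => ∑ a ∈ D, P a * Real.exp (t * (φ a - c)))
      (∑ a ∈ D, P a * (Real.exp (0 * (φ a - c)) * (1 * (φ a - c)))) 0 := by
    refine HasDerivAt.fun_sum fun a _ => ?_
    exact (((hasDerivAt_id (0 : ℝ)).mul_const (φ a - c)).exp).const_mul (P a)
  have hneg : ∑ a ∈ D, P a * (Real.exp (0 * (φ a - c)) * (1 * (φ a - c))) < 0 := by
    have : ∀ a, P a * (Real.exp (0 * (φ a - c)) * (1 * (φ a - c))) = P a * φ a - P a * c := by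
      intro a; simp; ring
    simp_rw [this, sum_sub_distrib, ← sum_mul, h1]
    linarith
  have hs := hd.tendsto_slope_zero_right
  have he := (hs.eventually (gt_mem_nhds hneg)).and self_mem_nhdsWithin
  obtain ⟨t, ht, htpos⟩ := he.exists
  refine ⟨t, htpos, ?_⟩
  simp only [zero_add, smul_eq_mul, zero_mul, Real.exp_zero, mul_one, h1] at ht
  have htpos' : 0 < t := htpos
  by_contra hcon
  push Not at hcon
  have : 0 ≤ t⁻¹ * (∑ a ∈ D, P a * Real.exp (t * (φ a - c)) - 1) :=
    mul_nonneg (inv_nonneg.2 htpos'.le) (by linarith)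
  linarith

/-- Chernoff bound for sums of i.i.d. variables with values in a finite alphabet. -/
lemma chernoff {A B : Type*} [Fintype B] (D : Finset A) (P φ : A → B → ℝ)
    (h0 : ∀ a b, 0 ≤ P a b) (h1 : ∑ a ∈ D, ∑ b, P a b = 1) {c : ℝ}
    (hc : ∑ a ∈ D, ∑ b, P a b * φ a b < c) :
    ∃ r : ℝ, 0 < r ∧ ∀ n : ℕ, ∑ a ∈ Fintype.piFinset (fun _ : Fin n => D), ∑ b : Fin n → B,
      (∏ i, P (a i) (b i)) * (if n * c ≤ ∑ i, φ (a i) (b i) then 1 else 0) ≤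
        Real.exp (-(r * n)) := by
  classical
  obtain ⟨t, ht, hlt⟩ := exists_mgf_lt_one (D ×ˢ (univ : Finset B)) (fun ab => P ab.1 ab.2)
    (fun ab => φ ab.1 ab.2) (by rw [sum_product]; exact h1) (c := c) (by rw [sum_product]; exact hc)
  rw [sum_product] at hlt
  simp only at hlt
  set M := ∑ a ∈ D, ∑ b, P a b * Real.exp (t * (φ a b - c)) with hM
  have hMpos : 0 < M := by
    have hne : ∃ a ∈ D, ∃ b, P a b ≠ 0 := by
      by_contra hcon
      push Not at hcon
      rw [Finset.sum_eq_zero (fun a ha => Finset.sum_eq_zero fun b _ => hcon a ha b)] at h1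
      norm_num at h1
    obtain ⟨a, ha, b, hb⟩ := hne
    refine Finset.sum_pos' (fun a _ => Finset.sum_nonneg fun b _ =>
      mul_nonneg (h0 a b) (Real.exp_pos _).le) ⟨a, ha, ?_⟩
    refine Finset.sum_pos' (fun b _ => mul_nonneg (h0 a b) (Real.exp_pos _).le)
      ⟨b, mem_univ b, mul_pos (lt_of_le_of_ne (h0 a b) hb.symm) (Real.exp_pos _)⟩
  refine ⟨-Real.log M, by have := Real.log_neg hMpos hlt; linarith, fun n => ?_⟩
  have hexp : Real.exp (-(-Real.log M * n)) = M ^ n := by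
    rw [show -(-Real.log M * n) = n * Real.log M by ring, Real.exp_nat_mul, Real.exp_log hMpos]
  rw [hexp, hM, ← sum_piFinset_sum_prod]
  refine sum_le_sum fun a _ => sum_le_sum fun b _ => ?_
  rw [Finset.prod_mul_distrib]
  refine mul_le_mul_of_nonneg_left ?_ (Finset.prod_nonneg fun i _ => h0 _ _)
  rw [← Real.exp_sum, ← Finset.mul_sum, sum_sub_distrib]
  simp only [sum_const, card_univ, Fintype.card_fin, nsmul_eq_mul]
  split_ifs with h
  · exact Real.one_le_exp (mul_nonneg ht.le (by linarith))
  · exact (Real.exp_pos _).le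

/-- A product of letters of an i.i.d. sequence is at least `exp (-n c)`, up to exponentially small
probability, when the mean of `-log` is less than `c`. -/
lemma chernoff_prod_lt {A B : Type*} [Fintype B] (D : Finset A) (P g : A → B → ℝ)
    (h0 : ∀ a b, 0 ≤ P a b) (h1 : ∑ a ∈ D, ∑ b, P a b = 1)
    (hg : ∀ a ∈ D, ∀ b, P a b ≠ 0 → 0 < g a b) {c : ℝ}
    (hc : ∑ a ∈ D, ∑ b, P a b * -Real.log (g a b) < c) :
    ∃ r : ℝ, 0 < r ∧ ∀ n : ℕ, ∑ a ∈ Fintype.piFinset (fun _ : Fin n => D), ∑ b : Fin n → B,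
      (∏ i, P (a i) (b i)) * (if ∏ i, g (a i) (b i) < Real.exp (-(n * c)) then 1 else 0) ≤
        Real.exp (-(r * n)) := by
  obtain ⟨r, hr, h⟩ := chernoff D P (fun a b => -Real.log (g a b)) h0 h1 hc
  refine ⟨r, hr, fun n => (sum_le_sum fun a ha => sum_le_sum fun b _ => ?_).trans (h n)⟩
  -- Positivity of `g` is known only on letters of positive probability, so the logarithm of the
  -- product may be expanded only off the null sequences.
  by_cases hz : ∏ i, P (a i) (b i) = 0
  · rw [hz]; simp
  refine mul_le_mul_of_nonneg_left ?_ (Finset.prod_nonneg fun i _ => h0 _ _)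
  have hpos : ∀ i, 0 < g (a i) (b i) := fun i =>
    hg _ (Fintype.mem_piFinset.1 ha i) _ (Finset.prod_ne_zero_iff.1 hz i (mem_univ i))
  by_cases hlt : ∏ i, g (a i) (b i) < Real.exp (-(n * c))
  · rw [if_pos hlt, if_pos]
    rw [← Real.log_lt_iff_lt_exp (Finset.prod_pos fun i _ => hpos i),
      Real.log_prod (fun i _ => (hpos i).ne')] at hlt
    rw [Finset.sum_neg_distrib]
    linarith
  · rw [if_neg hlt]; split_ifs <;> norm_num

/-- A product of letters of an i.i.d. sequence is at most `exp (-n c)`, up to exponentially small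
probability, when the mean of `-log` is greater than `c`. -/
lemma chernoff_lt_prod {A B : Type*} [Fintype B] (D : Finset A) (P g : A → B → ℝ)
    (h0 : ∀ a b, 0 ≤ P a b) (h1 : ∑ a ∈ D, ∑ b, P a b = 1)
    (hg : ∀ a ∈ D, ∀ b, P a b ≠ 0 → 0 < g a b) {c : ℝ}
    (hc : c < ∑ a ∈ D, ∑ b, P a b * -Real.log (g a b)) :
    ∃ r : ℝ, 0 < r ∧ ∀ n : ℕ, ∑ a ∈ Fintype.piFinset (fun _ : Fin n => D), ∑ b : Fin n → B,
      (∏ i, P (a i) (b i)) * (if Real.exp (-(n * c)) < ∏ i, g (a i) (b i) then 1 else 0) ≤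
        Real.exp (-(r * n)) := by
  obtain ⟨r, hr, h⟩ := chernoff D P (fun a b => Real.log (g a b)) h0 h1 (c := -c)
    (by simp only [mul_neg, Finset.sum_neg_distrib] at hc; linarith)
  refine ⟨r, hr, fun n => (sum_le_sum fun a ha => sum_le_sum fun b _ => ?_).trans (h n)⟩
  by_cases hz : ∏ i, P (a i) (b i) = 0
  · rw [hz]; simp
  refine mul_le_mul_of_nonneg_left ?_ (Finset.prod_nonneg fun i _ => h0 _ _)
  have hpos : ∀ i, 0 < g (a i) (b i) := fun i =>
    hg _ (Fintype.mem_piFinset.1 ha i) _ (Finset.prod_ne_zero_iff.1 hz i (mem_univ i))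
  by_cases hlt : Real.exp (-(n * c)) < ∏ i, g (a i) (b i)
  · rw [if_pos hlt, if_pos]
    rw [← Real.lt_log_iff_exp_lt (Finset.prod_pos fun i _ => hpos i),
      Real.log_prod (fun i _ => (hpos i).ne')] at hlt
    linarith
  · rw [if_neg hlt]; split_ifs <;> norm_num

/-! ### Indicators -/

open Classical in
/-- The indicator of a proposition. -/
noncomputable def ind (p : Prop) : ℝ := if p then 1 else 0

lemma ind_true {p : Prop} (h : p) : ind p = 1 := by simp [ind, h]

lemma ind_false {p : Prop} (h : ¬ p) : ind p = 0 := by simp [ind, h]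

lemma ind_eq_ite (p : Prop) [Decidable p] : ind p = if p then 1 else 0 := by
  by_cases h : p <;> simp [ind, h]

lemma ind_nonneg (p : Prop) : 0 ≤ ind p := by
  by_cases h : p <;> simp [ind, h]

lemma ind_le_one (p : Prop) : ind p ≤ 1 := by
  by_cases h : p <;> simp [ind, h]

/-- Markov's inequality, pointwise. -/
lemma ind_le_div {t w : ℝ} (ht : 0 < t) (hw : 0 ≤ w) : ind (t ≤ w) ≤ w / t := by
  by_cases h : t ≤ w
  · rw [ind_true h]; exact (one_le_div ht).2 h
  · rw [ind_false h]; positivity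

/-! ### Weights and concatenation -/

/-- The first `k` coordinates. -/
def headVec {n k : ℕ} {B : Type*} (h : k ≤ n) (z : Fin n → B) : Fin k → B :=
  fun j => z (Fin.castLE h j)

/-- The last `n - k` coordinates. -/
def tailVec {n k : ℕ} {B : Type*} (z : Fin n → B) : Fin (n - k) → B :=
  fun j => z ⟨j + k, by omega⟩

/-- The coordinates of a concatenation. -/
def splitFin {n k : ℕ} (h : k ≤ n) : Fin k ⊕ Fin (n - k) ≃ Fin n :=
  finSumFinEquiv.trans (finCongr (by omega))

lemma splitFin_inl {n k : ℕ} (h : k ≤ n) (j : Fin k) : splitFin h (Sum.inl j) = Fin.castLE h j := by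
  ext; simp [splitFin]

lemma splitFin_inr {n k : ℕ} (h : k ≤ n) (j : Fin (n - k)) :
    splitFin h (Sum.inr j) = ⟨j + k, by omega⟩ := by
  ext; simp [splitFin]; omega

lemma weight_concat {n k : ℕ} (h : k ≤ n) (a : Fin k → ℝ) (b : Fin (n - k) → ℝ)
    (z : Fin n → ZMod 2) :
    weight (concat a b) z = weight a (headVec h z) * weight b (tailVec z) := by
  unfold weight
  rw [← Fintype.prod_equiv (splitFin h) (fun i => if z (splitFin h i) = 1
    then concat a b (splitFin h i) else 1 - concat a b (splitFin h i)) _ (fun _ => rfl),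
    Fintype.prod_sum_type]
  congr 1
  · refine prod_congr rfl fun j _ => ?_
    have : concat a b (Fin.castLE h j) = a j := by simp [concat]
    rw [splitFin_inl, this, headVec]
  · refine prod_congr rfl fun j _ => ?_
    have : concat a b ⟨j + k, by omega⟩ = b j := by simp [concat]
    rw [splitFin_inr, this, tailVec]

/-- A vector is the concatenation of its first `k` and its last `n - k` coordinates. -/
def splitVec {n k : ℕ} (h : k ≤ n) (B : Type*) : (Fin n → B) ≃ (Fin k → B) × (Fin (n - k) → B) :=
  ((splitFin h).arrowCongr (Equiv.refl B)).symm.trans (Equiv.sumArrowEquivProdArrow _ _ _)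

lemma splitVec_apply {n k : ℕ} (h : k ≤ n) {B : Type*} (z : Fin n → B) :
    splitVec h B z = (headVec h z, tailVec z) := by
  ext j
  · simp [splitVec, headVec, Equiv.sumArrowEquivProdArrow, splitFin_inl]
  · simp [splitVec, tailVec, Equiv.sumArrowEquivProdArrow, splitFin_inr]

lemma sum_headVec_tailVec {n k : ℕ} (h : k ≤ n) (F : (Fin k → ZMod 2) → (Fin (n - k) → ZMod 2) → ℝ) :
    ∑ z : Fin n → ZMod 2, F (headVec h z) (tailVec z) = ∑ m, ∑ v, F m v := by
  rw [← Fintype.sum_prod_type' F]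
  exact Fintype.sum_equiv (splitVec h (ZMod 2)) _ _ (fun z => by rw [splitVec_apply])

lemma exists_headVec_tailVec {n k : ℕ} (h : k ≤ n) {B : Type*} (m : Fin k → B)
    (v : Fin (n - k) → B) : ∃ z : Fin n → B, headVec h z = m ∧ tailVec z = v := by
  refine ⟨(splitVec h B).symm (m, v), ?_⟩
  have := splitVec_apply h ((splitVec h B).symm (m, v))
  rw [Equiv.apply_symm_apply] at this
  exact ⟨(Prod.ext_iff.1 this).1.symm, (Prod.ext_iff.1 this).2.symm⟩

lemma weight_nonneg {n : ℕ} {q : Fin n → ℝ} (hq : ∀ i, q i ∈ Set.Icc (0 : ℝ) 1)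
    (u : Fin n → ZMod 2) : 0 ≤ weight q u := by
  refine prod_nonneg fun i _ => ?_
  have := hq i
  split_ifs
  · exact this.1
  · linarith [this.2]

lemma sum_zmod_two (g : ZMod 2 → ℝ) : ∑ b, g b = g 0 + g 1 := Fin.sum_univ_two g

lemma sum_weight {n : ℕ} (q : Fin n → ℝ) : ∑ u, weight q u = 1 := by
  unfold weight
  have h := Finset.prod_univ_sum (fun _ : Fin n => (univ : Finset (ZMod 2)))
    (fun i b => if b = 1 then q i else 1 - q i)
  rw [Fintype.piFinset_univ] at h
  rw [← h]
  refine prod_eq_one fun i _ => ?_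
  rw [sum_zmod_two]; simp

/-- Biases 0 and 1 turn the weight into a hard constraint; this is how the encoder imposes the
message. -/
lemma weight_bits {k : ℕ} (m u : Fin k → ZMod 2) :
    weight (fun j => if m j = 1 then 1 else 0) u = ind (u = m) := by
  by_cases h : u = m
  · rw [ind_true h, h]
    refine prod_eq_one fun i _ => ?_
    by_cases hm : m i = 1 <;> simp [hm]
  · rw [ind_false h]
    obtain ⟨i, hi⟩ := Function.ne_iff.1 h
    refine prod_eq_zero (mem_univ i) ?_
    have : ∀ a b : ZMod 2, a ≠ b → (if a = 1 then (if b = 1 then (1 : ℝ) else 0)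
        else 1 - (if b = 1 then (1 : ℝ) else 0)) = 0 := by
      intro a b hab
      by_cases ha : a = 1
      · subst ha; simp [hab.symm]
      · have hb : b = 1 := by revert a b; decide
        simp [ha, hb]
    exact this _ _ hi

/-- On the decoder side the unknown message bits contribute a constant, which does not affect the
maximizer. -/
lemma weight_half {k : ℕ} (u : Fin k → ZMod 2) : weight (fun _ => 1 / 2) u = (1 / 2) ^ k := by
  unfold weight
  rw [prod_congr rfl (g := fun _ => (1 / 2 : ℝ)) (fun i _ => by split_ifs <;> norm_num)]
  simp

/-- The weight `w_p(x) w_{[m,q]}(x Hᵀ)` maximized by the encoder. -/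
noncomputable def encWeight {n k : ℕ} (h : k ≤ n) (p : Fin n → ℝ) (m : Fin k → ZMod 2)
    (q : Fin (n - k) → ℝ) (H : GL (Fin n) (ZMod 2)) (x : Fin n → ZMod 2) : ℝ :=
  weight p x * (ind (headVec h (parity H x) = m) * weight q (tailVec (parity H x)))

/-- `2ᵏ` times the weight `w_p(x) w_{[1/2,…,1/2,q]}(x Hᵀ)` maximized by the decoder. -/
noncomputable def decWeight {n k : ℕ} (p : Fin n → ℝ)
    (q : Fin (n - k) → ℝ) (H : GL (Fin n) (ZMod 2)) (x : Fin n → ZMod 2) : ℝ :=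
  weight p x * weight q (tailVec (parity H x))

lemma encWeight_nonneg {n k : ℕ} (h : k ≤ n) {p : Fin n → ℝ} (m : Fin k → ZMod 2)
    {q : Fin (n - k) → ℝ} (hp : ∀ i, p i ∈ Set.Icc (0 : ℝ) 1) (hq : ∀ i, q i ∈ Set.Icc (0 : ℝ) 1)
    (H : GL (Fin n) (ZMod 2)) (x : Fin n → ZMod 2) : 0 ≤ encWeight h p m q H x :=
  mul_nonneg (weight_nonneg hp x) (mul_nonneg (ind_nonneg _) (weight_nonneg hq _))

lemma decWeight_nonneg {n k : ℕ} {p : Fin n → ℝ}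
    {q : Fin (n - k) → ℝ} (hp : ∀ i, p i ∈ Set.Icc (0 : ℝ) 1) (hq : ∀ i, q i ∈ Set.Icc (0 : ℝ) 1)
    (H : GL (Fin n) (ZMod 2)) (x : Fin n → ZMod 2) : 0 ≤ decWeight p q H x :=
  mul_nonneg (weight_nonneg hp x) (weight_nonneg hq _)

lemma encWeight_le_encode {S : Type*} {f : Query} (hf : IsQuery f) {n k : ℕ} (h : k ≤ n)
    (pe : S → ℝ) (s : Fin n → S) (m : Fin k → ZMod 2) (q : Fin (n - k) → ℝ)
    (H : GL (Fin n) (ZMod 2)) (x : Fin n → ZMod 2) :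
    encWeight h (fun i => pe (s i)) m q H x ≤
      encWeight h (fun i => pe (s i)) m q H (encode f pe H q m s) := by
  have := hf n H (fun i => pe (s i)) (concat (fun j => if m j = 1 then 1 else 0) q) x
  rw [weight_concat h, weight_concat h, weight_bits, weight_bits] at this
  exact this

lemma decode_eq {Y : Type*} (f : Query) {n k : ℕ} (h : k ≤ n) (pd : Y → ℝ)
    (H : GL (Fin n) (ZMod 2)) (q : Fin (n - k) → ℝ) (y : Fin n → Y) :
    decode f pd H q y = headVec h (parity H
      (f n H (fun i => pd (y i)) (concat (fun _ : Fin k => 1 / 2) q))) := by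
  ext j
  have : (j : ℕ) < n := by omega
  simp only [decode, this, dif_pos, headVec]
  rfl

lemma decWeight_le_query {Y : Type*} {f : Query} (hf : IsQuery f) {n k : ℕ} (h : k ≤ n)
    (pd : Y → ℝ) (H : GL (Fin n) (ZMod 2)) (q : Fin (n - k) → ℝ) (y : Fin n → Y)
    (x : Fin n → ZMod 2) :
    decWeight (fun i => pd (y i)) q H x ≤ decWeight (fun i => pd (y i)) q H
      (f n H (fun i => pd (y i)) (concat (fun _ : Fin k => 1 / 2) q)) := by
  have := hf n H (fun i => pd (y i)) (concat (fun _ : Fin k => 1 / 2) q) x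
  rw [weight_concat h, weight_concat h, weight_half, weight_half, mul_left_comm,
    mul_left_comm (weight (fun i => pd (y i)) (f n H _ _))] at this
  exact le_of_mul_le_mul_left this (by positivity)

/-! ### First moment bounds -/

lemma sum_ind_headVec {n k : ℕ} (h : k ≤ n) (m : Fin k → ZMod 2)
    (F : (Fin (n - k) → ZMod 2) → ℝ) :
    ∑ z : Fin n → ZMod 2, ind (headVec h z = m) * F (tailVec z) = ∑ v, F v := by
  rw [sum_headVec_tailVec h (fun a v => ind (a = m) * F v), Finset.sum_eq_single m]
  · simp [ind_true]
  · intro b _ hb; simp [ind_false hb]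
  · simp

/-- The change of measure. Markov's inequality replaces the indicator by weight/θ, and uniformity of
the parity of x ≠ 0 turns the weights into the product law of biases `p` and `q`. The price
1/(θ(2ⁿ-1)) is only exp(δn), up to a constant, for the θ used later. -/
lemma firstMoment_le {n k : ℕ} (hn : 2 ≤ n) (h : k ≤ n) {p : Fin n → ℝ} (m : Fin k → ZMod 2)
    {q : Fin (n - k) → ℝ} (hp : ∀ i, p i ∈ Set.Icc (0 : ℝ) 1) (hq : ∀ i, q i ∈ Set.Icc (0 : ℝ) 1)
    {θ : ℝ} (hθ : 0 < θ) {B : (Fin n → ZMod 2) → (Fin (n - k) → ZMod 2) → ℝ}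
    (hB : ∀ x v, 0 ≤ B x v) :
    avgGL n (fun H => ∑ x ∈ {x : Fin n → ZMod 2 | x ≠ 0}, ind (θ ≤ encWeight h p m q H x) *
      B x (tailVec (parity H x))) ≤
      1 / (θ * numNonzero n) * ∑ x, ∑ v, weight p x * weight q v * B x v := by
  have h1 := numNonzero_pos hn
  have hx : ∀ x ∈ ({x : Fin n → ZMod 2 | x ≠ 0} : Finset _), avgGL n (fun H =>
      ind (θ ≤ encWeight h p m q H x) * B x (tailVec (parity H x))) ≤
      1 / (θ * numNonzero n) * ∑ v, weight p x * weight q v * B x v := by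
    intro x hx
    calc avgGL n (fun H => ind (θ ≤ encWeight h p m q H x) * B x (tailVec (parity H x)))
        ≤ avgGL n (fun H => (weight p x / θ) * (ind (headVec h (parity H x) = m) *
          (weight q (tailVec (parity H x)) * B x (tailVec (parity H x))))) := by
          refine avgGL_mono fun H => ?_
          refine (mul_le_mul_of_nonneg_right
            (ind_le_div hθ (encWeight_nonneg h m hp hq H x)) (hB _ _)).trans (le_of_eq ?_)
          rw [encWeight]; ring
      _ ≤ (weight p x / θ) * ((1 / numNonzero n) * ∑ z, ind (headVec h z = m) *
          (weight q (tailVec z) * B x (tailVec z))) := by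
          rw [avgGL_mul_left]
          refine mul_le_mul_of_nonneg_left ?_ (div_nonneg (weight_nonneg hp x) hθ.le)
          exact avgGL_comp_parity_le hn (by simpa using hx)
            (F := fun z => ind (headVec h z = m) * (weight q (tailVec z) * B x (tailVec z)))
            (fun z => mul_nonneg (ind_nonneg _) (mul_nonneg (weight_nonneg hq _) (hB _ _)))
      _ = _ := by
          rw [sum_ind_headVec h m (fun v => weight q v * B x v), Finset.mul_sum, Finset.mul_sum,
            Finset.mul_sum]
          refine sum_congr rfl fun v _ => ?_
          field_simp
  rw [avgGL_sum]
  refine (sum_le_sum hx).trans ?_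
  rw [← Finset.mul_sum]
  refine mul_le_mul_of_nonneg_left ?_ (by positivity)
  exact sum_le_sum_of_subset_of_nonneg (filter_subset _ _) fun x _ _ => sum_nonneg fun v _ =>
    mul_nonneg (mul_nonneg (weight_nonneg hp _) (weight_nonneg hq _)) (hB _ _)

/-- Markov's inequality for both vectors, then near pairwise independence of their parities. The
message constraint fixes the head of the parity of x, but the head for the competitor x' is free,
which produces the factor 2ᵏ. -/
lemma pairMoment_le {n k : ℕ} (hn : 2 ≤ n) (h : k ≤ n) {p : Fin n → ℝ} (m : Fin k → ZMod 2)
    {q : Fin (n - k) → ℝ} (hp : ∀ i, p i ∈ Set.Icc (0 : ℝ) 1) (hq : ∀ i, q i ∈ Set.Icc (0 : ℝ) 1)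
    {θ T : ℝ} (hθ : 0 < θ) (hT : 0 < T) {I : Type*} [Fintype I]
    {V : (Fin n → ZMod 2) → I → ℝ} (hV : ∀ x y, 0 ≤ V x y) (hV1 : ∀ x, ∑ y, V x y = 1)
    {p' : I → Fin n → ℝ} (hp' : ∀ y i, p' y i ∈ Set.Icc (0 : ℝ) 1) :
    avgGL n (fun H => ∑ x ∈ {x : Fin n → ZMod 2 | x ≠ 0}, ind (θ ≤ encWeight h p m q H x) *
      ∑ y, V x y * ∑ x' ∈ {x' : Fin n → ZMod 2 | x' ≠ 0 ∧ x ≠ x'},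
        ind (T ≤ decWeight (p' y) q H x')) ≤
      2 ^ k / (θ * T * (numNonzero n * (numNonzero n - 1))) := by
  have h1 := numNonzero_pos hn
  have h1' : 0 < numNonzero n - 1 := by linarith
  set C := θ * T * (numNonzero n * (numNonzero n - 1)) with hC
  have hCpos : 0 < C := by positivity
  have hxx : ∀ x ∈ ({x : Fin n → ZMod 2 | x ≠ 0} : Finset _), ∀ y,
      ∀ x' ∈ ({x' : Fin n → ZMod 2 | x' ≠ 0 ∧ x ≠ x'} : Finset _),
      avgGL n (fun H => ind (θ ≤ encWeight h p m q H x) * ind (T ≤ decWeight (p' y) q H x')) ≤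
        weight p x * weight (p' y) x' * (2 ^ k / C) := by
    intro x hx y x' hx'
    simp only [mem_filter, mem_univ, true_and] at hx hx'
    calc avgGL n (fun H => ind (θ ≤ encWeight h p m q H x) * ind (T ≤ decWeight (p' y) q H x'))
        ≤ avgGL n (fun H => (weight p x * weight (p' y) x' / (θ * T)) *
          ((ind (headVec h (parity H x) = m) * weight q (tailVec (parity H x))) *
            weight q (tailVec (parity H x')))) := by
          refine avgGL_mono fun H => ?_
          refine (mul_le_mul (ind_le_div hθ (encWeight_nonneg h m hp hq H x))
            (ind_le_div hT (decWeight_nonneg (hp' y) hq H x')) (ind_nonneg _)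
            (div_nonneg (encWeight_nonneg h m hp hq H x) hθ.le)).trans (le_of_eq ?_)
          rw [encWeight, decWeight]; field_simp
      _ ≤ (weight p x * weight (p' y) x' / (θ * T)) *
          ((1 / (numNonzero n * (numNonzero n - 1))) *
          ((∑ z, ind (headVec h z = m) * weight q (tailVec z)) * ∑ z, weight q (tailVec z))) := by
          rw [avgGL_mul_left]
          refine mul_le_mul_of_nonneg_left ?_ (div_nonneg (mul_nonneg (weight_nonneg hp x)
            (weight_nonneg (hp' y) x')) (by positivity))
          exact avgGL_comp_parity_pair_le hn hx hx'.1 hx'.2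
            (F := fun z => ind (headVec h z = m) * weight q (tailVec z))
            (G := fun z => weight q (tailVec z))
            (fun z => mul_nonneg (ind_nonneg _) (weight_nonneg hq _))
            (fun z => weight_nonneg hq _)
      _ = _ := by
          rw [sum_ind_headVec h m (fun v => weight q v), sum_weight,
            sum_headVec_tailVec h (fun _ v => weight q v)]
          simp only [sum_weight, sum_const, card_univ, Fintype.card_pi, ZMod.card, prod_const,
            Fintype.card_fin, nsmul_eq_mul, mul_one, hC]
          push_cast
          field_simp
  have hsub : ∀ (A : Finset (Fin n → ZMod 2)) (r : Fin n → ℝ), (∀ i, r i ∈ Set.Icc (0 : ℝ) 1) →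
      ∑ x ∈ A, weight r x ≤ 1 := by
    intro A r hr
    rw [← sum_weight r]
    exact sum_le_sum_of_subset_of_nonneg (subset_univ A) fun x _ _ => weight_nonneg hr x
  simp_rw [Finset.mul_sum, avgGL_sum]
  calc _ ≤ ∑ x ∈ {x : Fin n → ZMod 2 | x ≠ 0}, ∑ y,
        ∑ x' ∈ {x' : Fin n → ZMod 2 | x' ≠ 0 ∧ x ≠ x'},
        V x y * (weight p x * weight (p' y) x' * (2 ^ k / C)) := by
        refine sum_le_sum fun x hx => sum_le_sum fun y _ => sum_le_sum fun x' hx' => ?_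
        simp_rw [mul_left_comm _ (V x y)]
        rw [avgGL_mul_left]
        exact mul_le_mul_of_nonneg_left (hxx x hx y x' hx') (hV x y)
    _ ≤ ∑ x ∈ {x : Fin n → ZMod 2 | x ≠ 0}, ∑ y, V x y * (weight p x * (2 ^ k / C)) := by
        refine sum_le_sum fun x hx => sum_le_sum fun y _ => ?_
        rw [← Finset.mul_sum]
        refine mul_le_mul_of_nonneg_left ?_ (hV x y)
        rw [← Finset.sum_mul, ← Finset.mul_sum]
        refine mul_le_mul_of_nonneg_right ?_ (by positivity)
        exact mul_le_of_le_one_right (weight_nonneg hp x) (hsub _ _ (hp' y))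
    _ = (∑ x ∈ {x : Fin n → ZMod 2 | x ≠ 0}, weight p x) * (2 ^ k / C) := by
        simp_rw [← Finset.sum_mul, hV1, one_mul]
        rw [Finset.sum_mul]
    _ ≤ 1 * (2 ^ k / C) := by
        exact mul_le_mul_of_nonneg_right (hsub _ _ hp) (by positivity)
    _ = _ := one_mul _

/-! ### Decomposition of the code probabilities -/

section Average

variable {S : Type*} [Fintype S]

/-- Expectation over the parity biases `q` and the state sequence `s`. -/
noncomputable def avgQS (PS : S → ℝ) (PQ : ℝ →₀ ℝ) (n k : ℕ)
    (F : (Fin (n - k) → ℝ) → (Fin n → S) → ℝ) : ℝ :=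
  ∑ q ∈ Fintype.piFinset (fun _ : Fin (n - k) => PQ.support), ∑ s : Fin n → S,
    (∏ j, PQ (q j)) * (∏ i, PS (s i)) * F q s

variable {PS : S → ℝ} {PQ : ℝ →₀ ℝ} {n k : ℕ}

/-- Comparing on the supports is enough; this lets hypotheses on the biases ignore letters of
probability zero. -/
lemma avgQS_mono (hPS : PS ∈ stdSimplex ℝ S) (hPQ : IsParityBias PQ)
    {F G : (Fin (n - k) → ℝ) → (Fin n → S) → ℝ}
    (h : ∀ q, (∀ j, q j ∈ PQ.support) → ∀ s, (∀ i, PS (s i) ≠ 0) → F q s ≤ G q s) :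
    avgQS PS PQ n k F ≤ avgQS PS PQ n k G := by
  refine sum_le_sum fun q hq => sum_le_sum fun s _ => ?_
  by_cases hs : ∀ i, PS (s i) ≠ 0
  · exact mul_le_mul_of_nonneg_left (h q (Fintype.mem_piFinset.1 hq) s hs)
      (mul_nonneg (prod_nonneg fun _ _ => hPQ.nonneg _) (prod_nonneg fun _ _ => hPS.1 _))
  · push Not at hs
    obtain ⟨i, hi⟩ := hs
    rw [prod_eq_zero (mem_univ i) hi]; simp

lemma avgQS_add (F G : (Fin (n - k) → ℝ) → (Fin n → S) → ℝ) :
    avgQS PS PQ n k (fun q s => F q s + G q s) = avgQS PS PQ n k F + avgQS PS PQ n k G := by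
  simp [avgQS, mul_add, sum_add_distrib]

lemma avgQS_mul_left (c : ℝ) (F : (Fin (n - k) → ℝ) → (Fin n → S) → ℝ) :
    avgQS PS PQ n k (fun q s => c * F q s) = c * avgQS PS PQ n k F := by
  simp only [avgQS, Finset.mul_sum]
  refine sum_congr rfl fun q _ => sum_congr rfl fun s _ => by ring

lemma sum_prod_state (hPS : PS ∈ stdSimplex ℝ S) (n : ℕ) :
    ∑ s : Fin n → S, ∏ i, PS (s i) = 1 := by
  classical
  have h := Finset.prod_univ_sum (fun _ : Fin n => (univ : Finset S)) (fun _ s => PS s)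
  rw [Fintype.piFinset_univ] at h
  rw [← h]; simp [hPS.2]

lemma sum_prod_bias (hPQ : IsParityBias PQ) (N : ℕ) :
    ∑ q ∈ Fintype.piFinset (fun _ : Fin N => PQ.support), ∏ j, PQ (q j) = 1 := by
  rw [← Finset.prod_univ_sum (fun _ : Fin N => PQ.support) (fun _ q => PQ q)]
  simp [hPQ.sum_eq_one]

lemma avgQS_state (hPQ : IsParityBias PQ) (F : (Fin n → S) → ℝ) :
    avgQS PS PQ n k (fun _ s => F s) = ∑ s, (∏ i, PS (s i)) * F s := by
  simp only [avgQS, mul_assoc, ← Finset.mul_sum]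
  rw [← Finset.sum_mul, sum_prod_bias hPQ, one_mul]

lemma avgQS_bias (hPS : PS ∈ stdSimplex ℝ S) (F : (Fin (n - k) → ℝ) → ℝ) :
    avgQS PS PQ n k (fun q _ => F q) =
      ∑ q ∈ Fintype.piFinset (fun _ : Fin (n - k) => PQ.support), (∏ j, PQ (q j)) * F q := by
  simp only [avgQS]
  refine sum_congr rfl fun q _ => ?_
  rw [← Finset.sum_mul, ← Finset.mul_sum, sum_prod_state hPS, mul_one]

lemma avgQS_const (hPS : PS ∈ stdSimplex ℝ S) (hPQ : IsParityBias PQ) (c : ℝ) :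
    avgQS PS PQ n k (fun _ _ => c) = c := by
  rw [avgQS_state hPQ, ← Finset.sum_mul, sum_prod_state hPS, one_mul]

lemma avgQS_nonneg (hPS : PS ∈ stdSimplex ℝ S) (hPQ : IsParityBias PQ)
    {F : (Fin (n - k) → ℝ) → (Fin n → S) → ℝ} (h : ∀ q, (∀ j, q j ∈ PQ.support) → ∀ s, 0 ≤ F q s) :
    0 ≤ avgQS PS PQ n k F := by
  rw [← avgQS_const hPS hPQ (n := n) (k := k) 0]
  exact avgQS_mono hPS hPQ fun q hq s _ => h q hq s

end Average

lemma sum_prod_channel {X Y : Type*} [Fintype Y] {V : X → Y → ℝ} (hV : ∀ x, V x ∈ stdSimplex ℝ Y)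
    {n : ℕ} (x : Fin n → X) : ∑ y : Fin n → Y, ∏ i, V (x i) (y i) = 1 := by
  classical
  have h := Finset.prod_univ_sum (fun _ : Fin n => (univ : Finset Y)) (fun i y => V (x i) y)
  rw [Fintype.piFinset_univ] at h
  rw [← h]
  exact prod_eq_one fun i _ => (hV _).2

lemma weight_le_one {n : ℕ} {q : Fin n → ℝ} (hq : ∀ i, q i ∈ Set.Icc (0 : ℝ) 1)
    (u : Fin n → ZMod 2) : weight q u ≤ 1 := by
  rw [← sum_weight q]
  exact single_le_sum (f := weight q) (fun u _ => weight_nonneg hq u) (mem_univ u)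

/-! ### Reduction to encoder failure plus first-moment terms -/

section Code

variable {S Y : Type*} [Fintype S] [Fintype Y]

/-- Probability of the event `E` given that the message is `m`. -/
noncomputable def msgProb (f : Query)
    (PS : S → ℝ) (W : S → ZMod 2 → Y → ℝ) (PQ : ℝ →₀ ℝ) (pe : S → ℝ) (pd : Y → ℝ) (n k : ℕ)
    (E : (Fin k → ZMod 2) → (Fin k → ZMod 2) → (Fin n → S) → (Fin n → ZMod 2) → Prop)
    (m : Fin k → ZMod 2) : ℝ :=
  avgQS PS PQ n k fun q s => avgGL n fun H => ∑ y : Fin n → Y,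
    (∏ i, W (s i) (encode f pe H q m s i) (y i)) *
      ind (E m (decode f pd H q y) s (encode f pe H q m s))

/-- Probability that no `x` has encoder weight at least `θ`, given that the message is `m`. -/
noncomputable def failProb {n k : ℕ} (PS : S → ℝ) (PQ : ℝ →₀ ℝ) (pe : S → ℝ) (h : k ≤ n)
    (θ : ℝ) (m : Fin k → ZMod 2) : ℝ :=
  avgQS PS PQ n k fun q s => avgGL n fun H =>
    ind (∀ x, encWeight h (fun i => pe (s i)) m q H x < θ)

variable {f : Query} {PS : S → ℝ} {W : S → ZMod 2 → Y → ℝ} {PQ : ℝ →₀ ℝ} {pe : S → ℝ} {pd : Y → ℝ}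
  {n k : ℕ} {E : (Fin k → ZMod 2) → (Fin k → ZMod 2) → (Fin n → S) → (Fin n → ZMod 2) → Prop}

lemma codeProb_eq : codeProb f PS W PQ pe pd n k E =
    (1 / 2 ^ k) * ∑ m, msgProb f PS W PQ pe pd n k E m := by
  unfold codeProb msgProb avgQS avgGL
  rw [Finset.mul_sum]
  refine sum_congr rfl fun m _ => ?_
  rw [Finset.sum_comm, Finset.mul_sum]
  refine sum_congr rfl fun q _ => ?_
  rw [Finset.sum_comm, Finset.mul_sum]
  refine sum_congr rfl fun s _ => ?_
  simp only [Finset.mul_sum]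
  refine sum_congr rfl fun H _ => sum_congr rfl fun y _ => ?_
  rw [ind]
  ring

lemma sum_channel_ind_le_one {S Y : Type*} [Fintype Y] {W : S → ZMod 2 → Y → ℝ} {n : ℕ}
    (hW : IsStateChannel W) (s : Fin n → S) (x : Fin n → ZMod 2)
    (P : (Fin n → Y) → Prop) :
    ∑ y : Fin n → Y, (∏ i, W (s i) (x i) (y i)) * ind (P y) ≤ 1 := by
  rw [← sum_prod_channel (V := fun a : S × ZMod 2 => W a.1 a.2) (fun a => hW a.1 a.2)
    (fun i => (s i, x i))]
  refine sum_le_sum fun y _ => ?_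
  exact mul_le_of_le_one_right (prod_nonneg fun i _ => (hW _ _).1 _) (ind_le_one _)

lemma msgProb_le_one (hPS : PS ∈ stdSimplex ℝ S) (hPQ : IsParityBias PQ) (hW : IsStateChannel W)
    (m : Fin k → ZMod 2) : msgProb f PS W PQ pe pd n k E m ≤ 1 := by
  rw [← avgQS_const hPS hPQ (n := n) (k := k) 1]
  refine avgQS_mono hPS hPQ fun q _ s _ => ?_
  rw [← avgGL_const n 1]
  exact avgGL_mono fun H => sum_channel_ind_le_one hW s _ _

lemma msgProb_nonneg (hPS : PS ∈ stdSimplex ℝ S) (hPQ : IsParityBias PQ) (hW : IsStateChannel W)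
    (m : Fin k → ZMod 2) : 0 ≤ msgProb f PS W PQ pe pd n k E m :=
  avgQS_nonneg hPS hPQ fun _ _ _ => avgGL_nonneg fun _ => sum_nonneg fun _ _ =>
    mul_nonneg (prod_nonneg fun _ _ => (hW _ _).1 _) (ind_nonneg _)

lemma codeProb_nonneg (hPS : PS ∈ stdSimplex ℝ S) (hPQ : IsParityBias PQ) (hW : IsStateChannel W) :
    0 ≤ codeProb f PS W PQ pe pd n k E := by
  rw [codeProb_eq]
  exact mul_nonneg (by positivity) (sum_nonneg fun m _ => msgProb_nonneg hPS hPQ hW m)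

/-- The message 0 is given up at a cost of 2⁻ᵏ. For any other message the zero vector, whose parity
is not random, violates the message constraint. -/
lemma codeProb_le (hPS : PS ∈ stdSimplex ℝ S) (hPQ : IsParityBias PQ) (hW : IsStateChannel W)
    {b : ℝ} (hb : 0 ≤ b) (h : ∀ m, m ≠ 0 → msgProb f PS W PQ pe pd n k E m ≤ b) :
    codeProb f PS W PQ pe pd n k E ≤ 1 / 2 ^ k + b := by
  rw [codeProb_eq]
  have h1 : ∑ m, msgProb f PS W PQ pe pd n k E m ≤
      ∑ m : Fin k → ZMod 2, ((if m = 0 then 1 else 0) + b) := by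
    refine sum_le_sum fun m _ => ?_
    by_cases hm : m = 0
    · rw [if_pos hm]
      linarith [msgProb_le_one (f := f) (pe := pe) (pd := pd) (E := E) hPS hPQ hW m]
    · rw [if_neg hm, zero_add]; exact h m hm
  rw [sum_add_distrib, Finset.sum_ite_eq', if_pos (mem_univ _)] at h1
  simp only [sum_const, card_univ, Fintype.card_pi, ZMod.card, prod_const, Fintype.card_fin,
    nsmul_eq_mul] at h1
  push_cast at h1
  calc _ ≤ (1 / 2 ^ k) * (1 + 2 ^ k * b) := mul_le_mul_of_nonneg_left h1 (by positivity)
    _ = _ := by field_simp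

lemma encWeight_zero (h : k ≤ n) (p : Fin n → ℝ) {m : Fin k → ZMod 2} (hm : m ≠ 0)
    (q : Fin (n - k) → ℝ) (H : GL (Fin n) (ZMod 2)) : encWeight h p m q H 0 = 0 := by
  have : headVec h (0 : Fin n → ZMod 2) ≠ m := fun e => hm (e.symm.trans rfl)
  rw [encWeight, parity_zero, ind_false this]; simp

/-- If some vector reaches θ then so does the maximizer, and the encoder's output is one term of the
sum over all x reaching θ. The sum no longer mentions the encoder, hence neither its dependence on H
nor its tie-breaking. -/
lemma msgProb_le (hf : IsQuery f) (hPS : PS ∈ stdSimplex ℝ S) (hPQ : IsParityBias PQ)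
    (hW : IsStateChannel W) (h : k ≤ n) {θ : ℝ} (hθ : 0 < θ) {m : Fin k → ZMod 2} (hm : m ≠ 0) :
    msgProb f PS W PQ pe pd n k E m ≤ failProb PS PQ pe h θ m +
      avgQS PS PQ n k fun q s => avgGL n fun H => ∑ x ∈ {x : Fin n → ZMod 2 | x ≠ 0},
        ind (θ ≤ encWeight h (fun i => pe (s i)) m q H x) *
          ∑ y : Fin n → Y, (∏ i, W (s i) (x i) (y i)) * ind (E m (decode f pd H q y) s x) := by
  rw [msgProb, failProb, ← avgQS_add]
  refine avgQS_mono hPS hPQ fun q _ s _ => ?_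
  rw [← avgGL_add]
  refine avgGL_mono fun H => ?_
  have hnn : ∀ x : Fin n → ZMod 2, 0 ≤ ind (θ ≤ encWeight h (fun i => pe (s i)) m q H x) *
      ∑ y : Fin n → Y, (∏ i, W (s i) (x i) (y i)) * ind (E m (decode f pd H q y) s x) :=
    fun x => mul_nonneg (ind_nonneg _) (sum_nonneg fun _ _ =>
      mul_nonneg (prod_nonneg fun _ _ => (hW _ _).1 _) (ind_nonneg _))
  by_cases hfail : ∀ x, encWeight h (fun i => pe (s i)) m q H x < θ
  · rw [ind_true hfail]
    linarith [sum_channel_ind_le_one hW s (encode f pe H q m s)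
      (fun y => E m (decode f pd H q y) s (encode f pe H q m s)),
      sum_nonneg (s := ({x : Fin n → ZMod 2 | x ≠ 0} : Finset _)) fun x _ => hnn x]
  · rw [ind_false hfail, zero_add]
    push Not at hfail
    obtain ⟨x, hx⟩ := hfail
    have hx0 := hx.trans (encWeight_le_encode hf h pe s m q H x)
    have hne : encode f pe H q m s ≠ 0 := by
      intro e
      rw [e, encWeight_zero h _ hm] at hx0
      linarith
    refine le_trans (le_of_eq ?_) (single_le_sum (fun x _ => hnn x)
      (mem_filter.2 ⟨mem_univ _, hne⟩))
    rw [ind_true hx0, one_mul]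

/-- The event does not involve the channel output, so the sum over y is 1 and `firstMoment_le`
applies directly. -/
lemma msgProb_state_le (hf : IsQuery f) (hPS : PS ∈ stdSimplex ℝ S) (hPQ : IsParityBias PQ)
    (hW : IsStateChannel W) (hpe : ∀ s, pe s ∈ Set.Icc (0 : ℝ) 1) (hn : 2 ≤ n) (h : k ≤ n) {θ : ℝ}
    (hθ : 0 < θ) {m : Fin k → ZMod 2} (hm : m ≠ 0) (Ev : (Fin n → S) → (Fin n → ZMod 2) → Prop) :
    msgProb f PS W PQ pe pd n k (fun _ _ s x => Ev s x) m ≤ failProb PS PQ pe h θ m +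
      1 / (θ * numNonzero n) * ∑ s : Fin n → S, ∑ x : Fin n → ZMod 2,
        (∏ i, PS (s i)) * weight (fun i => pe (s i)) x * ind (Ev s x) := by
  refine (msgProb_le hf hPS hPQ hW h hθ hm).trans (add_le_add_right ?_ _)
  have h1 := numNonzero_pos hn
  calc _ ≤ avgQS PS PQ n k (fun _ s => 1 / (θ * numNonzero n) *
        ∑ x, weight (fun i => pe (s i)) x * ind (Ev s x)) := by
        refine avgQS_mono hPS hPQ fun q hq s _ => ?_
        have hq' : ∀ i, q i ∈ Set.Icc (0 : ℝ) 1 := fun i => hPQ.support_subset _ (hq i)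
        have := firstMoment_le hn h (p := fun i => pe (s i)) m (fun i => hpe _) hq' hθ
          (B := fun x _ => ind (Ev s x)) (fun _ _ => ind_nonneg _)
        refine le_trans (avgGL_mono fun H => sum_le_sum fun x _ => ?_) (this.trans (le_of_eq ?_))
        · refine mul_le_mul_of_nonneg_left ?_ (ind_nonneg _)
          rw [← Finset.sum_mul]
          rw [sum_prod_channel (V := fun a : S × ZMod 2 => W a.1 a.2) (fun a => hW a.1 a.2)
            (fun i => (s i, x i)), one_mul]
        · congr 1
          refine sum_congr rfl fun x _ => ?_
          simp_rw [mul_right_comm _ (weight q _) (ind _)]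
          rw [← Finset.mul_sum, sum_weight, mul_one]
    _ = _ := by
        rw [avgQS_mul_left, avgQS_state hPQ]
        simp_rw [Finset.mul_sum, mul_assoc]

/-- A wrong message means that either one of the two factors of the decoder weight of the
transmitted x is small, or another vector has weight at least T₁T₂. The competitor 0 is separated
because its parity is always 0; its weight is at most `weight q 0`. -/
lemma ind_error_le {Y : Type*} {pd : Y → ℝ} (hf : IsQuery f)
    (hpd : ∀ y, pd y ∈ Set.Icc (0 : ℝ) 1) (h : k ≤ n)
    {q : Fin (n - k) → ℝ} (hq : ∀ i, q i ∈ Set.Icc (0 : ℝ) 1) {T₁ T₂ : ℝ} (hT₁ : 0 < T₁)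
    (hT₂ : 0 < T₂) {m : Fin k → ZMod 2} {H : GL (Fin n) (ZMod 2)} {x : Fin n → ZMod 2}
    (hx : headVec h (parity H x) = m) (y : Fin n → Y) :
    ind (m ≠ decode f pd H q y) ≤
      (ind (weight (fun i => pd (y i)) x < T₁) + ind (weight q (tailVec (parity H x)) < T₂) +
        ind (T₁ * T₂ ≤ weight q 0)) +
      ∑ x' ∈ {x' : Fin n → ZMod 2 | x' ≠ 0 ∧ x ≠ x'},
        ind (T₁ * T₂ ≤ decWeight (fun i => pd (y i)) q H x') := by
  have hn1 := ind_nonneg (weight (fun i => pd (y i)) x < T₁)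
  have hn2 := ind_nonneg (weight q (tailVec (parity H x)) < T₂)
  have hn3 := ind_nonneg (T₁ * T₂ ≤ weight q 0)
  have hn4 : 0 ≤ ∑ x' ∈ {x' : Fin n → ZMod 2 | x' ≠ 0 ∧ x ≠ x'},
      ind (T₁ * T₂ ≤ decWeight (fun i => pd (y i)) q H x') := sum_nonneg fun _ _ => ind_nonneg _
  by_cases he : m ≠ decode f pd H q y
  swap
  · rw [ind_false he]; linarith
  rw [ind_true he]
  by_cases h1 : weight (fun i => pd (y i)) x < T₁
  · rw [ind_true h1]; linarith
  by_cases h2 : weight q (tailVec (parity H x)) < T₂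
  · rw [ind_true h2]; linarith
  push Not at h1 h2
  have hxT : T₁ * T₂ ≤ decWeight (fun i => pd (y i)) q H x :=
    mul_le_mul h1 h2 hT₂.le (hT₁.le.trans h1)
  have hxh := hxT.trans (decWeight_le_query hf h pd H q y x)
  rw [decode_eq f h] at he
  set xh := f n H (fun i => pd (y i)) (concat (fun _ : Fin k => 1 / 2) q)
  by_cases h0 : xh = 0
  · have : T₁ * T₂ ≤ weight q 0 := by
      rw [h0, decWeight, parity_zero] at hxh
      exact hxh.trans (mul_le_of_le_one_left (weight_nonneg hq _) (weight_le_one (fun i => hpd _) _))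
    rw [ind_true this]; linarith
  · have hne : x ≠ xh := by
      rintro e; rw [← e] at he; exact he hx.symm
    have : (1 : ℝ) ≤ ∑ x' ∈ {x' : Fin n → ZMod 2 | x' ≠ 0 ∧ x ≠ x'},
        ind (T₁ * T₂ ≤ decWeight (fun i => pd (y i)) q H x') := by
      refine le_trans (le_of_eq (ind_true hxh).symm) (single_le_sum
        (f := fun x' => ind (T₁ * T₂ ≤ decWeight (fun i => pd (y i)) q H x'))
        (fun x' _ => ind_nonneg _) (mem_filter.2 ⟨mem_univ _, h0, hne⟩))
    linarith

/-- The first three events of `ind_error_le` go through `firstMoment_le`, the count of nonzero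
competitors through `pairMoment_le`. -/
lemma msgProb_error_le (hf : IsQuery f) (hPS : PS ∈ stdSimplex ℝ S) (hPQ : IsParityBias PQ)
    (hW : IsStateChannel W) (hpe : ∀ s, pe s ∈ Set.Icc (0 : ℝ) 1)
    (hpd : ∀ y, pd y ∈ Set.Icc (0 : ℝ) 1) (hn : 2 ≤ n) (h : k ≤ n) {θ T₁ T₂ : ℝ}
    (hθ : 0 < θ) (hT₁ : 0 < T₁) (hT₂ : 0 < T₂) {m : Fin k → ZMod 2} (hm : m ≠ 0) :
    msgProb f PS W PQ pe pd n k (fun m m' _ _ => m ≠ m') m ≤ failProb PS PQ pe h θ m +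
      (1 / (θ * numNonzero n) *
        (∑ s : Fin n → S, ∑ x : Fin n → ZMod 2, ∑ y : Fin n → Y,
          (∏ i, PS (s i)) * weight (fun i => pe (s i)) x * (∏ i, W (s i) (x i) (y i)) *
            ind (weight (fun i => pd (y i)) x < T₁) +
        ∑ q ∈ Fintype.piFinset (fun _ : Fin (n - k) => PQ.support),
          ∑ v : Fin (n - k) → ZMod 2, (∏ j, PQ (q j)) * weight q v * ind (weight q v < T₂) +
        ∑ q ∈ Fintype.piFinset (fun _ : Fin (n - k) => PQ.support),
          (∏ j, PQ (q j)) * ind (T₁ * T₂ ≤ weight q 0)) +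
      2 ^ k / (θ * (T₁ * T₂) * (numNonzero n * (numNonzero n - 1)))) := by
  refine (msgProb_le hf hPS hPQ hW h hθ hm).trans (add_le_add_right ?_ _)
  have h1 := numNonzero_pos hn
  have hW1 : ∀ (s : Fin n → S) (x : Fin n → ZMod 2), ∑ y : Fin n → Y, ∏ i, W (s i) (x i) (y i) = 1 :=
    fun s x => sum_prod_channel (V := fun a : S × ZMod 2 => W a.1 a.2) (fun a => hW a.1 a.2)
      (fun i => (s i, x i))
  have hW0 : ∀ (s : Fin n → S) (x : Fin n → ZMod 2) (y : Fin n → Y),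
      0 ≤ ∏ i, W (s i) (x i) (y i) := fun s x y => prod_nonneg fun i _ => (hW _ _).1 _
  calc _ ≤ avgQS PS PQ n k (fun q s => 1 / (θ * numNonzero n) *
        (∑ x, weight (fun i => pe (s i)) x * (∑ y : Fin n → Y, (∏ i, W (s i) (x i) (y i)) *
            ind (weight (fun i => pd (y i)) x < T₁)) +
          ∑ v, weight q v * ind (weight q v < T₂) + ind (T₁ * T₂ ≤ weight q 0)) +
        2 ^ k / (θ * (T₁ * T₂) * (numNonzero n * (numNonzero n - 1)))) := by
        refine avgQS_mono hPS hPQ fun q hq s _ => ?_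
        have hq' : ∀ i, q i ∈ Set.Icc (0 : ℝ) 1 := fun i => hPQ.support_subset _ (hq i)
        have hfirst := firstMoment_le hn h (p := fun i => pe (s i)) m (fun i => hpe _) hq' hθ
          (B := fun x v => (∑ y : Fin n → Y, (∏ i, W (s i) (x i) (y i)) *
            ind (weight (fun i => pd (y i)) x < T₁)) + ind (weight q v < T₂) +
            ind (T₁ * T₂ ≤ weight q 0))
          (fun x v => add_nonneg (add_nonneg (sum_nonneg fun y _ =>
            mul_nonneg (hW0 s x y) (ind_nonneg _)) (ind_nonneg _)) (ind_nonneg _))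
        have hpair := pairMoment_le hn h (p := fun i => pe (s i)) m (fun i => hpe _) hq' hθ
          (mul_pos hT₁ hT₂) (V := fun x (y : Fin n → Y) => ∏ i, W (s i) (x i) (y i))
          (fun x y => hW0 s x y) (hW1 s) (p' := fun y i => pd (y i)) (fun y i => hpd _)
        refine le_trans ?_ (add_le_add (hfirst.trans (le_of_eq ?_)) hpair)
        · rw [← avgGL_add]
          refine avgGL_mono fun H => ?_
          rw [← sum_add_distrib]
          refine sum_le_sum fun x _ => ?_
          by_cases hx : θ ≤ encWeight h (fun i => pe (s i)) m q H x
          swap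
          · rw [ind_false hx]; simp
          -- Reaching the positive threshold forces the message constraint.
          have hhead : headVec h (parity H x) = m := by
            by_contra hne
            rw [encWeight, ind_false hne] at hx
            simp at hx
            linarith
          rw [ind_true hx, one_mul, one_mul, one_mul]
          refine (sum_le_sum fun y _ => mul_le_mul_of_nonneg_left
            (ind_error_le hf hpd h hq' hT₁ hT₂ hhead y) (hW0 s x y)).trans (le_of_eq ?_)
          simp only [mul_add, sum_add_distrib]
          rw [← Finset.sum_mul (f := fun y : Fin n → Y => ∏ i, W (s i) (x i) (y i))
              (a := ind (weight q (tailVec (parity H x)) < T₂)),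
            ← Finset.sum_mul (f := fun y : Fin n → Y => ∏ i, W (s i) (x i) (y i))
              (a := ind (T₁ * T₂ ≤ weight q 0)), hW1, one_mul, one_mul]
        · congr 1
          simp only [mul_add, sum_add_distrib]
          congr 1
          · congr 1
            · refine sum_congr rfl fun x _ => ?_
              simp_rw [mul_right_comm (weight _ x) (weight q _)]
              rw [← Finset.mul_sum, sum_weight, mul_one]
            · simp_rw [mul_assoc, ← Finset.mul_sum]
              rw [← Finset.sum_mul, sum_weight, one_mul]
          · simp_rw [← Finset.sum_mul, ← Finset.mul_sum, sum_weight, mul_one]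
            rw [sum_weight, one_mul]
    _ = _ := by
        rw [avgQS_add, avgQS_const hPS hPQ, avgQS_mul_left, avgQS_add, avgQS_add,
          avgQS_bias hPS, avgQS_state hPQ, avgQS_bias hPS]
        simp_rw [Finset.mul_sum, mul_assoc]

end Code

/-! ### Large deviations of weights -/

/-- The probability that a bit of bias `p` equals `b`. -/
noncomputable def bitProb (p : ℝ) (b : ZMod 2) : ℝ := if b = 1 then p else 1 - p

lemma weight_eq_prod_bitProb {n : ℕ} (q : Fin n → ℝ) (u : Fin n → ZMod 2) :
    weight q u = ∏ i, bitProb (q i) (u i) := rfl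

lemma bitProb_one (p : ℝ) : bitProb p 1 = p := by simp [bitProb]

lemma bitProb_zero (p : ℝ) : bitProb p 0 = 1 - p := by simp [bitProb]

lemma bitProb_nonneg {p : ℝ} (hp : p ∈ Set.Icc (0 : ℝ) 1) (b : ZMod 2) : 0 ≤ bitProb p b := by
  unfold bitProb
  split_ifs
  · exact hp.1
  · linarith [hp.2]

/-- Cross entropy (in nats) of bits of biases `p'` and `p`. -/
noncomputable def crossEntropy (p' p : ℝ) : ℝ := p' * -Real.log p + (1 - p') * -Real.log (1 - p)

lemma crossEntropy_self (p : ℝ) : crossEntropy p p = Real.binEntropy p := by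
  simp [crossEntropy, Real.binEntropy]

section Chernoff

variable {A : Type*} {D : Finset A} {P : A → ℝ} {p' p : A → ℝ}

lemma bitLaw_nonneg (hP : ∀ a, 0 ≤ P a) (hp' : ∀ a, P a ≠ 0 → p' a ∈ Set.Icc (0 : ℝ) 1)
    (a : A) (b : ZMod 2) : 0 ≤ P a * bitProb (p' a) b := by
  by_cases h : P a = 0
  · simp [h]
  · exact mul_nonneg (hP a) (bitProb_nonneg (hp' a h) b)

lemma bitLaw_sum (h1 : ∑ a ∈ D, P a = 1) : ∑ a ∈ D, ∑ b, P a * bitProb (p' a) b = 1 := by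
  rw [← h1]
  refine sum_congr rfl fun a _ => ?_
  rw [sum_zmod_two, bitProb_one, bitProb_zero]; ring

lemma bitLaw_mean : ∑ a ∈ D, ∑ b, P a * bitProb (p' a) b * -Real.log (bitProb (p a) b) =
    ∑ a ∈ D, P a * crossEntropy (p' a) (p a) := by
  refine sum_congr rfl fun a _ => ?_
  rw [sum_zmod_two, bitProb_one, bitProb_zero, bitProb_one, bitProb_zero, crossEntropy]; ring

lemma bitLaw_pos (hac : ∀ a, P a ≠ 0 → ∀ b, bitProb (p' a) b ≠ 0 → 0 < bitProb (p a) b)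
    (a : A) (b : ZMod 2) (h : P a * bitProb (p' a) b ≠ 0) : 0 < bitProb (p a) b :=
  hac a (left_ne_zero_of_mul h) b (right_ne_zero_of_mul h)

/-- Bits are drawn with biases `p'` but weighed with biases `p`, so -log of the weight concentrates
at the cross entropy. The condition `hac` keeps this cross entropy honest: without absolute
continuity the value log 0 = 0 would hide an infinite one. -/
lemma weight_chernoff_lt (hP : ∀ a, 0 ≤ P a) (h1 : ∑ a ∈ D, P a = 1)
    (hp' : ∀ a, P a ≠ 0 → p' a ∈ Set.Icc (0 : ℝ) 1)
    (hac : ∀ a, P a ≠ 0 → ∀ b, bitProb (p' a) b ≠ 0 → 0 < bitProb (p a) b) {c : ℝ}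
    (hc : ∑ a ∈ D, P a * crossEntropy (p' a) (p a) < c) :
    ∃ r : ℝ, 0 < r ∧ ∀ n : ℕ, ∑ a ∈ Fintype.piFinset (fun _ : Fin n => D),
      ∑ u : Fin n → ZMod 2, (∏ i, P (a i)) * weight (fun i => p' (a i)) u *
        ind (weight (fun i => p (a i)) u < Real.exp (-(n * c))) ≤ Real.exp (-(r * n)) := by
  obtain ⟨r, hr, h⟩ := chernoff_prod_lt D (fun a b => P a * bitProb (p' a) b)
    (fun a b => bitProb (p a) b) (bitLaw_nonneg hP hp') (bitLaw_sum h1)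
    (fun a _ b h => bitLaw_pos hac a b h) (c := c) (by rw [bitLaw_mean]; exact hc)
  refine ⟨r, hr, fun n => le_trans (le_of_eq ?_) (h n)⟩
  refine sum_congr rfl fun a _ => sum_congr rfl fun u _ => ?_
  rw [prod_mul_distrib, ind_eq_ite]
  rfl

lemma weight_chernoff_gt (hP : ∀ a, 0 ≤ P a) (h1 : ∑ a ∈ D, P a = 1)
    (hp' : ∀ a, P a ≠ 0 → p' a ∈ Set.Icc (0 : ℝ) 1) {c : ℝ}
    (hc : c < ∑ a ∈ D, P a * Real.binEntropy (p' a)) :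
    ∃ r : ℝ, 0 < r ∧ ∀ n : ℕ, ∑ a ∈ Fintype.piFinset (fun _ : Fin n => D),
      ∑ u : Fin n → ZMod 2, (∏ i, P (a i)) * weight (fun i => p' (a i)) u *
        ind (Real.exp (-(n * c)) < weight (fun i => p' (a i)) u) ≤ Real.exp (-(r * n)) := by
  obtain ⟨r, hr, h⟩ := chernoff_lt_prod D (fun a b => P a * bitProb (p' a) b)
    (fun a b => bitProb (p' a) b) (bitLaw_nonneg hP hp') (bitLaw_sum h1)
    (fun a _ b h => bitLaw_pos (fun a ha b hb => lt_of_le_of_ne (bitProb_nonneg (hp' a ha) b)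
      hb.symm) a b h) (c := c) (by rw [bitLaw_mean]; simp_rw [crossEntropy_self]; exact hc)
  refine ⟨r, hr, fun n => le_trans (le_of_eq ?_) (h n)⟩
  refine sum_congr rfl fun a _ => sum_congr rfl fun u _ => ?_
  rw [prod_mul_distrib, ind_eq_ite]
  rfl

end Chernoff

/-! ### The encoder finds a codeword of large weight -/

/-- A pair is good if it is typical for the auxiliary biases `p'`, `q'`: original weight at least
a₁a₂ ≥ θ and auxiliary probability at most b₁b₂ ≤ 1/M. If the good pairs carry auxiliary mass at
least 1/2, there are at least M/2 of them, and the second moment bound shows that some good pair is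
realized by H. -/
lemma avgGL_fail_le {n k : ℕ} (hn : 2 ≤ n) (h : k ≤ n) {p p' : Fin n → ℝ} {q q' : Fin (n - k) → ℝ}
    (hp' : ∀ i, p' i ∈ Set.Icc (0 : ℝ) 1) (hq' : ∀ i, q' i ∈ Set.Icc (0 : ℝ) 1)
    {m : Fin k → ZMod 2} (hm : m ≠ 0) {θ a₁ b₁ a₂ b₂ M : ℝ} (ha₁ : 0 < a₁) (ha₂ : 0 < a₂)
    (hθ : θ ≤ a₁ * a₂) (hM : b₁ * b₂ ≤ 1 / M) (hM2 : 2 ^ n < M / 2) (hb₁ : 0 ≤ b₁) :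
    avgGL n (fun H => ind (∀ x, encWeight h p m q H x < θ)) ≤
      2 * (∑ x, weight p' x * ind (weight p x < a₁) + ∑ x, weight p' x * ind (b₁ < weight p' x) +
        (∑ v, weight q' v * ind (weight q v < a₂) + ∑ v, weight q' v * ind (b₂ < weight q' v))) +
      (numNonzero n / (M / 2 - 2 ^ n) + 1 / (numNonzero n - 1)) := by
  classical
  have h1 := numNonzero_pos hn
  have hMpos : 0 < M := by have : (0 : ℝ) < 2 ^ n := by positivity
                           linarith
  have hg : 0 < M / 2 - 2 ^ n := by linarith
  have hκ : 0 ≤ numNonzero n / (M / 2 - 2 ^ n) + 1 / (numNonzero n - 1) :=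
    add_nonneg (div_nonneg (by linarith) hg.le) (div_nonneg zero_le_one (by linarith))
  set β := ∑ x, weight p' x * ind (weight p x < a₁) + ∑ x, weight p' x * ind (b₁ < weight p' x) +
        (∑ v, weight q' v * ind (weight q v < a₂) + ∑ v, weight q' v * ind (b₂ < weight q' v))
    with hβ
  by_cases hβ2 : 1 / 2 < β
  -- Here the term 2β already exceeds 1, which is why the bound carries the factor 2.
  · have : avgGL n (fun H => ind (∀ x, encWeight h p m q H x < θ)) ≤ 1 := by
      rw [← avgGL_const n 1]; exact avgGL_mono fun _ => ind_le_one _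
    linarith
  have hβ0 : 0 ≤ β := by
    have : ∀ {N : ℕ} (r : Fin N → ℝ) (hr : ∀ i, r i ∈ Set.Icc (0 : ℝ) 1)
        (E : (Fin N → ZMod 2) → Prop), 0 ≤ ∑ u, weight r u * ind (E u) := fun r hr E =>
      sum_nonneg fun u _ => mul_nonneg (weight_nonneg hr u) (ind_nonneg _)
    exact add_nonneg (add_nonneg (this _ hp' _) (this _ hp' _))
      (add_nonneg (this _ hq' _) (this _ hq' _))
  push Not at hβ2
  let good : (Fin n → ZMod 2) → (Fin (n - k) → ZMod 2) → Prop := fun x v =>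
    a₁ ≤ weight p x ∧ weight p' x ≤ b₁ ∧ a₂ ≤ weight q v ∧ weight q' v ≤ b₂
  -- Prefixing the message makes each good (x, v) one pair (x, z) of full length, and `m ≠ 0`
  -- ensures z ≠ 0.
  let G : Finset ((Fin n → ZMod 2) × (Fin n → ZMod 2)) :=
    {a | (a.1 ≠ 0 ∧ good a.1 (tailVec a.2)) ∧ headVec h a.2 = m}
  have hmass : 1 / 2 ≤ ∑ x, ∑ v, weight p' x * weight q' v * ind (good x v) := by
    have hpt : ∀ x v, weight p' x * weight q' v ≤ weight p' x * weight q' v * ind (good x v) +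
        (weight p' x * ind (weight p x < a₁) * weight q' v +
          weight p' x * ind (b₁ < weight p' x) * weight q' v +
        (weight p' x * (weight q' v * ind (weight q v < a₂)) +
          weight p' x * (weight q' v * ind (b₂ < weight q' v)))) := by
      intro x v
      have e1 := weight_nonneg hp' x
      have e2 := weight_nonneg hq' v
      have e3 := mul_nonneg e1 e2
      have hone : 1 ≤ ind (good x v) + (ind (weight p x < a₁) + ind (b₁ < weight p' x) +
          (ind (weight q v < a₂) + ind (b₂ < weight q' v))) := by
        have n0 := ind_nonneg (good x v)
        have n1 := ind_nonneg (weight p x < a₁)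
        have n2 := ind_nonneg (b₁ < weight p' x)
        have n3 := ind_nonneg (weight q v < a₂)
        have n4 := ind_nonneg (b₂ < weight q' v)
        by_cases c1 : weight p x < a₁
        · rw [ind_true c1] at n1 ⊢; linarith
        by_cases c2 : b₁ < weight p' x
        · rw [ind_true c2] at n2 ⊢; linarith
        by_cases c3 : weight q v < a₂
        · rw [ind_true c3] at n3 ⊢; linarith
        by_cases c4 : b₂ < weight q' v
        · rw [ind_true c4] at n4 ⊢; linarith
        push Not at c1 c2 c3 c4
        rw [ind_true (show good x v from ⟨c1, c2, c3, c4⟩)]; linarith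
      nlinarith [mul_le_mul_of_nonneg_left hone e3]
    have hs := sum_le_sum (s := univ) fun x _ => sum_le_sum (s := univ) fun v _ => hpt x v
    simp only [sum_add_distrib] at hs
    have hL : ∑ x, ∑ v, weight p' x * weight q' v = 1 := by
      simp_rw [← Finset.mul_sum, sum_weight, mul_one, sum_weight]
    simp only [← Finset.mul_sum, sum_weight, mul_one] at hs
    rw [← Finset.sum_mul, ← Finset.sum_mul, sum_weight, one_mul, one_mul] at hs
    linarith
  have hcount : M / 2 ≤ ∑ x, ∑ v, ind (good x v) := by
    have hpt : ∀ x v, M * (weight p' x * weight q' v * ind (good x v)) ≤ ind (good x v) := by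
      intro x v
      by_cases hgd : good x v
      · rw [ind_true hgd, mul_one]
        have : weight p' x * weight q' v ≤ 1 / M :=
          (mul_le_mul hgd.2.1 hgd.2.2.2 (weight_nonneg hq' v) hb₁).trans hM
        calc M * (weight p' x * weight q' v) ≤ M * (1 / M) :=
              mul_le_mul_of_nonneg_left this hMpos.le
          _ = 1 := by field_simp
      · rw [ind_false hgd]; simp
    have hs := sum_le_sum (s := univ) fun x _ => sum_le_sum (s := univ) fun v _ => hpt x v
    simp only [← Finset.mul_sum] at hs
    nlinarith
  have hGcard : (#G : ℝ) = ∑ x, ∑ v, ind (x ≠ 0 ∧ good x v) := by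
    rw [Finset.natCast_card_filter, Fintype.sum_prod_type]
    refine sum_congr rfl fun x _ => ?_
    rw [← sum_ind_headVec h m (fun v => ind (x ≠ 0 ∧ good x v))]
    refine sum_congr rfl fun z _ => ?_
    by_cases c1 : headVec h z = m
    · simp [c1, ind]
    · simp [c1, ind]
  have hGge : M / 2 - 2 ^ n ≤ (#G : ℝ) := by
    rw [hGcard]
    have hpt : ∀ x v, ind (good x v) ≤ ind (x ≠ 0 ∧ good x v) + (if x = 0 then 1 else 0) := by
      intro x v
      by_cases hx : x = 0
      · rw [if_pos hx]; linarith [ind_le_one (good x v), ind_nonneg (x ≠ 0 ∧ good x v)]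
      · simp [hx]
    have hs := sum_le_sum (s := univ) fun x _ => sum_le_sum (s := univ) fun v _ => hpt x v
    simp only [sum_add_distrib, sum_const, card_univ, Fintype.card_pi, ZMod.card, prod_const,
      Fintype.card_fin, nsmul_eq_mul] at hs
    rw [← Finset.mul_sum, Finset.sum_ite_eq', if_pos (mem_univ _), mul_one] at hs
    push_cast at hs
    -- Dropping x = 0 loses at most 2ⁿ⁻ᵏ pairs.
    have : (2 : ℝ) ^ (n - k) ≤ 2 ^ n := pow_le_pow_right₀ (by norm_num) (Nat.sub_le n k)
    linarith
  have hGpos : (0 : ℝ) < #G := by linarith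
  have hGne : G.Nonempty := by
    rw [← Finset.card_pos]; exact_mod_cast hGpos
  have hG0 : ∀ a ∈ G, a.1 ≠ 0 ∧ a.2 ≠ 0 := by
    intro a ha
    simp only [G, mem_filter, mem_univ, true_and] at ha
    refine ⟨ha.1.1, fun e => hm ?_⟩
    rw [← ha.2, e]; rfl
  have hsec := avgGL_forall_notMem_le hn G hG0 hGne
  have hfail : avgGL n (fun H => ind (∀ x, encWeight h p m q H x < θ)) ≤
      avgGL n (fun H => if ∀ x, (x, parity H x) ∉ G then 1 else 0) := by
    refine avgGL_mono fun H => ?_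
    by_cases hf : ∀ x, encWeight h p m q H x < θ
    · rw [ind_true hf, if_pos]
      intro x hx
      simp only [G, mem_filter, mem_univ, true_and] at hx
      have := hf x
      rw [encWeight, ind_true hx.2, one_mul] at this
      have h2 := mul_le_mul hx.1.2.1 hx.1.2.2.2.1 ha₂.le (ha₁.le.trans hx.1.2.1)
      linarith
    · rw [ind_false hf]; split_ifs <;> norm_num
  have hdiv : numNonzero n / #G ≤ numNonzero n / (M / 2 - 2 ^ n) :=
    div_le_div_of_nonneg_left (by linarith) hg hGge
  linarith

lemma crossEntropy_nonneg {p' p : ℝ} (hp' : p' ∈ Set.Icc (0 : ℝ) 1) (hp : p ∈ Set.Icc (0 : ℝ) 1) :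
    0 ≤ crossEntropy p' p := by
  have h1 := Real.log_nonpos hp.1 hp.2
  have h2 := Real.log_nonpos (x := 1 - p) (by linarith [hp.2]) (by linarith [hp.1])
  exact add_nonneg (mul_nonneg hp'.1 (by linarith)) (mul_nonneg (by linarith [hp'.2]) (by linarith))

lemma tendsto_exp_neg_mul_nat {r : ℝ} (hr : 0 < r) :
    Tendsto (fun n : ℕ => Real.exp (-(r * n))) atTop (𝓝 0) :=
  Real.tendsto_exp_neg_atTop_nhds_zero.comp
    ((tendsto_natCast_atTop_atTop (R := ℝ)).const_mul_atTop hr)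

lemma two_pow_eq_exp (n : ℕ) : (2 : ℝ) ^ n = Real.exp (n * Real.log 2) := by
  rw [Real.exp_nat_mul, Real.exp_log (by norm_num)]

/-! ### The number of parity bits up to rounding -/

section Floor

variable {R : ℝ} {n : ℕ}

lemma floor_le_of_lt_one (hR : 0 ≤ R) (hR1 : R ≤ 1) : ⌊(n : ℝ) * R⌋₊ ≤ n := by
  have h1 : (⌊(n : ℝ) * R⌋₊ : ℝ) ≤ n * R := Nat.floor_le (by positivity)
  have h2 : (n : ℝ) * R ≤ n := mul_le_of_le_one_right (by positivity) hR1
  exact_mod_cast h1.trans h2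

lemma le_sub_floor (hR : 0 ≤ R) (hR1 : R ≤ 1) : n * (1 - R) ≤ ((n - ⌊(n : ℝ) * R⌋₊ : ℕ) : ℝ) := by
  rw [Nat.cast_sub (floor_le_of_lt_one hR hR1)]
  have h1 : (⌊(n : ℝ) * R⌋₊ : ℝ) ≤ n * R := Nat.floor_le (by positivity)
  linarith

lemma sub_floor_le (hR : 0 ≤ R) (hR1 : R ≤ 1) :
    ((n - ⌊(n : ℝ) * R⌋₊ : ℕ) : ℝ) ≤ n * (1 - R) + 1 := by
  rw [Nat.cast_sub (floor_le_of_lt_one hR hR1)]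
  have h1 := Nat.lt_floor_add_one ((n : ℝ) * R)
  linarith

end Floor

lemma failProb_le {S : Type*} [Fintype S] {PS : S → ℝ} (hPS : PS ∈ stdSimplex ℝ S)
    {PQ : ℝ →₀ ℝ} (hPQ : IsParityBias PQ) {pe pe' : S → ℝ}
    (hpe' : ∀ s, pe' s ∈ Set.Icc (0 : ℝ) 1)
    {t : ℝ → ℝ} (ht : ∀ q ∈ Set.Icc (0 : ℝ) 1, t q ∈ Set.Icc (0 : ℝ) 1)
    {n k : ℕ} (hn : 2 ≤ n) (h : k ≤ n)
    {m : Fin k → ZMod 2} (hm : m ≠ 0) {θ a₁ b₁ a₂ b₂ M : ℝ} (ha₁ : 0 < a₁) (ha₂ : 0 < a₂)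
    (hθ : θ ≤ a₁ * a₂) (hM : b₁ * b₂ ≤ 1 / M) (hM2 : 2 ^ n < M / 2) (hb₁ : 0 ≤ b₁) :
    failProb PS PQ pe h θ m ≤
      2 * (∑ s : Fin n → S, ∑ x, (∏ i, PS (s i)) * weight (fun i => pe' (s i)) x *
              ind (weight (fun i => pe (s i)) x < a₁) +
            ∑ s : Fin n → S, ∑ x, (∏ i, PS (s i)) * weight (fun i => pe' (s i)) x *
              ind (b₁ < weight (fun i => pe' (s i)) x) +
          (∑ q ∈ Fintype.piFinset (fun _ : Fin (n - k) => PQ.support), ∑ v, (∏ j, PQ (q j)) *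
              weight (fun i => t (q i)) v * ind (weight q v < a₂) +
            ∑ q ∈ Fintype.piFinset (fun _ : Fin (n - k) => PQ.support), ∑ v, (∏ j, PQ (q j)) *
              weight (fun i => t (q i)) v * ind (b₂ < weight (fun i => t (q i)) v))) +
        (numNonzero n / (M / 2 - 2 ^ n) + 1 / (numNonzero n - 1)) := by
  have key : failProb PS PQ pe h θ m ≤ avgQS PS PQ n k (fun q s =>
      2 * (∑ x, weight (fun i => pe' (s i)) x * ind (weight (fun i => pe (s i)) x < a₁) +
            ∑ x, weight (fun i => pe' (s i)) x * ind (b₁ < weight (fun i => pe' (s i)) x) +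
          (∑ v, weight (fun i => t (q i)) v * ind (weight q v < a₂) +
            ∑ v, weight (fun i => t (q i)) v * ind (b₂ < weight (fun i => t (q i)) v))) +
        (numNonzero n / (M / 2 - 2 ^ n) + 1 / (numNonzero n - 1))) := by
    refine avgQS_mono hPS hPQ fun q hq s _ => ?_
    exact avgGL_fail_le hn h (fun i => hpe' _)
      (fun i => ht _ (hPQ.support_subset _ (hq i))) hm ha₁ ha₂ hθ hM hM2 hb₁
  refine key.trans (le_of_eq ?_)
  rw [avgQS_add, avgQS_mul_left, avgQS_add, avgQS_add, avgQS_add, avgQS_const hPS hPQ,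
    avgQS_state hPQ, avgQS_state hPQ, avgQS_bias hPS, avgQS_bias hPS]
  simp only [mul_assoc, ← Finset.mul_sum]

/-- `hcross` says that typical pairs of the tilted law still have original weight above θ; `hent`
says that there are exponentially more than 2ⁿ of them. -/
lemma failProb_tilted {S : Type*} [Fintype S] {PS : S → ℝ} (hPS : PS ∈ stdSimplex ℝ S)
    {PQ : ℝ →₀ ℝ} (hPQ : IsParityBias PQ) {R : ℝ} (hR : 0 < R) (hR1 : R < 1) {pe pe' : S → ℝ}
    (hpe' : ∀ s, pe' s ∈ Set.Icc (0 : ℝ) 1)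
    {t : ℝ → ℝ} (ht : ∀ q ∈ Set.Icc (0 : ℝ) 1, t q ∈ Set.Icc (0 : ℝ) 1)
    (hacS : ∀ s b, bitProb (pe' s) b ≠ 0 → 0 < bitProb (pe s) b)
    (hacQ : ∀ q ∈ Set.Icc (0 : ℝ) 1, ∀ b, bitProb (t q) b ≠ 0 → 0 < bitProb q b) {δ : ℝ}
    (hcross : ∑ s, PS s * crossEntropy (pe' s) (pe s) +
      (1 - R) * ∑ q ∈ PQ.support, PQ q * crossEntropy (t q) q < Real.log 2 + δ)
    (hent : Real.log 2 < ∑ s, PS s * Real.binEntropy (pe' s) +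
      (1 - R) * ∑ q ∈ PQ.support, PQ q * Real.binEntropy (t q)) :
    ∃ u : ℕ → ℝ, Tendsto u atTop (𝓝 0) ∧ ∀ᶠ n : ℕ in atTop, ∀ (h : ⌊(n : ℝ) * R⌋₊ ≤ n) m, m ≠ 0 →
      failProb PS PQ pe h (Real.exp (-(n * (Real.log 2 + δ)))) m ≤ u n := by
  set α₁ := ∑ s, PS s * crossEntropy (pe' s) (pe s)
  set α₂ := ∑ q ∈ PQ.support, PQ q * crossEntropy (t q) q
  set h₁ := ∑ s, PS s * Real.binEntropy (pe' s)
  set h₂ := ∑ q ∈ PQ.support, PQ q * Real.binEntropy (t q)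
  have hα₂ : 0 ≤ α₂ := sum_nonneg fun q hq => mul_nonneg (hPQ.nonneg q)
    (crossEntropy_nonneg (ht q (hPQ.support_subset q hq)) (hPQ.support_subset q hq))
  have hh₂ : 0 ≤ h₂ := sum_nonneg fun q hq => mul_nonneg (hPQ.nonneg q)
    (Real.binEntropy_nonneg (ht q (hPQ.support_subset q hq)).1 (ht q (hPQ.support_subset q hq)).2)
  have hQmem : ∀ q, PQ q ≠ 0 → q ∈ Set.Icc (0 : ℝ) 1 := fun q hq =>
    hPQ.support_subset q (Finsupp.mem_support_iff.2 hq)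
  -- Of the 3ε, two pay for the Chernoff slacks and one for the rounding n - k ≤ n(1-R) + 1. Of the
  -- 4ε, two pay for the slacks and two remain, so that M = 2ⁿ exp(2εn).
  obtain ⟨ε, hε, hε1, hε2⟩ : ∃ ε : ℝ, 0 < ε ∧ α₁ + (1 - R) * α₂ + 3 * ε ≤ Real.log 2 + δ ∧
      Real.log 2 + 4 * ε ≤ h₁ + (1 - R) * h₂ := by
    refine ⟨min ((Real.log 2 + δ - (α₁ + (1 - R) * α₂)) / 3)
      ((h₁ + (1 - R) * h₂ - Real.log 2) / 4), ?_, ?_, ?_⟩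
    · apply lt_min <;> linarith
    · linarith [min_le_left ((Real.log 2 + δ - (α₁ + (1 - R) * α₂)) / 3)
        ((h₁ + (1 - R) * h₂ - Real.log 2) / 4)]
    · linarith [min_le_right ((Real.log 2 + δ - (α₁ + (1 - R) * α₂)) / 3)
        ((h₁ + (1 - R) * h₂ - Real.log 2) / 4)]
  obtain ⟨r₁, hr₁, hb₁⟩ := weight_chernoff_lt (D := univ) (P := PS) (p' := pe') (p := pe) hPS.1 hPS.2
    (fun s _ => hpe' s) (fun s _ => hacS s) (c := α₁ + ε) (by linarith)
  obtain ⟨r₂, hr₂, hb₂⟩ := weight_chernoff_gt (D := univ) (P := PS) (p' := pe') hPS.1 hPS.2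
    (fun s _ => hpe' s) (c := h₁ - ε) (by linarith)
  obtain ⟨r₃, hr₃, hb₃⟩ := weight_chernoff_lt (D := PQ.support) (P := PQ) (p' := t) (p := id)
    hPQ.nonneg hPQ.sum_eq_one (fun q hq => ht q (hQmem q hq)) (fun q hq => hacQ q (hQmem q hq))
    (c := α₂ + ε) (by simp only [id]; linarith)
  obtain ⟨r₄, hr₄, hb₄⟩ := weight_chernoff_gt (D := PQ.support) (P := PQ) (p' := t)
    hPQ.nonneg hPQ.sum_eq_one (fun q hq => ht q (hQmem q hq)) (c := h₂ - ε) (by linarith)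
  simp only [Fintype.piFinset_univ] at hb₁ hb₂
  have hR' : 0 < 1 - R := by linarith
  refine ⟨fun n => 2 * (Real.exp (-(r₁ * n)) + Real.exp (-(r₂ * n)) +
    (Real.exp (-(r₃ * (1 - R) * n)) + Real.exp (-(r₄ * (1 - R) * n)))) +
    (1 / (Real.exp (2 * ε * n) / 2 - 1) + 1 / (numNonzero n - 1)), ?_, ?_⟩
  · have hexp : Tendsto (fun n : ℕ => Real.exp (2 * ε * n)) atTop atTop :=
      Real.tendsto_exp_atTop.comp
        ((tendsto_natCast_atTop_atTop (R := ℝ)).const_mul_atTop (by positivity))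
    have hk1 : Tendsto (fun n : ℕ => 1 / (Real.exp (2 * ε * n) / 2 - 1)) atTop (𝓝 0) := by
      refine Tendsto.div_atTop tendsto_const_nhds ?_
      exact tendsto_atTop_add_const_right _ (-1) (hexp.atTop_div_const (by norm_num))
    have hk2 : Tendsto (fun n : ℕ => 1 / (numNonzero n - 1)) atTop (𝓝 0) := by
      refine Tendsto.div_atTop tendsto_const_nhds ?_
      have h2 : Tendsto (fun n : ℕ => (2 : ℝ) ^ n) atTop atTop :=
        tendsto_pow_atTop_atTop_of_one_lt (by norm_num)
      exact tendsto_atTop_add_const_right _ (-1) (tendsto_atTop_add_const_right _ (-1) h2)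
    have := (((((tendsto_exp_neg_mul_nat hr₁).add (tendsto_exp_neg_mul_nat hr₂)).add
      ((tendsto_exp_neg_mul_nat (mul_pos hr₃ hR')).add
        (tendsto_exp_neg_mul_nat (mul_pos hr₄ hR')))).const_mul 2).add (hk1.add hk2))
    simpa using this
  · have hlarge : ∀ᶠ n : ℕ in atTop, 2 ≤ n ∧ α₂ ≤ n * ε ∧ 2 < Real.exp (2 * ε * n) := by
      refine (eventually_ge_atTop 2).and (Eventually.and ?_ ?_)
      · exact ((tendsto_natCast_atTop_atTop (R := ℝ)).atTop_mul_const hε).eventually_ge_atTop α₂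
      · have hexp : Tendsto (fun n : ℕ => Real.exp (2 * ε * n)) atTop atTop :=
          Real.tendsto_exp_atTop.comp
            ((tendsto_natCast_atTop_atTop (R := ℝ)).const_mul_atTop (by positivity))
        exact hexp.eventually_gt_atTop 2
    filter_upwards [hlarge] with n ⟨hn2, hnα, hnexp⟩
    intro h m hm
    set k := ⌊(n : ℝ) * R⌋₊
    have hN1 : n * (1 - R) ≤ ((n - k : ℕ) : ℝ) := le_sub_floor hR.le hR1.le
    have hN2 : ((n - k : ℕ) : ℝ) ≤ n * (1 - R) + 1 := sub_floor_le hR.le hR1.le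
    have hN3 : ((n - k : ℕ) : ℝ) ≤ n := by exact_mod_cast Nat.sub_le n k
    set N := ((n - k : ℕ) : ℝ) with hNdef
    have hM : Real.exp (n * (Real.log 2 + 2 * ε)) = 2 ^ n * Real.exp (2 * ε * n) := by
      rw [two_pow_eq_exp, ← Real.exp_add]; ring_nf
    have hpow : (0 : ℝ) < 2 ^ n := by positivity
    have hθ : Real.exp (-(n * (Real.log 2 + δ))) ≤
        Real.exp (-(n * (α₁ + ε))) * Real.exp (-(N * (α₂ + ε))) := by
      rw [← Real.exp_add]
      refine Real.exp_le_exp.2 ?_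
      have e1 : N * α₂ ≤ (n * (1 - R) + 1) * α₂ := mul_le_mul_of_nonneg_right hN2 hα₂
      have e2 : N * ε ≤ n * ε := mul_le_mul_of_nonneg_right hN3 hε.le
      have e3 := mul_le_mul_of_nonneg_left hε1 (Nat.cast_nonneg (α := ℝ) n)
      nlinarith
    have hbb : Real.exp (-(n * (h₁ - ε))) * Real.exp (-(N * (h₂ - ε))) ≤
        1 / Real.exp (n * (Real.log 2 + 2 * ε)) := by
      rw [← Real.exp_add, one_div, ← Real.exp_neg]
      refine Real.exp_le_exp.2 ?_
      have e1 : n * (1 - R) * h₂ ≤ N * h₂ := mul_le_mul_of_nonneg_right hN1 hh₂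
      have e2 : N * ε ≤ n * ε := mul_le_mul_of_nonneg_right hN3 hε.le
      have e3 := mul_le_mul_of_nonneg_left hε2 (Nat.cast_nonneg (α := ℝ) n)
      nlinarith
    have hM2 : (2 : ℝ) ^ n < Real.exp (n * (Real.log 2 + 2 * ε)) / 2 := by
      rw [hM]; nlinarith
    have hκ : numNonzero n / (Real.exp (n * (Real.log 2 + 2 * ε)) / 2 - 2 ^ n) ≤
        1 / (Real.exp (2 * ε * n) / 2 - 1) := by
      rw [hM, div_le_div_iff₀ (by nlinarith) (by linarith), numNonzero]
      nlinarith
    have hdec : ∀ r : ℝ, 0 < r → Real.exp (-(r * N)) ≤ Real.exp (-(r * (1 - R) * n)) := by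
      intro r hr
      refine Real.exp_le_exp.2 ?_
      nlinarith [mul_le_mul_of_nonneg_left hN1 hr.le]
    have key := failProb_le hPS hPQ hpe' ht hn2 h hm (pe := pe) (Real.exp_pos _) (Real.exp_pos _)
      hθ hbb hM2 (Real.exp_pos _).le
    refine key.trans (add_le_add (mul_le_mul_of_nonneg_left (add_le_add
      (add_le_add (hb₁ n) (hb₂ n)) (add_le_add ((hb₃ (n - k)).trans (hdec _ hr₃))
      ((hb₄ (n - k)).trans (hdec _ hr₄)))) (by norm_num)) (add_le_add hκ le_rfl))

/-! ### Tilting biases towards `1/2` -/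

open Classical in
/-- Move a bias other than `0` and `1` towards `1/2`. -/
noncomputable def tilt (l p : ℝ) : ℝ := if p = 0 ∨ p = 1 then p else (1 - l) * p + l / 2

lemma tilt_mem {l p : ℝ} (hl : l ∈ Set.Icc (0 : ℝ) 1) (hp : p ∈ Set.Icc (0 : ℝ) 1) :
    tilt l p ∈ Set.Icc (0 : ℝ) 1 := by
  unfold tilt
  split_ifs with h
  · exact hp
  · obtain ⟨h1, h2⟩ := hl
    obtain ⟨h3, h4⟩ := hp
    constructor <;> nlinarith

/-- Because 0 and 1 are left fixed, the tilted law is absolutely continuous with respect to the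
original one. -/
lemma bitProb_pos_of_tilt {l p : ℝ} (hp : p ∈ Set.Icc (0 : ℝ) 1) {b : ZMod 2}
    (h : bitProb (tilt l p) b ≠ 0) : 0 < bitProb p b := by
  by_cases h01 : p = 0 ∨ p = 1
  · rw [tilt, if_pos h01] at h
    exact lt_of_le_of_ne (bitProb_nonneg hp b) h.symm
  · push Not at h01
    have h0 := lt_of_le_of_ne hp.1 h01.1.symm
    have h1 := lt_of_le_of_ne hp.2 h01.2
    unfold bitProb
    split_ifs <;> linarith

lemma continuous_tilt (p : ℝ) : Continuous (fun l => tilt l p) := by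
  unfold tilt
  split_ifs
  · exact continuous_const
  · fun_prop

lemma tilt_zero (p : ℝ) : tilt 0 p = p := by
  unfold tilt; split_ifs <;> simp

/-- Strict concavity on the segment from `p` to 1/2, where the entropy is maximal. -/
lemma binEntropy_lt_tilt {l p : ℝ} (hl : l ∈ Set.Ioo (0 : ℝ) 1) (hp : p ∈ Set.Icc (0 : ℝ) 1)
    (h : p ∉ ({0, 1 / 2, 1} : Set ℝ)) : Real.binEntropy p < Real.binEntropy (tilt l p) := by
  simp only [Set.mem_insert_iff, Set.mem_singleton_iff, not_or] at h
  rw [tilt, if_neg (by tauto)]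
  have hhalf : (1 / 2 : ℝ) ∈ Set.Icc (0 : ℝ) 1 := ⟨by norm_num, by norm_num⟩
  have hl' : 0 < 1 - l := by linarith [hl.2]
  have hc := Real.strictConcave_binEntropy.2 hp hhalf h.2.1 hl' hl.1 (by ring)
  simp only [smul_eq_mul] at hc
  have h2 : Real.binEntropy p ≤ Real.binEntropy (1 / 2) := by
    rw [one_div, Real.binEntropy_two_inv]; exact Real.binEntropy_le_log_two
  rw [show (1 - l) * p + l / 2 = (1 - l) * p + l * (1 / 2) by ring]
  nlinarith [hl.1]

lemma binEntropy_le_tilt {l p : ℝ} (hl : l ∈ Set.Ioo (0 : ℝ) 1) (hp : p ∈ Set.Icc (0 : ℝ) 1) :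
    Real.binEntropy p ≤ Real.binEntropy (tilt l p) := by
  by_cases h : p ∈ ({0, 1 / 2, 1} : Set ℝ)
  · have : tilt l p = p := by
      simp only [Set.mem_insert_iff, Set.mem_singleton_iff] at h
      unfold tilt
      split_ifs with h'
      · rfl
      · rcases h with h | h | h
        · exact absurd (Or.inl h) h'
        · rw [h]; ring
        · exact absurd (Or.inr h) h'
    rw [this]
  · exact (binEntropy_lt_tilt hl hp h).le

/-- At l = 0 entropy and cross entropy both equal log 2. By continuity the cross entropy stays below
log 2 + δ for small l > 0, while the entropy strictly increases since some bias of positive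
probability moves. -/
lemma failProb_of_exists {S : Type*} [Fintype S] {PS : S → ℝ} (hPS : PS ∈ stdSimplex ℝ S)
    {PQ : ℝ →₀ ℝ} (hPQ : IsParityBias PQ) {R : ℝ} (hR : 0 < R) (hR1 : R < 1) {pe : S → ℝ}
    (hpe : ∀ s, pe s ∈ Set.Icc (0 : ℝ) 1)
    (hbal : ∑ s, PS s * Real.binEntropy (pe s) +
      (1 - R) * ∑ q ∈ PQ.support, PQ q * Real.binEntropy q = Real.log 2)
    (hnd : (∃ s, PS s ≠ 0 ∧ pe s ∉ ({0, 1 / 2, 1} : Set ℝ)) ∨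
      ∃ q ∈ PQ.support, q ∉ ({0, 1 / 2, 1} : Set ℝ)) {δ : ℝ} (hδ : 0 < δ) :
    ∃ u : ℕ → ℝ, Tendsto u atTop (𝓝 0) ∧ ∀ᶠ n : ℕ in atTop, ∀ (h : ⌊(n : ℝ) * R⌋₊ ≤ n) m, m ≠ 0 →
      failProb PS PQ pe h (Real.exp (-(n * (Real.log 2 + δ)))) m ≤ u n := by
  have hcont : Continuous (fun l => ∑ s, PS s * crossEntropy (tilt l (pe s)) (pe s) +
      (1 - R) * ∑ q ∈ PQ.support, PQ q * crossEntropy (tilt l q) q) := by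
    have hce : ∀ p : ℝ, Continuous (fun l => crossEntropy (tilt l p) p) := by
      intro p
      unfold crossEntropy
      have := continuous_tilt p
      fun_prop
    refine Continuous.add (continuous_finsetSum _ fun s _ => continuous_const.mul (hce _))
      (continuous_const.mul (continuous_finsetSum _ fun q _ => continuous_const.mul (hce _)))
  have h0 : Tendsto (fun l => ∑ s, PS s * crossEntropy (tilt l (pe s)) (pe s) +
      (1 - R) * ∑ q ∈ PQ.support, PQ q * crossEntropy (tilt l q) q) (𝓝 0) (𝓝 (Real.log 2)) := by
    have := hcont.tendsto 0
    simp only [tilt_zero, crossEntropy_self, hbal] at this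
    exact this
  have hev : ∀ᶠ l : ℝ in 𝓝[>] 0, (∑ s, PS s * crossEntropy (tilt l (pe s)) (pe s) +
      (1 - R) * ∑ q ∈ PQ.support, PQ q * crossEntropy (tilt l q) q < Real.log 2 + δ) ∧
      l ∈ Set.Ioo (0 : ℝ) 1 := by
    refine Eventually.and ?_ (Ioo_mem_nhdsGT (by norm_num))
    exact (h0.mono_left nhdsWithin_le_nhds).eventually (gt_mem_nhds (by linarith))
  obtain ⟨l, hl1, hl2⟩ := hev.exists
  have hlI : l ∈ Set.Icc (0 : ℝ) 1 := ⟨hl2.1.le, hl2.2.le⟩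
  have hsS : ∀ s, PS s * Real.binEntropy (pe s) ≤ PS s * Real.binEntropy (tilt l (pe s)) :=
    fun s => mul_le_mul_of_nonneg_left (binEntropy_le_tilt hl2 (hpe s)) (hPS.1 s)
  have hsQ : ∀ q ∈ PQ.support, PQ q * Real.binEntropy q ≤ PQ q * Real.binEntropy (tilt l q) :=
    fun q hq => mul_le_mul_of_nonneg_left (binEntropy_le_tilt hl2 (hPQ.support_subset q hq))
      (hPQ.nonneg q)
  refine failProb_tilted hPS hPQ hR hR1 (pe' := fun s => tilt l (pe s)) (t := tilt l)
    (fun s => tilt_mem hlI (hpe s)) (fun q hq => tilt_mem hlI hq)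
    (fun s b h => bitProb_pos_of_tilt (hpe s) h) (fun q hq b h => bitProb_pos_of_tilt hq h) hl1 ?_
  rw [← hbal]
  have hR' : 0 < 1 - R := by linarith
  rcases hnd with ⟨s, hs, hsn⟩ | ⟨q, hq, hqn⟩
  · refine add_lt_add_of_lt_of_le (sum_lt_sum (fun s _ => hsS s) ⟨s, mem_univ s, ?_⟩)
      (mul_le_mul_of_nonneg_left (sum_le_sum hsQ) hR'.le)
    exact mul_lt_mul_of_pos_left (binEntropy_lt_tilt hl2 (hpe s) hsn)
      (lt_of_le_of_ne (hPS.1 s) hs.symm)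
  · refine add_lt_add_of_le_of_lt (sum_le_sum fun s _ => hsS s)
      (mul_lt_mul_of_pos_left (sum_lt_sum hsQ ⟨q, hq, ?_⟩) hR')
    exact mul_lt_mul_of_pos_left (binEntropy_lt_tilt hl2 (hPQ.support_subset q hq) hqn)
      (lt_of_le_of_ne (hPQ.nonneg q) (Finsupp.mem_support_iff.1 hq).symm)

/-- All parities are prescribed and all codewords are equally likely: inverting H gives an exact
solution of weight 2⁻ⁿ, for every H. -/
lemma failProb_of_half {S : Type*} [Fintype S] {PS : S → ℝ} (hPS : PS ∈ stdSimplex ℝ S)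
    {PQ : ℝ →₀ ℝ} (hPQ : IsParityBias PQ) {pe : S → ℝ} (hpe : ∀ s, PS s ≠ 0 → pe s = 1 / 2)
    (hQ : ∀ q ∈ PQ.support, q = 0 ∨ q = 1) {δ : ℝ} (hδ : 0 < δ) {n k : ℕ} (h : k ≤ n)
    (m : Fin k → ZMod 2) :
    failProb PS PQ pe h (Real.exp (-(n * (Real.log 2 + δ)))) m ≤ 0 := by
  rw [failProb, ← avgQS_const hPS hPQ (n := n) (k := k) 0]
  refine avgQS_mono hPS hPQ fun q hq s hs => ?_
  rw [← avgGL_const n 0]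
  refine avgGL_mono fun H => ?_
  rw [ind_false]
  push Not
  obtain ⟨z, hz1, hz2⟩ := exists_headVec_tailVec h m (fun j => if q j = 1 then (1 : ZMod 2) else 0)
  refine ⟨parity H⁻¹ z, ?_⟩
  have hqv : q = fun j => if (tailVec z : Fin (n - k) → ZMod 2) j = 1 then (1 : ℝ) else 0 := by
    ext j
    rw [hz2]
    rcases hQ _ (hq j) with e | e <;> simp [e]
  have hp : (fun i => pe (s i)) = fun _ => (1 / 2 : ℝ) := funext fun i => hpe _ (hs i)
  have hw : weight q (tailVec z) = 1 := by
    conv_lhs => rw [hqv]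
    rw [weight_bits, ind_true rfl]
  rw [encWeight, parity_parity_inv, hp, weight_half, ind_true hz1, hw, one_mul, mul_one]
  rw [one_div, inv_pow, two_pow_eq_exp, ← Real.exp_neg]
  refine Real.exp_le_exp.2 ?_
  have : (0 : ℝ) ≤ n := Nat.cast_nonneg n
  nlinarith

/-- With probability tending to `1`, the encoder finds a codeword of weight at least
`2^{-n(1+o(1))}`. -/
lemma exists_failProb_bound {S : Type*} [Fintype S] {PS : S → ℝ} (hPS : PS ∈ stdSimplex ℝ S)
    {PQ : ℝ →₀ ℝ} (hPQ : IsParityBias PQ) {R : ℝ} (hR : 0 < R) (hR1 : R < 1) {pe : S → ℝ}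
    (hpe : ∀ s, pe s ∈ Set.Icc (0 : ℝ) 1)
    (hbal : ∑ s, PS s * Real.binEntropy (pe s) +
      (1 - R) * ∑ q ∈ PQ.support, PQ q * Real.binEntropy q = Real.log 2)
    (hnd : (∃ s, PS s ≠ 0 ∧ pe s ∉ ({0, 1 / 2, 1} : Set ℝ)) ∨
      (∃ q ∈ PQ.support, q ∉ ({0, 1 / 2, 1} : Set ℝ)) ∨
      (∀ s, PS s ≠ 0 → pe s ∉ ({0, 1} : Set ℝ))) {δ : ℝ} (hδ : 0 < δ) :
    ∃ u : ℕ → ℝ, Tendsto u atTop (𝓝 0) ∧ ∀ᶠ n : ℕ in atTop, ∀ (h : ⌊(n : ℝ) * R⌋₊ ≤ n) m, m ≠ 0 →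
      failProb PS PQ pe h (Real.exp (-(n * (Real.log 2 + δ)))) m ≤ u n := by
  by_cases h12 : (∃ s, PS s ≠ 0 ∧ pe s ∉ ({0, 1 / 2, 1} : Set ℝ)) ∨
      ∃ q ∈ PQ.support, q ∉ ({0, 1 / 2, 1} : Set ℝ)
  · exact failProb_of_exists hPS hPQ hR hR1 hpe hbal h12 hδ
  have h3 : ∀ s, PS s ≠ 0 → pe s ∉ ({0, 1} : Set ℝ) := by
    rcases hnd with h | h | h
    · exact absurd (Or.inl h) h12
    · exact absurd (Or.inr h) h12
    · exact h
  push Not at h12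
  have hhalf : ∀ s, PS s ≠ 0 → pe s = 1 / 2 := by
    intro s hs
    have a := h12.1 s hs
    have b := h3 s hs
    simp only [Set.mem_insert_iff, Set.mem_singleton_iff, not_or] at a b
    tauto
  -- Uniform codeword bits alone exhaust the balance, so E[H_b(Q)] = 0 and every parity bias is 0 or
  -- 1.
  have hS : ∑ s, PS s * Real.binEntropy (pe s) = Real.log 2 := by
    rw [← one_mul (Real.log 2), ← hPS.2, Finset.sum_mul]
    refine sum_congr rfl fun s _ => ?_
    by_cases hs : PS s = 0
    · simp [hs]
    · rw [hhalf s hs, one_div, Real.binEntropy_two_inv]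
  have hQ0 : ∑ q ∈ PQ.support, PQ q * Real.binEntropy q = 0 := by
    have : (1 - R) * ∑ q ∈ PQ.support, PQ q * Real.binEntropy q = 0 := by linarith
    exact (mul_eq_zero.1 this).resolve_left (by linarith)
  have hQ : ∀ q ∈ PQ.support, q = 0 ∨ q = 1 := by
    intro q hq
    have hI := hPQ.support_subset q hq
    have := (Finset.sum_eq_zero_iff_of_nonneg (fun q hq => mul_nonneg (hPQ.nonneg q)
      (Real.binEntropy_nonneg (hPQ.support_subset q hq).1 (hPQ.support_subset q hq).2))).1 hQ0 q hq
    have := (mul_eq_zero.1 this).resolve_left (Finsupp.mem_support_iff.1 hq)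
    exact Real.binEntropy_eq_zero.1 this
  exact ⟨fun _ => 0, tendsto_const_nhds, Eventually.of_forall fun n h m _ =>
    failProb_of_half hPS hPQ hhalf hQ hδ h m⟩

/-! ### Information quantities in nats -/

lemma kernel_zero {p : ZMod 2 → ℝ} (hp : p ∈ stdSimplex ℝ (ZMod 2)) : p 0 = 1 - p 1 := by
  have := hp.2
  rw [sum_zmod_two] at this
  linarith

lemma bitProb_kernel {p : ZMod 2 → ℝ} (hp : p ∈ stdSimplex ℝ (ZMod 2)) (b : ZMod 2) :
    bitProb (p 1) b = p b := by
  by_cases hb : b = 0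
  · rw [hb, bitProb_zero, kernel_zero hp]
  · rw [zmod_two_eq_one_of_ne_zero hb, bitProb_one]

lemma kernel_mem {p : ZMod 2 → ℝ} (hp : p ∈ stdSimplex ℝ (ZMod 2)) : p 1 ∈ Set.Icc (0 : ℝ) 1 := by
  have h0 := hp.1 0
  have h1 := hp.1 1
  rw [kernel_zero hp] at h0
  exact ⟨h1, by linarith⟩

lemma log_two_pos : 0 < Real.log 2 := Real.log_pos (by norm_num)

lemma entropy_mul_log_two {A : Type*} [Fintype A] (p : A → ℝ) :
    entropy p * Real.log 2 = -∑ a, p a * Real.log (p a) := by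
  have := log_two_pos
  rw [entropy, neg_mul, Finset.sum_mul]
  congr 1
  refine sum_congr rfl fun a _ => ?_
  rw [Real.logb]; field_simp

lemma entropy_binary {p : ZMod 2 → ℝ} (hp : p ∈ stdSimplex ℝ (ZMod 2)) :
    entropy p * Real.log 2 = Real.binEntropy (p 1) := by
  rw [entropy_mul_log_two, sum_zmod_two, kernel_zero hp, Real.binEntropy]
  simp only [Real.log_inv]; ring

lemma condEntropy_binary {S : Type*} [Fintype S] {PS : S → ℝ} {PX : S → ZMod 2 → ℝ}
    (hPX : IsKernel PX) :
    condEntropy PS PX * Real.log 2 = ∑ s, PS s * Real.binEntropy (PX s 1) := by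
  rw [condEntropy, Finset.sum_mul]
  refine sum_congr rfl fun s _ => ?_
  rw [mul_assoc, entropy_binary (hPX s)]

lemma meanBinEntropy_mul (PQ : ℝ →₀ ℝ) :
    meanBinEntropy PQ * Real.log 2 = ∑ q ∈ PQ.support, PQ q * Real.binEntropy q := by
  have := log_two_pos
  rw [meanBinEntropy, Finset.sum_mul]
  refine sum_congr rfl fun q _ => ?_
  field_simp

/-- Valid also at zero, thanks to log 0 = 0; this gives the chain rule for entropy without
positivity assumptions. -/
lemma mul_log_mul {a b : ℝ} : a * b * Real.log (a * b) = b * (a * Real.log a) + a * (b * Real.log b) := by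
  by_cases ha : a = 0
  · simp [ha]
  by_cases hb : b = 0
  · simp [hb]
  rw [Real.log_mul ha hb]; ring

lemma entropy_joint {S : Type*} [Fintype S] {PS : S → ℝ} {PX : S → ZMod 2 → ℝ}
    (hPX : IsKernel PX) :
    entropy (fun xs : ZMod 2 × S => jointXS PS PX xs.1 xs.2) =
      entropy PS + condEntropy PS PX := by
  refine mul_right_cancel₀ log_two_pos.ne' ?_
  rw [add_mul, entropy_mul_log_two, entropy_mul_log_two, condEntropy, Finset.sum_mul]
  simp_rw [mul_assoc, entropy_mul_log_two]
  rw [Fintype.sum_prod_type_right]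
  simp only [jointXS, mul_neg, Finset.sum_neg_distrib]
  rw [← neg_add, ← sum_add_distrib]
  congr 1
  refine sum_congr rfl fun s _ => ?_
  simp_rw [mul_log_mul, sum_add_distrib]
  rw [← Finset.sum_mul, (hPX s).2, one_mul, ← Finset.mul_sum]

section Joint

variable {S Y : Type*} [Fintype S] [Fintype Y] {PS : S → ℝ} {PX : S → ZMod 2 → ℝ}
  {W : S → ZMod 2 → Y → ℝ}

lemma jointXY_nonneg (hPS : PS ∈ stdSimplex ℝ S) (hPX : IsKernel PX) (hW : IsStateChannel W)
    (x : ZMod 2) (y : Y) : 0 ≤ jointXY PS PX W x y :=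
  sum_nonneg fun s _ => mul_nonneg (mul_nonneg (hPS.1 s) ((hPX s).1 x)) ((hW s x).1 y)

lemma jointXY_sum_output (hW : IsStateChannel W) (x : ZMod 2) :
    ∑ y, jointXY PS PX W x y = ∑ s, jointXS PS PX x s := by
  simp only [jointXY, jointXS]
  rw [sum_comm]
  refine sum_congr rfl fun s _ => ?_
  rw [← Finset.mul_sum, (hW s x).2, mul_one]

lemma jointXY_sum (hPS : PS ∈ stdSimplex ℝ S) (hPX : IsKernel PX) (hW : IsStateChannel W) :
    ∑ x, ∑ y, jointXY PS PX W x y = 1 := by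
  simp_rw [jointXY_sum_output hW, jointXS]
  rw [sum_comm]
  simp_rw [← Finset.mul_sum, (hPX _).2, mul_one]
  exact hPS.2

lemma decBias_mem (hPS : PS ∈ stdSimplex ℝ S) (hPX : IsKernel PX) (hW : IsStateChannel W) (y : Y) :
    decBias PS PX W y ∈ Set.Icc (0 : ℝ) 1 := by
  have h0 := jointXY_nonneg hPS hPX hW 0 y
  have h1 := jointXY_nonneg hPS hPX hW 1 y
  rw [decBias, sum_zmod_two]
  exact ⟨div_nonneg h1 (add_nonneg h0 h1), div_le_one_of_le₀ (by linarith) (add_nonneg h0 h1)⟩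

lemma bitProb_decBias {S Y : Type*} [Fintype S] {PS : S → ℝ} {PX : S → ZMod 2 → ℝ}
    {W : S → ZMod 2 → Y → ℝ} {y : Y} (hy : ∑ x, jointXY PS PX W x y ≠ 0) (x : ZMod 2) :
    bitProb (decBias PS PX W y) x = jointXY PS PX W x y / ∑ x, jointXY PS PX W x y := by
  by_cases hx : x = 0
  · rw [hx, bitProb_zero, decBias, eq_div_iff hy, sub_mul, div_mul_cancel₀ _ hy, sum_zmod_two]
    ring
  · rw [zmod_two_eq_one_of_ne_zero hx, bitProb_one, decBias]

lemma jointXY_marginal_ne_zero (hPS : PS ∈ stdSimplex ℝ S) (hPX : IsKernel PX)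
    (hW : IsStateChannel W) {x : ZMod 2} {y : Y} (h : jointXY PS PX W x y ≠ 0) :
    ∑ x, jointXY PS PX W x y ≠ 0 := by
  intro h0
  rw [Finset.sum_eq_zero_iff_of_nonneg (fun x _ => jointXY_nonneg hPS hPX hW x y)] at h0
  exact h (h0 x (mem_univ x))

/-- The arbitrary value of `decBias` at outputs of probability zero is harmless: on the support of
the joint law the decoder's weights are positive, as the Chernoff bound requires. -/
lemma bitProb_decBias_pos (hPS : PS ∈ stdSimplex ℝ S) (hPX : IsKernel PX)
    (hW : IsStateChannel W) {x : ZMod 2} {y : Y} (h : jointXY PS PX W x y ≠ 0) :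
    0 < bitProb (decBias PS PX W y) x := by
  have hm := jointXY_marginal_ne_zero hPS hPX hW h
  rw [bitProb_decBias hm]
  exact div_pos (lt_of_le_of_ne (jointXY_nonneg hPS hPX hW x y) h.symm)
    (lt_of_le_of_ne (sum_nonneg fun x _ => jointXY_nonneg hPS hPX hW x y) hm.symm)

/-- The conditional entropy `H(X|Y)` in nats. -/
noncomputable def decEntropy (PS : S → ℝ) (PX : S → ZMod 2 → ℝ) (W : S → ZMod 2 → Y → ℝ) : ℝ :=
  ∑ x, ∑ y, jointXY PS PX W x y * -Real.log (bitProb (decBias PS PX W y) x)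

lemma decEntropy_nonneg (hPS : PS ∈ stdSimplex ℝ S) (hPX : IsKernel PX) (hW : IsStateChannel W) :
    0 ≤ decEntropy PS PX W := by
  refine sum_nonneg fun x _ => sum_nonneg fun y _ =>
    mul_nonneg (jointXY_nonneg hPS hPX hW x y) ?_
  have hd := decBias_mem hPS hPX hW y
  have : bitProb (decBias PS PX W y) x ≤ 1 := by
    unfold bitProb
    split_ifs
    · exact hd.2
    · linarith [hd.1]
  linarith [Real.log_nonpos (bitProb_nonneg hd x) this]

/-- Both joint laws have the same X-marginal, so H(X) cancels and the rate becomes H(X|S) - H(X|Y).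
-/
lemma rate_mul_log_two (hPS : PS ∈ stdSimplex ℝ S) (hPX : IsKernel PX) (hW : IsStateChannel W) :
    (mutualInfo (jointXY PS PX W) - mutualInfo (jointXS PS PX)) * Real.log 2 =
      ∑ s, PS s * Real.binEntropy (PX s 1) - decEntropy PS PX W := by
  have hS : (fun s => ∑ x, jointXS PS PX x s) = PS := by
    ext s; simp only [jointXS]; rw [← Finset.mul_sum, (hPX s).2, mul_one]
  have hX : (fun x => ∑ y, jointXY PS PX W x y) = fun x => ∑ s, jointXS PS PX x s :=
    funext fun x => jointXY_sum_output hW x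
  have hD : decEntropy PS PX W =
      (entropy (fun ab : ZMod 2 × Y => jointXY PS PX W ab.1 ab.2) -
        entropy (fun y => ∑ x, jointXY PS PX W x y)) * Real.log 2 := by
    rw [sub_mul, entropy_mul_log_two, entropy_mul_log_two, Fintype.sum_prod_type, decEntropy]
    rw [sum_comm, sum_comm (f := fun x y => jointXY PS PX W (x, y).1 (x, y).2 *
      Real.log (jointXY PS PX W (x, y).1 (x, y).2)), sub_neg_eq_add, ← Finset.sum_neg_distrib,
      ← sum_add_distrib]
    refine sum_congr rfl fun y _ => ?_
    rw [Finset.sum_mul, ← Finset.sum_neg_distrib, ← sum_add_distrib]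
    refine sum_congr rfl fun x _ => ?_
    by_cases h : jointXY PS PX W x y = 0
    · simp [h]
    · have hm := jointXY_marginal_ne_zero hPS hPX hW h
      rw [bitProb_decBias hm, Real.log_div h hm]
      ring
  rw [mutualInfo, mutualInfo, hX, hS, entropy_joint hPX, ← condEntropy_binary hPX, hD]
  ring

end Joint

/-! ### Exponential bounds for the atypical events -/

lemma weight_encBias {S : Type*} {PX : S → ZMod 2 → ℝ} (hPX : IsKernel PX) {n : ℕ} (s : Fin n → S)
    (x : Fin n → ZMod 2) : weight (fun i => encBias PX (s i)) x = ∏ i, PX (s i) (x i) := by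
  rw [weight_eq_prod_bitProb]
  exact prod_congr rfl fun i _ => bitProb_kernel (hPX _) _

/-- Summing out the states leaves i.i.d. pairs (x, y) with law P_{XY}, and the mean of -log P_{X|Y}
is H(X|Y). -/
lemma exists_decoder_weight_bound {S Y : Type*} [Fintype S] [Fintype Y] {PS : S → ℝ}
    {PX : S → ZMod 2 → ℝ} {W : S → ZMod 2 → Y → ℝ}
    (hPS : PS ∈ stdSimplex ℝ S) (hPX : IsKernel PX) (hW : IsStateChannel W) {c : ℝ}
    (hc : decEntropy PS PX W < c) :
    ∃ r : ℝ, 0 < r ∧ ∀ n : ℕ, ∑ s : Fin n → S, ∑ x : Fin n → ZMod 2, ∑ y : Fin n → Y,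
      (∏ i, PS (s i)) * weight (fun i => encBias PX (s i)) x * (∏ i, W (s i) (x i) (y i)) *
        ind (weight (fun i => decBias PS PX W (y i)) x < Real.exp (-(n * c))) ≤
      Real.exp (-(r * n)) := by
  classical
  obtain ⟨r, hr, h⟩ := chernoff_prod_lt univ (jointXY PS PX W)
    (fun x y => bitProb (decBias PS PX W y) x) (jointXY_nonneg hPS hPX hW)
    (jointXY_sum hPS hPX hW) (fun x _ y h => bitProb_decBias_pos hPS hPX hW h) (c := c) hc
  refine ⟨r, hr, fun n => le_trans (le_of_eq ?_) (h n)⟩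
  rw [Fintype.piFinset_univ, sum_comm]
  refine sum_congr rfl fun x _ => ?_
  rw [sum_comm]
  refine sum_congr rfl fun y _ => ?_
  have hs : ∑ s : Fin n → S, ∏ i, PS (s i) * PX (s i) (x i) * W (s i) (x i) (y i) =
      ∏ i, jointXY PS PX W (x i) (y i) := by
    have h := Finset.prod_univ_sum (fun _ : Fin n => (univ : Finset S))
      (fun i s => PS s * PX s (x i) * W s (x i) (y i))
    rw [Fintype.piFinset_univ] at h
    exact h.symm
  rw [← hs, Finset.sum_mul]
  refine sum_congr rfl fun s _ => ?_
  rw [weight_encBias hPX, prod_mul_distrib, prod_mul_distrib, ind_eq_ite]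
  rfl

/-- Two one-sided Chernoff bounds for the indicator of the letter (a, b). -/
lemma exists_empirical_bound_letter {S : Type*} [Fintype S] [DecidableEq S] {PS : S → ℝ}
    {PX : S → ZMod 2 → ℝ} (hPS : PS ∈ stdSimplex ℝ S) (hPX : IsKernel PX) {ε : ℝ} (hε : 0 < ε)
    (a : S) (b : ZMod 2) :
    ∃ r : ℝ, 0 < r ∧ ∀ n : ℕ, 0 < n → ∑ s : Fin n → S, ∑ x : Fin n → ZMod 2,
      (∏ i, PS (s i)) * weight (fun i => encBias PX (s i)) x *
        ind (ε ≤ |empirical s x a b - PS a * PX a b|) ≤ 2 * Real.exp (-(r * n)) := by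
  classical
  have h0 : ∀ s x, 0 ≤ PS s * PX s x := fun s x => mul_nonneg (hPS.1 s) ((hPX s).1 x)
  have h1 : ∑ s, ∑ x, PS s * PX s x = 1 := by
    simp_rw [← Finset.mul_sum, (hPX _).2, mul_one]; exact hPS.2
  have hmean : ∑ s, ∑ x, PS s * PX s x * (if s = a ∧ x = b then 1 else 0) = PS a * PX a b := by
    rw [Finset.sum_eq_single a, Finset.sum_eq_single b]
    · simp
    · intro x _ hx; simp [hx]
    · simp
    · intro s _ hs; simp [hs]
    · simp
  obtain ⟨r, hr, hb⟩ := chernoff univ (fun s x => PS s * PX s x)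
    (fun s x => if s = a ∧ x = b then 1 else 0) h0 h1 (c := PS a * PX a b + ε)
    (by rw [hmean]; linarith)
  obtain ⟨r', hr', hb'⟩ := chernoff univ (fun s x => PS s * PX s x)
    (fun s x => -(if s = a ∧ x = b then 1 else 0)) h0 h1 (c := -(PS a * PX a b) + ε)
    (by simp only [mul_neg, Finset.sum_neg_distrib]; rw [hmean]; linarith)
  simp only [Fintype.piFinset_univ] at hb hb'
  refine ⟨min r r', lt_min hr hr', fun n hn => ?_⟩
  have hnpos : (0 : ℝ) < n := by exact_mod_cast hn
  have hbr : Real.exp (-(r * n)) ≤ Real.exp (-(min r r' * n)) :=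
    Real.exp_le_exp.2 (neg_le_neg (mul_le_mul_of_nonneg_right (min_le_left _ _) hnpos.le))
  have hbr' : Real.exp (-(r' * n)) ≤ Real.exp (-(min r r' * n)) :=
    Real.exp_le_exp.2 (neg_le_neg (mul_le_mul_of_nonneg_right (min_le_right _ _) hnpos.le))
  have hsum := add_le_add ((hb n).trans hbr) ((hb' n).trans hbr')
  rw [← two_mul, ← sum_add_distrib] at hsum
  refine le_trans (sum_le_sum fun s _ => ?_) hsum
  rw [← sum_add_distrib]
  refine sum_le_sum fun x _ => ?_
  rw [weight_encBias hPX, ← prod_mul_distrib, ← mul_add]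
  refine mul_le_mul_of_nonneg_left ?_ (prod_nonneg fun i _ => h0 _ _)
  have hemp : ∑ i, (if s i = a ∧ x i = b then (1 : ℝ) else 0) = n * empirical s x a b := by
    rw [empirical, Finset.natCast_card_filter]; field_simp
  by_cases he : ε ≤ |empirical s x a b - PS a * PX a b|
  swap
  · rw [ind_false he]; split_ifs <;> norm_num
  rw [ind_true he]
  rcases le_abs.1 he with hc | hc
  · rw [if_pos (by rw [hemp]; exact mul_le_mul_of_nonneg_left (by linarith) hnpos.le)]
    split_ifs <;> norm_num
  · rw [if_pos (c := _ ≤ ∑ i, -(if s i = a ∧ x i = b then (1 : ℝ) else 0)) (by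
      rw [Finset.sum_neg_distrib, hemp, ← mul_neg (n : ℝ)]
      exact mul_le_mul_of_nonneg_left (by linarith) hnpos.le)]
    split_ifs <;> norm_num

lemma exists_empirical_bound {S : Type*} [Fintype S] [DecidableEq S] {PS : S → ℝ}
    {PX : S → ZMod 2 → ℝ} (hPS : PS ∈ stdSimplex ℝ S) (hPX : IsKernel PX) {ε : ℝ} (hε : 0 < ε) :
    ∃ r C : ℝ, 0 < r ∧ 0 ≤ C ∧ ∀ n : ℕ, 0 < n → ∑ s : Fin n → S, ∑ x : Fin n → ZMod 2,
      (∏ i, PS (s i)) * weight (fun i => encBias PX (s i)) x *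
        ind (∃ a b, ε ≤ |empirical s x a b - PS a * PX a b|) ≤ C * Real.exp (-(r * n)) := by
  -- Needed to take the smallest of the rates over the letters.
  have hne : Nonempty S := by
    by_contra hS
    rw [not_nonempty_iff] at hS
    have := hPS.2
    simp at this
  choose r hr hb using fun ab : S × ZMod 2 => exists_empirical_bound_letter hPS hPX hε ab.1 ab.2
  obtain ⟨c, hc⟩ := Finite.exists_min r
  refine ⟨r c, Fintype.card (S × ZMod 2) * 2, hr c, by positivity, fun n hn => ?_⟩
  have hw : ∀ (s : Fin n → S) (x : Fin n → ZMod 2),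
      0 ≤ (∏ i, PS (s i)) * weight (fun i => encBias PX (s i)) x := fun s x =>
    mul_nonneg (prod_nonneg fun i _ => hPS.1 _) (weight_nonneg (fun i => kernel_mem (hPX _)) x)
  calc _ ≤ ∑ s : Fin n → S, ∑ x : Fin n → ZMod 2, ∑ ab : S × ZMod 2,
      (∏ i, PS (s i)) * weight (fun i => encBias PX (s i)) x *
        ind (ε ≤ |empirical s x ab.1 ab.2 - PS ab.1 * PX ab.1 ab.2|) := by
        refine sum_le_sum fun s _ => sum_le_sum fun x _ => ?_
        rw [← Finset.mul_sum]
        refine mul_le_mul_of_nonneg_left ?_ (hw s x)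
        by_cases he : ∃ a b, ε ≤ |empirical s x a b - PS a * PX a b|
        · obtain ⟨a, b, hab⟩ := id he
          rw [ind_true he]
          have := single_le_sum (s := univ) (f := fun ab : S × ZMod 2 =>
            ind (ε ≤ |empirical s x ab.1 ab.2 - PS ab.1 * PX ab.1 ab.2|))
            (fun _ _ => ind_nonneg _) (mem_univ (a, b))
          simp only [ind_true hab] at this
          exact this
        · rw [ind_false he]; exact sum_nonneg fun _ _ => ind_nonneg _
    _ = ∑ ab : S × ZMod 2, ∑ s : Fin n → S, ∑ x : Fin n → ZMod 2,
      (∏ i, PS (s i)) * weight (fun i => encBias PX (s i)) x *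
        ind (ε ≤ |empirical s x ab.1 ab.2 - PS ab.1 * PX ab.1 ab.2|) := by
        exact (sum_congr rfl fun s _ => sum_comm).trans sum_comm
    _ ≤ ∑ ab : S × ZMod 2, 2 * Real.exp (-(r c * n)) := by
        refine sum_le_sum fun ab _ => (hb ab n hn).trans ?_
        refine mul_le_mul_of_nonneg_left (Real.exp_le_exp.2 (neg_le_neg ?_)) (by norm_num)
        exact mul_le_mul_of_nonneg_right (hc ab) (Nat.cast_nonneg n)
    _ = _ := by
        rw [sum_const, card_univ, nsmul_eq_mul]; ring

/-- By symmetry of the parity biases, the zero vector has expected weight `2⁻ᴺ`. -/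
lemma sum_bias_weight_zero {PQ : ℝ →₀ ℝ} (hPQ : IsParityBias PQ) (N : ℕ) :
    ∑ q ∈ Fintype.piFinset (fun _ : Fin N => PQ.support), (∏ j, PQ (q j)) * weight q 0 =
      (1 / 2) ^ N := by
  have hsymm : ∑ q ∈ PQ.support, PQ q * (1 - q) = ∑ q ∈ PQ.support, PQ q * q := by
    refine Finset.sum_bij (fun q _ => 1 - q) ?_ ?_ ?_ ?_
    · intro q hq
      rw [Finsupp.mem_support_iff] at hq ⊢
      rwa [hPQ.symm]
    · intro a _ b _ h; linarith
    · intro q hq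
      refine ⟨1 - q, ?_, by ring⟩
      rw [Finsupp.mem_support_iff] at hq ⊢
      rwa [hPQ.symm]
    · intro q _
      rw [hPQ.symm]
  have hhalf : ∑ q ∈ PQ.support, PQ q * (1 - q) = 1 / 2 := by
    have : ∑ q ∈ PQ.support, PQ q * (1 - q) + ∑ q ∈ PQ.support, PQ q * q = 1 := by
      rw [← sum_add_distrib]
      exact (sum_congr rfl fun q _ => by ring).trans hPQ.sum_eq_one
    linarith
  have h := Finset.prod_univ_sum (fun _ : Fin N => PQ.support) (fun _ q => PQ q * (1 - q))
  simp only [hhalf, prod_const, card_univ, Fintype.card_fin] at h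
  rw [h]
  refine sum_congr rfl fun q _ => ?_
  rw [prod_mul_distrib]
  simp [weight]

/-! ### Reliability of the code -/

lemma two_pow_le_numNonzero {n : ℕ} (hn : 2 ≤ n) :
    (2 : ℝ) ^ n ≤ 2 * numNonzero n ∧ (2 : ℝ) ^ n ≤ 2 * (numNonzero n - 1) := by
  have : (2 : ℝ) ^ 2 ≤ 2 ^ n := pow_le_pow_right₀ (by norm_num) hn
  rw [numNonzero]
  constructor <;> linarith

/-- The price of the change of measure: θ 2ⁿ = exp(-δn), and the factor 2 covers 2ⁿ against 2ⁿ - 1.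
-/
lemma inv_threshold_le {n : ℕ} (hn : 2 ≤ n) (δ : ℝ) :
    1 / (Real.exp (-(n * (Real.log 2 + δ))) * numNonzero n) ≤ 2 * Real.exp (δ * n) := by
  have hK := numNonzero_pos hn
  have hK2 := (two_pow_le_numNonzero hn).1
  have he : Real.exp (-(n * (Real.log 2 + δ))) * 2 ^ n * Real.exp (δ * n) = 1 := by
    rw [two_pow_eq_exp, ← Real.exp_add, ← Real.exp_add, ← Real.exp_zero]
    ring_nf
  rw [div_le_iff₀ (mul_pos (Real.exp_pos _) (by linarith)), ← he]
  have := mul_le_mul_of_nonneg_left hK2 (mul_pos (Real.exp_pos (-(n * (Real.log 2 + δ))))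
    (Real.exp_pos (δ * n))).le
  nlinarith

lemma tendsto_one_div_two_pow_floor {R : ℝ} (hR : 0 < R) :
    Tendsto (fun n : ℕ => (1 : ℝ) / 2 ^ ⌊(n : ℝ) * R⌋₊) atTop (𝓝 0) := by
  have h1 : Tendsto (fun n : ℕ => ⌊(n : ℝ) * R⌋₊) atTop atTop :=
    tendsto_nat_floor_atTop.comp ((tendsto_natCast_atTop_atTop (R := ℝ)).atTop_mul_const hR)
  have h2 := (tendsto_pow_atTop_nhds_zero_of_lt_one (r := (1 / 2 : ℝ)) (by norm_num)
    (by norm_num)).comp h1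
  refine h2.congr fun n => ?_
  simp

/-- Markov's inequality for the zero competitor. The symmetry of `PQ` enters the argument here,
through the mean of `weight q 0`. -/
lemma sum_bias_ind_le {PQ : ℝ →₀ ℝ} (hPQ : IsParityBias PQ) (N : ℕ) {T : ℝ} (hT : 0 < T) :
    ∑ q ∈ Fintype.piFinset (fun _ : Fin N => PQ.support), (∏ j, PQ (q j)) * ind (T ≤ weight q 0) ≤
      (1 / 2) ^ N / T := by
  rw [← sum_bias_weight_zero hPQ, Finset.sum_div]
  refine sum_le_sum fun q hq => ?_
  rw [mul_div_assoc]
  refine mul_le_mul_of_nonneg_left (ind_le_div hT (weight_nonneg (fun i =>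
    hPQ.support_subset _ (Fintype.mem_piFinset.1 hq i)) _)) (prod_nonneg fun _ _ => hPQ.nonneg _)

lemma pair_exponent_le {n k : ℕ} (hn : 2 ≤ n) {P Q : ℝ} (hP : 0 < P) (hQ : 0 < Q)
    (h : (2 : ℝ) ^ k ≤ Q * P * (2 ^ n * 2 ^ n)) :
    2 ^ k / (P * (numNonzero n * (numNonzero n - 1))) ≤ 4 * Q := by
  have hK := numNonzero_pos hn
  have hK2 := two_pow_le_numNonzero hn
  have hKK : (2 : ℝ) ^ n * 2 ^ n ≤ 4 * (numNonzero n * (numNonzero n - 1)) := by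
    have := mul_le_mul hK2.1 hK2.2 (by positivity) (by linarith)
    linarith
  rw [div_le_iff₀ (mul_pos hP (mul_pos (by linarith) (by linarith)))]
  refine h.trans ((mul_le_mul_of_nonneg_left hKK (by positivity)).trans (le_of_eq ?_))
  ring

section Reliable

variable {S Y : Type*} [Fintype S] [Fintype Y] {PS : S → ℝ} {PX : S → ZMod 2 → ℝ}
  {W : S → ZMod 2 → Y → ℝ} {PQ : ℝ →₀ ℝ} {R : ℝ} {f : Query}

lemma tendsto_codeProb_of_bound (hPS : PS ∈ stdSimplex ℝ S) (hPQ : IsParityBias PQ)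
    (hW : IsStateChannel W) (hR : 0 < R) {pe : S → ℝ} {pd : Y → ℝ}
    {E : (n : ℕ) → (Fin ⌊(n : ℝ) * R⌋₊ → ZMod 2) → (Fin ⌊(n : ℝ) * R⌋₊ → ZMod 2) →
      (Fin n → S) → (Fin n → ZMod 2) → Prop} {u : ℕ → ℝ}
    (hu : Tendsto u atTop (𝓝 0)) {C δ : ℝ} (hδ : 0 < δ)
    (h : ∀ᶠ n : ℕ in atTop, ∀ m, m ≠ 0 →
      msgProb f PS W PQ pe pd n ⌊(n : ℝ) * R⌋₊ (E n) m ≤ u n + C * Real.exp (-(δ * n))) :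
    Tendsto (fun n : ℕ => codeProb f PS W PQ pe pd n ⌊(n : ℝ) * R⌋₊ (E n)) atTop (𝓝 0) := by
  have hlim : Tendsto (fun n : ℕ => (1 : ℝ) / 2 ^ ⌊(n : ℝ) * R⌋₊ +
      |u n + C * Real.exp (-(δ * n))|) atTop (𝓝 0) := by
    have := (tendsto_one_div_two_pow_floor hR).add
      (hu.add ((tendsto_exp_neg_mul_nat hδ).const_mul C)).abs
    simpa using this
  refine squeeze_zero' (Eventually.of_forall fun n => codeProb_nonneg hPS hPQ hW) ?_ hlim
  filter_upwards [h] with n hn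
  exact codeProb_le hPS hPQ hW (abs_nonneg _) fun m hm => (hn m hm).trans (le_abs_self _)

/-- With Δ the gap between the Gelfand–Pinsker rate and R, the thresholds T₁ and T₂ each give up Δ/4
per letter, which makes atypical weights exponentially rare and still leaves Δ/2 against the
competitors. -/
lemma tendsto_errorProb (hPS : PS ∈ stdSimplex ℝ S) (hPX : IsKernel PX) (hW : IsStateChannel W)
    (hPQ : IsParityBias PQ) (hnd : NonDegenerate PS PX PQ) (hR : 0 < R) (hR1 : R < 1)
    (hbal : ∑ s, PS s * Real.binEntropy (PX s 1) +
      (1 - R) * ∑ q ∈ PQ.support, PQ q * Real.binEntropy q = Real.log 2)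
    (hrate : R * Real.log 2 < ∑ s, PS s * Real.binEntropy (PX s 1) - decEntropy PS PX W)
    (hf : IsQuery f) :
    Tendsto (fun n : ℕ => codeProb f PS W PQ (encBias PX) (decBias PS PX W) n ⌊(n : ℝ) * R⌋₊
        (fun m m' _ _ => m ≠ m')) atTop (𝓝 0) := by
  set hx := ∑ s, PS s * Real.binEntropy (PX s 1) with hxdef
  set hq := ∑ q ∈ PQ.support, PQ q * Real.binEntropy q with hqdef
  set hy := decEntropy PS PX W with hydef
  have hpe : ∀ s, encBias PX s ∈ Set.Icc (0 : ℝ) 1 := fun s => kernel_mem (hPX s)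
  have hpd : ∀ y, decBias PS PX W y ∈ Set.Icc (0 : ℝ) 1 := decBias_mem hPS hPX hW
  have hQmem : ∀ q, PQ q ≠ 0 → q ∈ Set.Icc (0 : ℝ) 1 := fun q hq =>
    hPQ.support_subset q (Finsupp.mem_support_iff.2 hq)
  have hq0 : 0 ≤ hq := sum_nonneg fun q hq => mul_nonneg (hPQ.nonneg q)
    (Real.binEntropy_nonneg (hPQ.support_subset q hq).1 (hPQ.support_subset q hq).2)
  obtain ⟨Δ, hΔ⟩ : ∃ Δ, Δ = hx - hy - R * Real.log 2 := ⟨_, rfl⟩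
  have hΔpos : 0 < Δ := by linarith
  have hR' : 0 < 1 - R := by linarith
  obtain ⟨r₁, hr₁, hb₁⟩ := exists_decoder_weight_bound hPS hPX hW (c := hy + Δ / 4) (by linarith)
  obtain ⟨r₂, hr₂, hb₂⟩ := weight_chernoff_lt (D := PQ.support) (P := PQ) (p' := id) (p := id)
    hPQ.nonneg hPQ.sum_eq_one hQmem (fun q hq b hb =>
      lt_of_le_of_ne (bitProb_nonneg (hQmem q hq) b) hb.symm) (c := hq + Δ / 4)
    (by simp only [id, crossEntropy_self]; linarith)
  -- Every rare event is given the bound exp(-2δn), so that exp(-δn) survives the price exp(δn) of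
  -- the change of measure.
  obtain ⟨δ, hδ, hδ1, hδ2, hδ3⟩ : ∃ δ : ℝ, 0 < δ ∧ 2 * δ ≤ r₁ ∧ 2 * δ ≤ r₂ * (1 - R) ∧
      2 * δ ≤ Δ / 2 := by
    refine ⟨min (r₁ / 2) (min (r₂ * (1 - R) / 2) (Δ / 4)), ?_, ?_, ?_, ?_⟩
    · exact lt_min (by linarith) (lt_min (by have := mul_pos hr₂ hR'; linarith) (by linarith))
    · linarith [min_le_left (r₁ / 2) (min (r₂ * (1 - R) / 2) (Δ / 4))]
    · linarith [(min_le_right (r₁ / 2) (min (r₂ * (1 - R) / 2) (Δ / 4))).trans (min_le_left _ _)]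
    · linarith [(min_le_right (r₁ / 2) (min (r₂ * (1 - R) / 2) (Δ / 4))).trans (min_le_right _ _)]
  obtain ⟨u, hu, hfail⟩ := exists_failProb_bound hPS hPQ hR hR1 hpe hbal hnd hδ
  -- The three first-moment terms contribute 4 + 2 exp(hq), the competing pairs 4 exp(hq); exp(hq)
  -- comes from rounding n - k.
  refine tendsto_codeProb_of_bound hPS hPQ hW hR hu (C := 4 + 6 * Real.exp hq) hδ
    (E := fun n m m' _ _ => m ≠ m') ?_
  filter_upwards [hfail, eventually_ge_atTop 2] with n hfn hn m hm
  have hkn : ⌊(n : ℝ) * R⌋₊ ≤ n := floor_le_of_lt_one hR.le hR1.le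
  have hk : (⌊(n : ℝ) * R⌋₊ : ℝ) ≤ n * R := Nat.floor_le (by positivity)
  have hN1 : n * (1 - R) ≤ ((n - ⌊(n : ℝ) * R⌋₊ : ℕ) : ℝ) := le_sub_floor hR.le hR1.le
  have hN2 : ((n - ⌊(n : ℝ) * R⌋₊ : ℕ) : ℝ) ≤ n * (1 - R) + 1 := sub_floor_le hR.le hR1.le
  have hN3 : ((n - ⌊(n : ℝ) * R⌋₊ : ℕ) : ℝ) ≤ n := by exact_mod_cast Nat.sub_le n _
  have key := msgProb_error_le (f := f) (pe := encBias PX) (pd := decBias PS PX W) hf hPS hPQ hW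
    hpe hpd hn hkn (Real.exp_pos (-(n * (Real.log 2 + δ)))) (Real.exp_pos (-(n * (hy + Δ / 4))))
    (Real.exp_pos (-(((n - ⌊(n : ℝ) * R⌋₊ : ℕ) : ℝ) * (hq + Δ / 4)))) hm
  refine key.trans (add_le_add (hfn hkn m hm) ?_)
  have e₁ := hb₁ n
  have e₂ := hb₂ (n - ⌊(n : ℝ) * R⌋₊)
  have e₃ := sum_bias_ind_le hPQ (n - ⌊(n : ℝ) * R⌋₊) (mul_pos (Real.exp_pos (-(n * (hy + Δ / 4))))
    (Real.exp_pos (-(((n - ⌊(n : ℝ) * R⌋₊ : ℕ) : ℝ) * (hq + Δ / 4)))))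
  simp only [id] at e₂
  have hpow : (2 : ℝ) ^ ⌊(n : ℝ) * R⌋₊ = Real.exp (⌊(n : ℝ) * R⌋₊ * Real.log 2) := two_pow_eq_exp _
  have hhalf : (1 / 2 : ℝ) ^ (n - ⌊(n : ℝ) * R⌋₊) =
      Real.exp (-(((n - ⌊(n : ℝ) * R⌋₊ : ℕ) : ℝ) * Real.log 2)) := by
    rw [one_div, inv_pow, two_pow_eq_exp, ← Real.exp_neg]
  generalize ((n - ⌊(n : ℝ) * R⌋₊ : ℕ) : ℝ) = N at *
  have hn0 : (0 : ℝ) ≤ n := Nat.cast_nonneg n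
  have hL := log_two_pos
  -- The balance converts the parity entropy (1-R) hq into log 2 - hx, bringing in H(X|Y) - H(X|S).
  have hinvT : n * (hy + Δ / 4) + N * (hq + Δ / 4) ≤
      n * (hy + Δ / 2 + Real.log 2 - hx) + hq := by
    have i1 : N * hq ≤ (n * (1 - R) + 1) * hq := mul_le_mul_of_nonneg_right hN2 hq0
    have i2 : N * (Δ / 4) ≤ n * (Δ / 4) := mul_le_mul_of_nonneg_right hN3 (by linarith)
    have i3 : (n : ℝ) * ((1 - R) * hq) = n * (Real.log 2 - hx) := by
      rw [show (1 - R) * hq = Real.log 2 - hx by linarith]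
    linarith
  have e₁' : Real.exp (-(r₁ * n)) ≤ Real.exp (-(2 * δ * n)) :=
    Real.exp_le_exp.2 (neg_le_neg (mul_le_mul_of_nonneg_right hδ1 hn0))
  have e₂' : Real.exp (-(r₂ * N)) ≤ Real.exp (-(2 * δ * n)) := by
    refine Real.exp_le_exp.2 (neg_le_neg ?_)
    have i1 := mul_le_mul_of_nonneg_right hδ2 hn0
    have i2 := mul_le_mul_of_nonneg_left hN1 hr₂.le
    linarith
  have e₃' : (1 / 2 : ℝ) ^ (n - ⌊(n : ℝ) * R⌋₊) /
      (Real.exp (-(n * (hy + Δ / 4))) * Real.exp (-(N * (hq + Δ / 4)))) ≤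
      Real.exp hq * Real.exp (-(2 * δ * n)) := by
    rw [hhalf, ← Real.exp_add, ← Real.exp_sub, ← Real.exp_add]
    refine Real.exp_le_exp.2 ?_
    have i1 := mul_le_mul_of_nonneg_right hN1 hL.le
    have i2 := mul_le_mul_of_nonneg_left hδ3 hn0
    have i3 : (n : ℝ) * Δ = n * (hx - hy - R * Real.log 2) := by rw [hΔ]
    linarith
  have hlast := pair_exponent_le hn (P := Real.exp (-(n * (Real.log 2 + δ))) *
      (Real.exp (-(n * (hy + Δ / 4))) * Real.exp (-(N * (hq + Δ / 4)))))
      (Q := Real.exp hq * Real.exp (-(δ * n))) (k := ⌊(n : ℝ) * R⌋₊) (by positivity)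
      (by positivity) (by
    rw [hpow, two_pow_eq_exp]
    simp only [← Real.exp_add]
    refine Real.exp_le_exp.2 ?_
    have i1 := mul_le_mul_of_nonneg_right hk hL.le
    have i2 := mul_le_mul_of_nonneg_left hδ3 hn0
    have i3 : (n : ℝ) * Δ = n * (hx - hy - R * Real.log 2) := by rw [hΔ]
    linarith)
  have hinv := inv_threshold_le hn δ
  have hsum := add_le_add (add_le_add (e₁.trans e₁') (e₂.trans e₂')) (e₃.trans e₃')
  have hfirst := mul_le_mul hinv hsum (by
    refine add_nonneg (add_nonneg ?_ ?_) ?_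
    · exact sum_nonneg fun s _ => sum_nonneg fun x _ => sum_nonneg fun y _ =>
        mul_nonneg (mul_nonneg (mul_nonneg (prod_nonneg fun _ _ => hPS.1 _)
          (weight_nonneg (fun i => hpe _) x)) (prod_nonneg fun _ _ => (hW _ _).1 _)) (ind_nonneg _)
    · exact sum_nonneg fun q hq => sum_nonneg fun v _ => mul_nonneg (mul_nonneg
        (prod_nonneg fun _ _ => hPQ.nonneg _) (weight_nonneg (fun i =>
          hPQ.support_subset _ (Fintype.mem_piFinset.1 hq i)) v)) (ind_nonneg _)
    · exact sum_nonneg fun q _ => mul_nonneg (prod_nonneg fun _ _ => hPQ.nonneg _) (ind_nonneg _))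
    (by positivity)
  have hcomb : 2 * Real.exp (δ * n) * (Real.exp (-(2 * δ * n)) + Real.exp (-(2 * δ * n)) +
      Real.exp hq * Real.exp (-(2 * δ * n))) = (4 + 2 * Real.exp hq) * Real.exp (-(δ * n)) := by
    have : Real.exp (δ * n) * Real.exp (-(2 * δ * n)) = Real.exp (-(δ * n)) := by
      rw [← Real.exp_add]; ring_nf
    linear_combination (4 + 2 * Real.exp hq) * this
  rw [hcomb] at hfirst
  refine (add_le_add hfirst hlast).trans (le_of_eq ?_)
  ring

lemma tendsto_empirical [DecidableEq S] (hPS : PS ∈ stdSimplex ℝ S) (hPX : IsKernel PX)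
    (hW : IsStateChannel W)
    (hPQ : IsParityBias PQ) (hnd : NonDegenerate PS PX PQ) (hR : 0 < R) (hR1 : R < 1)
    (hbal : ∑ s, PS s * Real.binEntropy (PX s 1) +
      (1 - R) * ∑ q ∈ PQ.support, PQ q * Real.binEntropy q = Real.log 2)
    (hf : IsQuery f) {ε : ℝ} (hε : 0 < ε) :
    Tendsto (fun n : ℕ => codeProb f PS W PQ (encBias PX) (decBias PS PX W) n ⌊(n : ℝ) * R⌋₊
        (fun _ _ s x => ∃ a b, ε ≤ |empirical s x a b - PS a * PX a b|)) atTop (𝓝 0) := by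
  have hpe : ∀ s, encBias PX s ∈ Set.Icc (0 : ℝ) 1 := fun s => kernel_mem (hPX s)
  obtain ⟨r, C, hr, hC, hb⟩ := exists_empirical_bound hPS hPX hε
  -- With δ = r/2 the price exp(rn/2) is beaten by the Chernoff bound exp(-rn).
  have hδ : 0 < r / 2 := by linarith
  obtain ⟨u, hu, hfail⟩ := exists_failProb_bound hPS hPQ hR hR1 hpe hbal hnd hδ
  refine tendsto_codeProb_of_bound hPS hPQ hW hR hu (C := 2 * C) hδ
    (E := fun n _ _ s x => ∃ a b, ε ≤ |empirical s x a b - PS a * PX a b|) ?_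
  filter_upwards [hfail, eventually_ge_atTop 2] with n hfn hn m hm
  have hkn : ⌊(n : ℝ) * R⌋₊ ≤ n := floor_le_of_lt_one hR.le hR1.le
  have key := msgProb_state_le (f := f) (pe := encBias PX) (pd := decBias PS PX W) hf hPS hPQ hW
    hpe hn hkn (Real.exp_pos (-(n * (Real.log 2 + r / 2)))) hm
    (fun s x => ∃ a b, ε ≤ |empirical s x a b - PS a * PX a b|)
  refine key.trans (add_le_add (hfn hkn m hm) ?_)
  have hinv := inv_threshold_le hn (r / 2)
  refine (mul_le_mul hinv (hb n (by omega)) (sum_nonneg fun s _ => sum_nonneg fun x _ =>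
    mul_nonneg (mul_nonneg (prod_nonneg fun _ _ => hPS.1 _)
      (weight_nonneg (fun i => hpe _) x)) (ind_nonneg _)) (by positivity)).trans (le_of_eq ?_)
  have : Real.exp (r / 2 * n) * Real.exp (-(r * n)) = Real.exp (-(r / 2 * n)) := by
    rw [← Real.exp_add]; ring_nf
  linear_combination 2 * C * this

lemma binEntropy_sum_le (hPS : PS ∈ stdSimplex ℝ S) :
    ∑ s, PS s * Real.binEntropy (PX s 1) ≤ Real.log 2 := by
  calc _ ≤ ∑ s, PS s * Real.log 2 := sum_le_sum fun s _ =>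
        mul_le_mul_of_nonneg_left Real.binEntropy_le_log_two (hPS.1 s)
    _ = _ := by rw [← Finset.sum_mul, hPS.2, one_mul]

/-- The rate is H(X|S) - H(X|Y) ≤ H(X|S) ≤ 1. In particular R < 1, so the division by 1 - R is
meaningful. -/
lemma rate_lt_condEntropy (hPS : PS ∈ stdSimplex ℝ S) (hPX : IsKernel PX)
    (hW : IsStateChannel W)
    (hrate : R < mutualInfo (jointXY PS PX W) - mutualInfo (jointXS PS PX)) :
    R < condEntropy PS PX ∧ condEntropy PS PX ≤ 1 := by
  have hL := log_two_pos
  have h1 := mul_lt_mul_of_pos_right hrate hL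
  rw [rate_mul_log_two hPS hPX hW] at h1
  have h2 := decEntropy_nonneg hPS hPX hW
  have h3 := condEntropy_binary (PS := PS) hPX
  have h4 := binEntropy_sum_le (PX := PX) hPS
  constructor
  · exact lt_of_mul_lt_mul_right (by linarith) hL.le
  · exact le_of_mul_le_mul_right (by linarith) hL

theorem reliable [DecidableEq S] (hPS : PS ∈ stdSimplex ℝ S) (hPX : IsKernel PX)
    (hW : IsStateChannel W)
    (hPQ : IsParityBias PQ) (hnd : NonDegenerate PS PX PQ) (hR : 0 < R)
    (hQ : meanBinEntropy PQ = (1 - condEntropy PS PX) / (1 - R))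
    (hrate : R < mutualInfo (jointXY PS PX W) - mutualInfo (jointXS PS PX)) :
    Reliable R PS PX W PQ := by
  obtain ⟨h1, h2⟩ := rate_lt_condEntropy hPS hPX hW hrate
  have hR1 : R < 1 := by linarith
  have hR' : (1 - R) ≠ 0 := by linarith
  have hbal : ∑ s, PS s * Real.binEntropy (PX s 1) +
      (1 - R) * ∑ q ∈ PQ.support, PQ q * Real.binEntropy q = Real.log 2 := by
    rw [← condEntropy_binary hPX, ← meanBinEntropy_mul, hQ]
    field_simp
    ring
  have hrate' := mul_lt_mul_of_pos_right hrate log_two_pos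
  rw [rate_mul_log_two hPS hPX hW] at hrate'
  exact fun f hf => ⟨tendsto_errorProb hPS hPX hW hPQ hnd hR hR1 hbal hrate' hf,
    fun ε hε => tendsto_empirical hPS hPX hW hPQ hnd hR hR1 hbal hf hε⟩

/-! ### Choice of the parity bias distribution -/

/-- The distribution which is uniform on `{a, 1 - a}`. -/
noncomputable def twoPoint (a : ℝ) : ℝ →₀ ℝ :=
  Finsupp.single a (1 / 2) + Finsupp.single (1 - a) (1 / 2)

lemma twoPoint_sum (a : ℝ) (φ : ℝ → ℝ) :
    ∑ q ∈ (twoPoint a).support, twoPoint a q * φ q = (φ a + φ (1 - a)) / 2 := by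
  have h : ∑ q ∈ (twoPoint a).support, twoPoint a q * φ q = (twoPoint a).sum fun q w => w * φ q :=
    rfl
  rw [h, twoPoint, Finsupp.sum_add_index' (by simp) (by intros; ring), Finsupp.sum_single_index
    (by simp), Finsupp.sum_single_index (by simp)]
  ring

lemma isParityBias_twoPoint {a : ℝ} (ha : a ∈ Set.Icc (0 : ℝ) 1) : IsParityBias (twoPoint a) := by
  classical
  refine ⟨fun q => ?_, fun q hq => ?_, ?_, fun q => ?_⟩
  · simp only [twoPoint, Finsupp.add_apply, Finsupp.single_apply]
    split_ifs <;> norm_num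
  · rw [Finsupp.mem_support_iff] at hq
    simp only [twoPoint, Finsupp.add_apply, Finsupp.single_apply] at hq
    by_cases h1 : a = q
    · rw [← h1]; exact ha
    · by_cases h2 : 1 - a = q
      · rw [← h2]; exact ⟨by linarith [ha.2], by linarith [ha.1]⟩
      · simp [h1, h2] at hq
  · have := twoPoint_sum a (fun _ => 1)
    simpa using this
  · simp only [twoPoint, Finsupp.add_apply, Finsupp.single_apply]
    have e1 : a = 1 - q ↔ 1 - a = q := by constructor <;> intro h <;> linarith
    have e2 : 1 - a = 1 - q ↔ a = q := by constructor <;> intro h <;> linarith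
    simp only [e1, e2]
    ring

/-- The target value c lies in [0, 1), so the intermediate value theorem gives a in [0, 1/2] with
H_b(a) = c, and c < 1 excludes a = 1/2. For c > 0 also a ≠ 0, which is non-degeneracy through Q. -/
lemma exists_parityBias (hPS : PS ∈ stdSimplex ℝ S) (hPX : IsKernel PX) (hR : R < condEntropy PS PX)
    (h1 : condEntropy PS PX ≤ 1) :
    ∃ PQ : ℝ →₀ ℝ, IsParityBias PQ ∧ meanBinEntropy PQ = (1 - condEntropy PS PX) / (1 - R) ∧
      NonDegenerate PS PX PQ := by
  have hL := log_two_pos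
  set c := (1 - condEntropy PS PX) / (1 - R) with hc
  have hR' : 0 < 1 - R := by linarith
  have hc0 : 0 ≤ c := div_nonneg (by linarith) hR'.le
  have hc1 : c < 1 := (div_lt_one hR').2 (by linarith)
  obtain ⟨a, ha, hac⟩ : ∃ a ∈ Set.Icc (0 : ℝ) (1 / 2), Real.binEntropy a = c * Real.log 2 := by
    have := intermediate_value_Icc (show (0 : ℝ) ≤ 1 / 2 by norm_num)
      (Real.binEntropy_continuous.continuousOn)
    rw [Real.binEntropy_zero, one_div, Real.binEntropy_two_inv] at this
    obtain ⟨a, ha, h⟩ := this ⟨mul_nonneg hc0 hL.le, mul_le_of_le_one_left hL.le hc1.le⟩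
    exact ⟨a, by simpa using ha, h⟩
  have haI : a ∈ Set.Icc (0 : ℝ) 1 := ⟨ha.1, by linarith [ha.2]⟩
  refine ⟨twoPoint a, isParityBias_twoPoint haI, ?_, ?_⟩
  · rw [meanBinEntropy, twoPoint_sum, Real.binEntropy_one_sub, hac]
    field_simp
    ring
  · by_cases hcz : c = 0
    -- If c = 0 then H(X|S) = 1, so every codeword bias of positive probability has maximal entropy
    -- and is neither 0 nor 1.
    · right; right
      have hH : condEntropy PS PX = 1 := by
        rw [hc, div_eq_zero_iff] at hcz
        rcases hcz with h | h <;> linarith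
      have hsum : ∑ s, PS s * (Real.log 2 - Real.binEntropy (PX s 1)) = 0 := by
        simp_rw [mul_sub, sum_sub_distrib, ← Finset.sum_mul, hPS.2, ← condEntropy_binary hPX, hH]
        ring
      rw [Finset.sum_eq_zero_iff_of_nonneg (fun s _ => mul_nonneg (hPS.1 s)
        (by linarith [Real.binEntropy_le_log_two (p := PX s 1)]))] at hsum
      intro s hs hmem
      have h := (mul_eq_zero.1 (hsum s (mem_univ s))).resolve_left hs
      simp only [Set.mem_insert_iff, Set.mem_singleton_iff] at hmem
      have h0 := Real.binEntropy_eq_zero.2 hmem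
      linarith
    · right; left
      refine ⟨a, ?_, ?_⟩
      · rw [Finsupp.mem_support_iff, twoPoint, Finsupp.add_apply, Finsupp.single_eq_same]
        have : 0 ≤ (Finsupp.single (1 - a) (1 / 2 : ℝ)) a := by
          classical
          rw [Finsupp.single_apply]; split_ifs <;> norm_num
        linarith
      · intro hmem
        simp only [Set.mem_insert_iff, Set.mem_singleton_iff] at hmem
        rcases hmem with h | h | h
        · rw [h, Real.binEntropy_zero] at hac
          exact (mul_ne_zero hcz hL.ne') hac.symm
        · rw [h, one_div, Real.binEntropy_two_inv] at hac
          nlinarith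
        · linarith [ha.2]

end Reliable

end WPC

/-! ### The three claims -/

theorem mainTheorem2 {S A Y : Type*} [Fintype S] [DecidableEq S] [Fintype Y]
    (PS : S → ℝ) (hPS : PS ∈ stdSimplex ℝ S) (R : ℝ) (hR : 0 < R) :
    -- the code with given `P_{X|S}` and `P_Q`
    (∀ (PX : S → ZMod 2 → ℝ) (W : S → ZMod 2 → Y → ℝ) (PQ : ℝ →₀ ℝ),
      WPC.IsKernel PX → WPC.IsStateChannel W → WPC.IsParityBias PQ →
      WPC.NonDegenerate PS PX PQ →
      WPC.meanBinEntropy PQ = (1 - WPC.condEntropy PS PX) / (1 - R) →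
      R < WPC.mutualInfo (WPC.jointXY PS PX W) - WPC.mutualInfo (WPC.jointXS PS PX) →
      WPC.Reliable R PS PX W PQ) ∧
    -- every rate below the Gelfand–Pinsker expression with binary auxiliary is achieved
    (∀ W : S → A → Y → ℝ, WPC.IsStateChannel W → R < WPC.gelfandPinsker (ZMod 2) PS W →
      ∃ (PU : S → ZMod 2 → ℝ) (g : ZMod 2 → S → A) (PQ : ℝ →₀ ℝ),
        WPC.IsKernel PU ∧ WPC.IsParityBias PQ ∧
        WPC.meanBinEntropy PQ = (1 - WPC.condEntropy PS PU) / (1 - R) ∧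
        WPC.Reliable R PS PU (WPC.auxChannel W g) PQ) ∧
    -- every rate below the capacity of a binary-input channel without state is achieved
    (∀ W : ZMod 2 → Y → ℝ, WPC.IsKernel W → R < WPC.shannonCapacity W →
      ∃ (PX : ZMod 2 → ℝ) (PQ : ℝ →₀ ℝ),
        PX ∈ stdSimplex ℝ (ZMod 2) ∧ WPC.IsParityBias PQ ∧
        WPC.meanBinEntropy PQ = (1 - WPC.entropy PX) / (1 - R) ∧
        WPC.Reliable R (fun _ : Unit => 1) (fun _ => PX) (fun _ => W) PQ) := by
  refine ⟨fun PX W PQ hPX hW hPQ hnd hQ hrate => WPC.reliable hPS hPX hW hPQ hnd hR hQ hrate,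
    fun W hW hlt => ?_, fun W hW hlt => ?_⟩
  -- Were the set empty, for instance with no input letters, its supremum would be 0 by convention,
  -- contradicting 0 < R.
  · have hne : {r | ∃ (PU : S → ZMod 2 → ℝ) (g : ZMod 2 → S → A), WPC.IsKernel PU ∧
        r = WPC.gpRate PS PU (WPC.auxChannel W g)}.Nonempty := by
      by_contra h
      rw [Set.not_nonempty_iff_eq_empty] at h
      rw [WPC.gelfandPinsker, h, Real.sSup_empty] at hlt
      linarith
    obtain ⟨r, ⟨PU, g, hPU, rfl⟩, hr⟩ := exists_lt_of_lt_csSup hne hlt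
    have hW' : WPC.IsStateChannel (WPC.auxChannel W g) := fun s u => hW s (g u s)
    obtain ⟨h1, h2⟩ := WPC.rate_lt_condEntropy hPS hPU hW' hr
    obtain ⟨PQ, hPQ, hQ, hnd⟩ := WPC.exists_parityBias hPS hPU h1 h2
    exact ⟨PU, g, PQ, hPU, hPQ, hQ, WPC.reliable hPS hPU hW' hPQ hnd hR hQ hr⟩
  · have hne : {r | ∃ PX ∈ stdSimplex ℝ (ZMod 2),
        r = WPC.mutualInfo (fun x y => PX x * W x y)}.Nonempty := by
      by_contra h
      rw [Set.not_nonempty_iff_eq_empty] at h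
      rw [WPC.shannonCapacity, h, Real.sSup_empty] at hlt
      linarith
    obtain ⟨r, ⟨PX, hPX, rfl⟩, hr⟩ := exists_lt_of_lt_csSup hne hlt
    -- A channel without state is one with a single state; then I(X;S) = 0 and H(X|S) = H(X).
    have hU : (fun _ : Unit => (1 : ℝ)) ∈ stdSimplex ℝ Unit := ⟨fun _ => zero_le_one, by simp⟩
    have hK : WPC.IsKernel (fun _ : Unit => PX) := fun _ => hPX
    have hW' : WPC.IsStateChannel (fun _ : Unit => W) := fun _ => hW
    have hXS : WPC.mutualInfo (WPC.jointXS (fun _ : Unit => (1 : ℝ)) (fun _ => PX)) = 0 := by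
      rw [WPC.mutualInfo, WPC.entropy_joint hK]
      simp [WPC.jointXS, WPC.entropy, WPC.condEntropy, hPX.2]
    have hXY : WPC.jointXY (fun _ : Unit => (1 : ℝ)) (fun _ => PX) (fun _ => W) =
        fun x y => PX x * W x y := by
      ext x y; simp [WPC.jointXY]
    have hrate : R < WPC.mutualInfo (WPC.jointXY (fun _ : Unit => (1 : ℝ)) (fun _ => PX)
        (fun _ => W)) - WPC.mutualInfo (WPC.jointXS (fun _ : Unit => (1 : ℝ)) (fun _ => PX)) := by
      rw [hXS, hXY, sub_zero]; exact hr
    obtain ⟨h1, h2⟩ := WPC.rate_lt_condEntropy hU hK hW' hrate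
    obtain ⟨PQ, hPQ, hQ, hnd⟩ := WPC.exists_parityBias hU hK h1 h2
    have hce : WPC.condEntropy (fun _ : Unit => (1 : ℝ)) (fun _ => PX) = WPC.entropy PX := by
      simp [WPC.condEntropy]
    refine ⟨PX, PQ, hPX, hPQ, by rw [hQ, hce], WPC.reliable hU hK hW' hPQ hnd hR hQ hrate⟩
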